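/- **Theorem.** An instance consists of an interval graph $G=(V,E)$ on $n\ge 1$ vertices, a color assignment $\gamma\colon V\to\{1,\dots,k\}$ (adjacent vertices may have the same color, and not every color need occur), and an integer $f\ge 0$. An *$f$-balanced independent set* of $G$ is an independent set $L\subseteq V$ that contains exactly $f$ vertices of each of the $k$ colors. Let $\tau(G)$ denote the vertex cover number of $G$, i.e. the minimum size of a vertex cover of $G$. There is an algorithm that, given $k$, $f$, $\gamma$ and the adjacency lists of $G$, computes an $f$-balanced independent set of $G$ or determines that no such set exists, in $O(2^{\tau(G)}\cdot n)$ time, where the implied constant is absolute. Time is measured as the number of unit-cost steps on a word RAM whose word length is at least logarithmic in the sum of the input length, $k$ and $f$. -/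

import Mathlib

/-! ### Interval graphs, balanced independent sets -/

/-- `G` is an interval graph: one can assign to each vertex a (nonempty, possibly unbounded, open,
closed or half-open) interval of the real line such that two distinct vertices are adjacent exactly
when their intervals meet. -/
def IsIntervalGraph {V : Type*} (G : SimpleGraph V) : Prop :=
  ∃ J : V → Set ℝ, (∀ v, (J v).Nonempty ∧ (J v).OrdConnected) ∧
    ∀ u v, u ≠ v → (G.Adj u v ↔ (J u ∩ J v).Nonempty)

/-- `L` is an `f`-balanced independent set of `G` for the color assignment `γ`: it is independent
and contains exactly `f` vertices of each of the `k` colors. -/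
def IsBalancedIndepSet {V : Type*} (G : SimpleGraph V) {k : ℕ} (γ : V → Fin k) (f : ℕ)
    (L : Finset V) : Prop :=
  G.IsIndepSet (L : Set V) ∧ ∀ c : Fin k, (L.filter fun v => γ v = c).card = f

/-! ### A word RAM with unit-cost steps

The machine has registers and a random access memory whose cells are numbered by natural numbers.
Everything is computed on words of `w` bits. Its programs are finite structured programs. The
primitive operations are constants, addition modulo `2 ^ w`, truncated subtraction, comparison, and
indirect reading and writing of memory; each of them takes one unit of time. There is no
multiplication, no division and no bit-parallel operation. -/

namespace WordRAM

/-- The contents of the registers and of the memory. -/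
structure State where
  reg : ℕ → ℕ
  mem : ℕ → ℕ

/-- Arithmetic expressions. `load a` is the content of the memory cell with address `a`. -/
inductive Exp where
  | const (c : ℕ)
  | reg (r : ℕ)
  | load (a : Exp)
  | add (a b : Exp)
  | sub (a b : Exp)
  | lt (a b : Exp)
  | eq (a b : Exp)

/-- The value of an expression, for words of `w` bits. Comparisons yield `1` or `0`. -/
def Exp.eval (w : ℕ) (s : State) : Exp → ℕ
  | .const c => c % 2 ^ w
  | .reg r => s.reg r
  | .load a => s.mem (a.eval w s)
  | .add a b => (a.eval w s + b.eval w s) % 2 ^ w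
  | .sub a b => a.eval w s - b.eval w s
  | .lt a b => if a.eval w s < b.eval w s then 1 else 0
  | .eq a b => if a.eval w s = b.eval w s then 1 else 0

/-- The time for evaluating an expression: the number of its primitive operations. -/
def Exp.cost : Exp → ℕ
  | .const _ => 1
  | .reg _ => 1
  | .load a => a.cost + 1
  | .add a b => a.cost + b.cost + 1
  | .sub a b => a.cost + b.cost + 1
  | .lt a b => a.cost + b.cost + 1
  | .eq a b => a.cost + b.cost + 1

/-- Programs. Conditions are expressions; a condition holds when its value is not `0`. -/
inductive Prog where
  | skip
  | assign (r : ℕ) (e : Exp)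
  | store (a e : Exp)
  | seq (p q : Prog)
  | ite (e : Exp) (p q : Prog)
  | loop (e : Exp) (p : Prog)

/-- `Exec w p s t s'`: with words of `w` bits, the program `p` started in the state `s` halts after
exactly `t` units of time in the state `s'`. The program `loop e p` executes `p` as long as `e`
holds, and each test of `e` is paid for. -/
inductive Exec (w : ℕ) : Prog → State → ℕ → State → Prop where
  | skip (s : State) : Exec w .skip s 1 s
  | assign (r : ℕ) (e : Exp) (s : State) :
      Exec w (.assign r e) s (e.cost + 1)
        { reg := Function.update s.reg r (e.eval w s), mem := s.mem }
  | store (a e : Exp) (s : State) :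
      Exec w (.store a e) s (a.cost + e.cost + 1)
        { reg := s.reg, mem := Function.update s.mem (a.eval w s) (e.eval w s) }
  | seq {p q : Prog} {s₁ s₂ s₃ : State} {t₁ t₂ : ℕ} :
      Exec w p s₁ t₁ s₂ → Exec w q s₂ t₂ s₃ → Exec w (.seq p q) s₁ (t₁ + t₂) s₃
  | ite_true {e : Exp} {p q : Prog} {s s' : State} {t : ℕ} :
      e.eval w s ≠ 0 → Exec w p s t s' → Exec w (.ite e p q) s (e.cost + 1 + t) s'
  | ite_false {e : Exp} {p q : Prog} {s s' : State} {t : ℕ} :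
      e.eval w s = 0 → Exec w q s t s' → Exec w (.ite e p q) s (e.cost + 1 + t) s'
  | loop_true {e : Exp} {p : Prog} {s₁ s₂ s₃ : State} {t₁ t₂ : ℕ} :
      e.eval w s₁ ≠ 0 → Exec w p s₁ t₁ s₂ → Exec w (.loop e p) s₂ t₂ s₃ →
        Exec w (.loop e p) s₁ (e.cost + 1 + t₁ + t₂) s₃
  | loop_false {e : Exp} {p : Prog} {s : State} :
      e.eval w s = 0 → Exec w (.loop e p) s (e.cost + 1) s

/-- The initial state for an input, which is a list of words: the input stands in the first memory
cells, and the other memory cells and all registers hold `0`. -/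
def init (input : List ℕ) : State where
  reg := fun _ => 0
  mem := fun i => input.getD i 0

end WordRAM

/-! ### Input and output of the problem -/

/-- `adj` is an adjacency list representation of `G`: `adj v` lists the neighbors of `v` in some
order, each of them once. -/
def IsAdjacencyLists {n : ℕ} (G : SimpleGraph (Fin n)) (adj : Fin n → List (Fin n)) : Prop :=
  ∀ v, (adj v).Nodup ∧ ∀ u, u ∈ adj v ↔ G.Adj v u

/-- The input: the numbers `n`, `k` and `f`, then the colors of the vertices `0, …, n - 1`, then
their degrees, then their adjacency lists one after the other. -/
def encodeInput {n k : ℕ} (f : ℕ) (γ : Fin n → Fin k) (adj : Fin n → List (Fin n)) : List ℕ :=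
  [n, k, f] ++ List.ofFn (fun v => (γ v : ℕ)) ++ List.ofFn (fun v => (adj v).length) ++
    (List.ofFn fun v => (adj v).map fun u : Fin n => (u : ℕ)).flatten

/-- The vertex set that a final state describes: its characteristic vector stands in `n` consecutive
memory cells, and register `1` holds the address of the first of them. -/
def outputSet (n : ℕ) (s : WordRAM.State) : Finset (Fin n) :=
  Finset.univ.filter fun v => s.mem (s.reg 1 + (v : ℕ)) ≠ 0

/-- The answer in the final state `s` is correct: either register `0` holds `1` and the set that is
output is an `f`-balanced independent set of `G`, or register `0` holds `0` and `G` has no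
`f`-balanced independent set. -/
def CorrectAnswer {n k : ℕ} (G : SimpleGraph (Fin n)) (γ : Fin n → Fin k) (f : ℕ)
    (s : WordRAM.State) : Prop :=
  (s.reg 0 = 1 ∧ IsBalancedIndepSet G γ f (outputSet n s)) ∨
    (s.reg 0 = 0 ∧ ¬ ∃ L : Finset (Fin n), IsBalancedIndepSet G γ f L)

/-! Let X be a vertex cover of size b. The vertices outside X are pairwise nonadjacent. Hence, once
the intersection S of the desired set with X is fixed and independent, every vertex outside X
without a neighbor in S may be added independently of the others, and only the number of added
vertices per color matters. Adding such free vertices greedily, each as long as its color has fewer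
than f selected vertices, decides in O(n) time whether S extends to a balanced set
(`balanced_selected`, `not_wrong_of_balanced`). Trying all subsets of X costs O(2^b n).

A cover of minimum size comes from branching: an uncovered edge must have one of its two ends in the
cover. The depth bound b is raised from 0 until the branching succeeds, which happens at the latest
at the size of a given cover (`not_agree_of_uncovered`); the costs O(2^b n) form a geometric sum.

Both searches are instances of one backtracking search through all bit sequences of length b
(`Strategy.runs_search`). Its completeness is lexicographic: a hypothetical solution prescribes a
bit for every pair on the stack, and the branch it prescribes is never passed without success
(`inv_push`, `inv_leaf`, `inv_back`). Its running time is O(n) per node of the binary tree. Since a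
graph may have far more than n edges, no node may scan all of them: the search keeps, for every
vertex, the number of its chosen neighbors, and a vertex with an uncovered edge is recognized by
comparing this number with its degree (`nbrs_eq_sum`, `runs_findVertex`, `runs_findEdge`).

Loops over colors are affordable when k ≤ n; for k > n the answer depends only on whether f = 0
(`not_balanced`). Correctness is proved for array programs together with a count of loop iterations;
`AExec.exists_exec` turns that count into machine time with a factor that depends on the program
only. -/

/-! ### Array programs

A small language on top of the word RAM. Its states have registers, the input region, which can be
overwritten, and sixteen unbounded arrays. Array `j` occupies the memory cells `N + 16 * i + j`,
where the input region consists of the first `N` cells and register `2` holds `N`. -/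

namespace ArrayRAM

open WordRAM

/-- States of array programs. -/
structure ASt where
  reg : ℕ → ℕ
  inp : ℕ → ℕ
  arr : ℕ → ℕ → ℕ

namespace ASt

/-- Overwrite a register. -/
def setReg (σ : ASt) (r x : ℕ) : ASt := { σ with reg := Function.update σ.reg r x }

/-- Overwrite an array entry. -/
def setArr (σ : ASt) (j i x : ℕ) : ASt :=
  { σ with arr := Function.update σ.arr j (Function.update (σ.arr j) i x) }

/-- Overwrite a cell of the input region. -/
def setInp (σ : ASt) (a x : ℕ) : ASt := { σ with inp := Function.update σ.inp a x }

@[simp] theorem setReg_reg (σ : ASt) (r x r' : ℕ) :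
    (σ.setReg r x).reg r' = if r' = r then x else σ.reg r' := by
  simp [setReg, Function.update_apply]

@[simp] theorem setReg_inp (σ : ASt) (r x : ℕ) : (σ.setReg r x).inp = σ.inp := rfl

@[simp] theorem setReg_arr (σ : ASt) (r x : ℕ) : (σ.setReg r x).arr = σ.arr := rfl

@[simp] theorem setArr_reg (σ : ASt) (j i x : ℕ) : (σ.setArr j i x).reg = σ.reg := rfl

@[simp] theorem setArr_inp (σ : ASt) (j i x : ℕ) : (σ.setArr j i x).inp = σ.inp := rfl

@[simp] theorem setArr_arr (σ : ASt) (j i x j' : ℕ) :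
    (σ.setArr j i x).arr j' = if j' = j then Function.update (σ.arr j) i x else σ.arr j' := by
  simp [setArr, Function.update_apply]

@[simp] theorem setInp_reg (σ : ASt) (a x : ℕ) : (σ.setInp a x).reg = σ.reg := rfl

@[simp] theorem setInp_arr (σ : ASt) (a x : ℕ) : (σ.setInp a x).arr = σ.arr := rfl

@[simp] theorem setInp_inp (σ : ASt) (a x : ℕ) :
    (σ.setInp a x).inp = Function.update σ.inp a x := rfl

/-- The word RAM state that represents a state of array programs. -/
def toState (N : ℕ) (σ : ASt) : State where
  reg := σ.reg
  mem := fun a => if a < N then σ.inp a else σ.arr ((a - N) % 16) ((a - N) / 16)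

theorem toState_setReg (N : ℕ) (σ : ASt) (r x : ℕ) :
    (σ.setReg r x).toState N =
      { reg := Function.update (σ.toState N).reg r x, mem := (σ.toState N).mem } := rfl

/-- Since `j < 16`, quotient and remainder modulo 16 recover the index and the array from an address
beyond the input region, so the interleaved arrays never collide. -/
theorem toState_setArr (N : ℕ) (σ : ASt) {j : ℕ} (hj : j < 16) (i x : ℕ) :
    (σ.setArr j i x).toState N =
      { reg := (σ.toState N).reg,
        mem := Function.update (σ.toState N).mem (16 * i + (N + j)) x } := by
  simp only [toState, setArr_arr, setArr_reg, setArr_inp, State.mk.injEq, true_and]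
  funext a
  by_cases ha : a = 16 * i + (N + j)
  · subst ha
    have h1 : ¬ 16 * i + (N + j) < N := by omega
    have h2 : (16 * i + (N + j) - N) % 16 = j := by omega
    have h3 : (16 * i + (N + j) - N) / 16 = i := by omega
    simp [h1, h2, h3]
  · rw [Function.update_of_ne ha]
    by_cases haN : a < N
    · simp [haN]
    · simp only [haN, if_false]
      by_cases hj' : (a - N) % 16 = j
      · have : (a - N) / 16 ≠ i := by omega
        simp [hj', Function.update_of_ne this]
      · simp [hj']

theorem toState_setInp (N : ℕ) (σ : ASt) {a : ℕ} (ha : a < N) (x : ℕ) :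
    (σ.setInp a x).toState N =
      { reg := (σ.toState N).reg, mem := Function.update (σ.toState N).mem a x } := by
  simp only [toState, setInp_arr, setInp_reg, setInp_inp, State.mk.injEq, true_and]
  funext b
  by_cases hb : b = a
  · subst hb; simp [ha]
  · simp [Function.update_of_ne hb]

end ASt

/-- Expressions of array programs. -/
inductive AExp where
  | const (c : ℕ)
  | var (r : ℕ)
  | inp (a : AExp)
  | get (j : ℕ) (i : AExp)
  | add (a b : AExp)
  | sub (a b : AExp)
  | lt (a b : AExp)
  | eq (a b : AExp)

namespace AExp

/-- The value of an expression. -/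
def eval (σ : ASt) : AExp → ℕ
  | const c => c
  | var r => σ.reg r
  | inp a => σ.inp (a.eval σ)
  | get j i => σ.arr j (i.eval σ)
  | add a b => a.eval σ + b.eval σ
  | sub a b => a.eval σ - b.eval σ
  | lt a b => if a.eval σ < b.eval σ then 1 else 0
  | eq a b => if a.eval σ = b.eval σ then 1 else 0

/-- The expression can be evaluated without overflow. -/
def Ok (N B : ℕ) (σ : ASt) : AExp → Prop
  | const c => c < B
  | var _ => True
  | inp a => a.Ok N B σ ∧ a.eval σ < N
  | get j i => i.Ok N B σ ∧ σ.reg 2 = N ∧ j < 16 ∧ 16 * i.eval σ + 16 + N ≤ B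
  | add a b => a.Ok N B σ ∧ b.Ok N B σ ∧ a.eval σ + b.eval σ < B
  | sub a b => a.Ok N B σ ∧ b.Ok N B σ
  | lt a b => a.Ok N B σ ∧ b.Ok N B σ
  | eq a b => a.Ok N B σ ∧ b.Ok N B σ

/-- The word RAM expression for the address of an array entry. -/
def addr (j : ℕ) (i : Exp) : Exp :=
  let i₂ := Exp.add i i
  let i₄ := Exp.add i₂ i₂
  let i₈ := Exp.add i₄ i₄
  .add (.add i₈ i₈) (.add (.reg 2) (.const j))

/-- Translation of expressions. -/
def compile : AExp → Exp
  | const c => .const c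
  | var r => .reg r
  | inp a => .load a.compile
  | get j i => .load (addr j i.compile)
  | add a b => .add a.compile b.compile
  | sub a b => .sub a.compile b.compile
  | lt a b => .lt a.compile b.compile
  | eq a b => .eq a.compile b.compile

/-- The machine cannot multiply, so the factor 16 is produced by four doublings. The bound on `16 *
x + 16 + N` keeps all partial sums below the word size. -/
theorem eval_addr {N w : ℕ} {σ : ASt} {j x : ℕ} {i : Exp} (hi : i.eval w (σ.toState N) = x)
    (hN : σ.reg 2 = N) (hj : j < 16) (hx : 16 * x + 16 + N ≤ 2 ^ w) :
    (addr j i).eval w (σ.toState N) = 16 * x + (N + j) := by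
  have hr : (σ.toState N).reg 2 = N := hN
  simp only [addr, Exp.eval, hi, hr]
  rw [Nat.mod_eq_of_lt (a := x + x) (by omega), Nat.mod_eq_of_lt (a := x + x + (x + x)) (by omega),
    Nat.mod_eq_of_lt (a := x + x + (x + x) + (x + x + (x + x))) (by omega),
    Nat.mod_eq_of_lt (a := x + x + (x + x) + (x + x + (x + x)) +
      (x + x + (x + x) + (x + x + (x + x)))) (by omega),
    Nat.mod_eq_of_lt (a := j) (by omega), Nat.mod_eq_of_lt (a := N + j) (by omega),
    Nat.mod_eq_of_lt (by omega)]
  omega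

theorem eval_compile {N w : ℕ} {σ : ASt} {e : AExp} (h : e.Ok N (2 ^ w) σ) :
    e.compile.eval w (σ.toState N) = e.eval σ := by
  induction e with
  | const c => exact Nat.mod_eq_of_lt h
  | var r => rfl
  | inp a ih =>
    simp only [compile, Exp.eval, ih h.1, eval]
    simp [ASt.toState, h.2]
  | get j i ih =>
    obtain ⟨h1, h2, h3, h4⟩ := h
    simp only [compile, Exp.eval, eval_addr (ih h1) h2 h3 h4, eval]
    have e1 : ¬ 16 * eval σ i + (N + j) < N := by omega
    have e2 : (16 * eval σ i + (N + j) - N) % 16 = j := by omega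
    have e3 : (16 * eval σ i + (N + j) - N) / 16 = eval σ i := by omega
    simp [ASt.toState, e1, e2, e3]
  | add a b iha ihb =>
    simp only [compile, Exp.eval, iha h.1, ihb h.2.1, eval]
    exact Nat.mod_eq_of_lt h.2.2
  | sub a b iha ihb => simp only [compile, Exp.eval, iha h.1, ihb h.2, eval]
  | lt a b iha ihb => simp only [compile, Exp.eval, iha h.1, ihb h.2, eval]
  | eq a b iha ihb => simp only [compile, Exp.eval, iha h.1, ihb h.2, eval]

end AExp

/-- Array programs. -/
inductive AProg where
  | skip
  | assign (r : ℕ) (e : AExp)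
  | set (j : ℕ) (i e : AExp)
  | put (a e : AExp)
  | seq (p q : AProg)
  | ite (e : AExp) (p q : AProg)
  | loop (e : AExp) (p : AProg)

/-- Sequential composition. -/
infixr:60 " ;; " => AProg.seq

/-- `AExec N B p σ i σ'`: the program `p` started in `σ` halts in `σ'` after `i` iterations of loops
altogether, without any overflow. -/
inductive AExec (N B : ℕ) : AProg → ASt → ℕ → ASt → Prop where
  | skip (σ : ASt) : AExec N B .skip σ 0 σ
  | assign {r : ℕ} {e : AExp} {σ : ASt} : e.Ok N B σ →
      AExec N B (.assign r e) σ 0 (σ.setReg r (e.eval σ))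
  | set {j : ℕ} {i e : AExp} {σ : ASt} : (AExp.get j i).Ok N B σ → e.Ok N B σ →
      AExec N B (.set j i e) σ 0 (σ.setArr j (i.eval σ) (e.eval σ))
  | put {a e : AExp} {σ : ASt} : (AExp.inp a).Ok N B σ → e.Ok N B σ →
      AExec N B (.put a e) σ 0 (σ.setInp (a.eval σ) (e.eval σ))
  | seq {p q : AProg} {σ₁ σ₂ σ₃ : ASt} {i₁ i₂ : ℕ} :
      AExec N B p σ₁ i₁ σ₂ → AExec N B q σ₂ i₂ σ₃ → AExec N B (.seq p q) σ₁ (i₁ + i₂) σ₃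
  | ite_true {e : AExp} {p q : AProg} {σ σ' : ASt} {i : ℕ} : e.Ok N B σ →
      e.eval σ ≠ 0 → AExec N B p σ i σ' → AExec N B (.ite e p q) σ i σ'
  | ite_false {e : AExp} {p q : AProg} {σ σ' : ASt} {i : ℕ} : e.Ok N B σ →
      e.eval σ = 0 → AExec N B q σ i σ' → AExec N B (.ite e p q) σ i σ'
  | loop_true {e : AExp} {p : AProg} {σ₁ σ₂ σ₃ : ASt} {i₁ i₂ : ℕ} : e.Ok N B σ₁ →
      e.eval σ₁ ≠ 0 → AExec N B p σ₁ i₁ σ₂ → AExec N B (.loop e p) σ₂ i₂ σ₃ →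
        AExec N B (.loop e p) σ₁ (i₁ + 1 + i₂) σ₃
  | loop_false {e : AExp} {p : AProg} {σ : ASt} : e.Ok N B σ →
      e.eval σ = 0 → AExec N B (.loop e p) σ 0 σ

namespace AProg

/-- Translation of programs. -/
def compile : AProg → Prog
  | skip => .skip
  | assign r e => .assign r e.compile
  | set j i e => .store (AExp.addr j i.compile) e.compile
  | put a e => .store a.compile e.compile
  | seq p q => .seq p.compile q.compile
  | ite e p q => .ite e.compile p.compile q.compile
  | loop e p => .loop e.compile p.compile

/-- The time of a program is at most its weight times one plus the number of loop iterations. -/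
def weight : AProg → ℕ
  | skip => 1
  | assign _ e => e.compile.cost + 1
  | set j i e => (AExp.addr j i.compile).cost + e.compile.cost + 1
  | put a e => a.compile.cost + e.compile.cost + 1
  | seq p q => p.weight + q.weight
  | ite e p q => e.compile.cost + 1 + p.weight + q.weight
  | loop e p => e.compile.cost + 1 + p.weight

/-- The registers that a program may write. -/
def regs : AProg → List ℕ
  | skip => []
  | assign r _ => [r]
  | set _ _ _ => []
  | put _ _ => []
  | seq p q => p.regs ++ q.regs
  | ite _ p q => p.regs ++ q.regs
  | loop _ p => p.regs

/-- The arrays that a program may write. -/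
def arrs : AProg → List ℕ
  | skip => []
  | assign _ _ => []
  | set j _ _ => [j]
  | put _ _ => []
  | seq p q => p.arrs ++ q.arrs
  | ite _ p q => p.arrs ++ q.arrs
  | loop _ p => p.arrs

/-- The program does not write to the input region. -/
def NoPut : AProg → Prop
  | skip => True
  | assign _ _ => True
  | set _ _ _ => True
  | put _ _ => False
  | seq p q => p.NoPut ∧ q.NoPut
  | ite _ p q => p.NoPut ∧ q.NoPut
  | loop _ p => p.NoPut

end AProg

/-- Code outside loops runs at most once, and each further execution of a piece of code is charged
to a loop iteration. The summand 1 in `i + 1` pays for the part that runs without any iteration and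
for the last, failing test of a loop. -/
theorem AExec.exists_exec {N w : ℕ} {p : AProg} {σ σ' : ASt} {i : ℕ} (h : AExec N (2 ^ w) p σ i σ') :
    ∃ t, Exec w p.compile (σ.toState N) t (σ'.toState N) ∧ t ≤ p.weight * (i + 1) := by
  induction h with
  | skip σ => exact ⟨1, .skip _, by simp [AProg.weight]⟩
  | @assign r e σ he =>
    refine ⟨e.compile.cost + 1, ?_, by simp [AProg.weight]⟩
    rw [ASt.toState_setReg, ← AExp.eval_compile he]
    exact .assign _ _ _
  | @set j i e σ hi he =>
    refine ⟨(AExp.addr j i.compile).cost + e.compile.cost + 1, ?_, by simp [AProg.weight]⟩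
    obtain ⟨h1, h2, h3, h4⟩ := hi
    rw [ASt.toState_setArr N σ h3, ← AExp.eval_compile he,
      ← AExp.eval_addr (AExp.eval_compile h1) h2 h3 h4]
    exact .store _ _ _
  | @put a e σ ha he =>
    refine ⟨a.compile.cost + e.compile.cost + 1, ?_, by simp [AProg.weight]⟩
    rw [ASt.toState_setInp N σ ha.2, ← AExp.eval_compile he, ← AExp.eval_compile ha.1]
    exact .store _ _ _
  | seq _ _ ih1 ih2 =>
    obtain ⟨t1, h1, b1⟩ := ih1
    obtain ⟨t2, h2, b2⟩ := ih2
    refine ⟨t1 + t2, .seq h1 h2, ?_⟩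
    simp only [AProg.weight]
    nlinarith
  | @ite_true e p q σ σ' i he h0 _ ih =>
    obtain ⟨t, h, b⟩ := ih
    refine ⟨_, .ite_true (by rwa [AExp.eval_compile he]) h, ?_⟩
    simp only [AProg.weight]
    nlinarith
  | @ite_false e p q σ σ' i he h0 _ ih =>
    obtain ⟨t, h, b⟩ := ih
    refine ⟨_, .ite_false (by rwa [AExp.eval_compile he]) h, ?_⟩
    simp only [AProg.weight]
    nlinarith
  | @loop_true e p σ₁ σ₂ σ₃ i₁ i₂ he h0 _ _ ih1 ih2 =>
    obtain ⟨t1, h1, b1⟩ := ih1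
    obtain ⟨t2, h2, b2⟩ := ih2
    refine ⟨_, .loop_true (by rwa [AExp.eval_compile he]) h1 h2, ?_⟩
    simp only [AProg.weight] at *
    nlinarith
  | @loop_false e p σ he h0 =>
    refine ⟨_, .loop_false (by rwa [AExp.eval_compile he]), ?_⟩
    simp only [AProg.weight]
    nlinarith

/-- `σ'` agrees with `σ` on everything that the program does not write. -/
def Frame (p : AProg) (σ σ' : ASt) : Prop :=
  (∀ r, r ∉ p.regs → σ'.reg r = σ.reg r) ∧ (∀ j, j ∉ p.arrs → σ'.arr j = σ.arr j) ∧
    (p.NoPut → σ'.inp = σ.inp)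

theorem Frame.refl (p : AProg) (σ : ASt) : Frame p σ σ :=
  ⟨fun _ _ => rfl, fun _ _ => rfl, fun _ => rfl⟩

theorem Frame.trans {p : AProg} {σ₁ σ₂ σ₃ : ASt} (h : Frame p σ₁ σ₂) (h' : Frame p σ₂ σ₃) :
    Frame p σ₁ σ₃ :=
  ⟨fun r hr => (h'.1 r hr).trans (h.1 r hr), fun j hj => (h'.2.1 j hj).trans (h.2.1 j hj),
    fun hp => (h'.2.2 hp).trans (h.2.2 hp)⟩

theorem Frame.mono {p q : AProg} {σ σ' : ASt} (h : Frame p σ σ') (hr : p.regs ⊆ q.regs)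
    (ha : p.arrs ⊆ q.arrs) (hp : q.NoPut → p.NoPut) : Frame q σ σ' :=
  ⟨fun r hr' => h.1 r fun h => hr' (hr h), fun j hj => h.2.1 j fun h => hj (ha h),
    fun hq => h.2.2 (hp hq)⟩

/-- A purely syntactic bound on the side effects. It lets loop invariants mention only what the loop
body changes. -/
theorem AExec.frame {N B : ℕ} {p : AProg} {σ σ' : ASt} {i : ℕ} (h : AExec N B p σ i σ') :
    Frame p σ σ' := by
  induction h with
  | skip σ => exact Frame.refl _ _
  | assign he =>
    refine ⟨fun r hr => ?_, fun _ _ => rfl, fun _ => rfl⟩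
    simp only [AProg.regs, List.mem_singleton] at hr
    simp [hr]
  | set hi he =>
    refine ⟨fun _ _ => rfl, fun j hj => ?_, fun _ => rfl⟩
    simp only [AProg.arrs, List.mem_singleton] at hj
    simp [hj]
  | put ha he => exact ⟨fun _ _ => rfl, fun _ _ => rfl, fun h => h.elim⟩
  | seq _ _ ih1 ih2 =>
    exact (ih1.mono (by simp [AProg.regs]) (by simp [AProg.arrs]) And.left).trans
      (ih2.mono (by simp [AProg.regs]) (by simp [AProg.arrs]) And.right)
  | ite_true _ _ _ ih => exact ih.mono (by simp [AProg.regs]) (by simp [AProg.arrs]) And.left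
  | ite_false _ _ _ ih => exact ih.mono (by simp [AProg.regs]) (by simp [AProg.arrs]) And.right
  | loop_true _ _ _ _ ih1 ih2 =>
    exact (ih1.mono (List.Subset.refl _) (List.Subset.refl _) id).trans ih2
  | loop_false _ _ => exact Frame.refl _ _

/-- Total correctness: the program halts in a state that satisfies `Q` together with the number of
loop iterations. -/
def Runs (N B : ℕ) (p : AProg) (σ : ASt) (Q : ASt → ℕ → Prop) : Prop :=
  ∃ σ' i, AExec N B p σ i σ' ∧ Q σ' i

/-! ### Proof rules for total correctness with iteration counts -/

namespace Runs

variable {N B : ℕ} {p q : AProg} {σ : ASt} {Q Q' : ASt → ℕ → Prop} {e a : AExp}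

theorem mono (h : Runs N B p σ Q) (hQ : ∀ σ' i, Frame p σ σ' → Q σ' i → Q' σ' i) :
    Runs N B p σ Q' := by
  obtain ⟨σ', i, h1, h2⟩ := h
  exact ⟨σ', i, h1, hQ σ' i h1.frame h2⟩

theorem skip (hQ : Q σ 0) : Runs N B .skip σ Q := ⟨σ, 0, .skip σ, hQ⟩

theorem assign {r : ℕ} (h : e.Ok N B σ) (hQ : Q (σ.setReg r (e.eval σ)) 0) :
    Runs N B (.assign r e) σ Q :=
  ⟨_, _, .assign h, hQ⟩

theorem set {j : ℕ} (ha : (AExp.get j a).Ok N B σ) (h : e.Ok N B σ)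
    (hQ : Q (σ.setArr j (a.eval σ) (e.eval σ)) 0) : Runs N B (.set j a e) σ Q :=
  ⟨_, _, .set ha h, hQ⟩

theorem put (ha : (AExp.inp a).Ok N B σ) (h : e.Ok N B σ)
    (hQ : Q (σ.setInp (a.eval σ) (e.eval σ)) 0) : Runs N B (.put a e) σ Q :=
  ⟨_, _, .put ha h, hQ⟩

theorem seq (h : Runs N B p σ fun σ₁ i₁ => Runs N B q σ₁ fun σ₂ i₂ => Q σ₂ (i₁ + i₂)) :
    Runs N B (p ;; q) σ Q := by
  obtain ⟨σ₁, i₁, h1, σ₂, i₂, h2, hQ⟩ := h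
  exact ⟨σ₂, _, .seq h1 h2, hQ⟩

theorem ite (h : e.Ok N B σ) (h1 : e.eval σ ≠ 0 → Runs N B p σ Q)
    (h2 : e.eval σ = 0 → Runs N B q σ Q) : Runs N B (.ite e p q) σ Q := by
  by_cases h0 : e.eval σ = 0
  · obtain ⟨σ', i, h3, h4⟩ := h2 h0
    exact ⟨σ', i, .ite_false h h0 h3, h4⟩
  · obtain ⟨σ', i, h3, h4⟩ := h1 h0
    exact ⟨σ', i, .ite_true h h0 h3, h4⟩

/-- The rule for loops: `Inv` is an invariant, and the potential `Φ` pays for the iterations. -/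
theorem loop (Inv : ASt → Prop) (Φ : ASt → ℕ) (h0 : Inv σ)
    (step : ∀ σ', Frame (.loop e p) σ σ' → Inv σ' → e.Ok N B σ' ∧
      (e.eval σ' ≠ 0 → Runs N B p σ' fun σ'' i => Inv σ'' ∧ i + 1 + Φ σ'' ≤ Φ σ')) :
    Runs N B (.loop e p) σ fun σ' i => Inv σ' ∧ e.eval σ' = 0 ∧ i + Φ σ' ≤ Φ σ := by
  -- The induction is on the value of the potential, which drops at each iteration. The frame
  -- relative to the initial state is carried along, so that `step` may use what the whole loop
  -- leaves unchanged.
  suffices H : ∀ m σ', Φ σ' = m → Frame (.loop e p) σ σ' → Inv σ' →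
      Runs N B (.loop e p) σ' fun σ'' i => Inv σ'' ∧ e.eval σ'' = 0 ∧ i + Φ σ'' ≤ Φ σ' from
    H _ σ rfl (Frame.refl _ _) h0
  intro m
  induction m using Nat.strong_induction_on with
  | _ m ih =>
    intro σ' hm hF hI
    obtain ⟨hok, hst⟩ := step σ' hF hI
    by_cases he : e.eval σ' = 0
    · exact ⟨σ', 0, .loop_false hok he, hI, he, by simp⟩
    · obtain ⟨σ₂, i₁, h1, hI2, hle⟩ := hst he
      obtain ⟨σ₃, i₂, h2, hI3, he3, hle3⟩ := ih (Φ σ₂) (by omega) σ₂ rfl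
        (hF.trans (h1.frame.mono (List.Subset.refl _) (List.Subset.refl _) id)) hI2
      exact ⟨σ₃, _, .loop_true hok he h1 h2, hI3, he3, by omega⟩

end Runs

/-- Execute `body` for the values of register `r` from `lo` up to the content of register `h`,
exclusively. -/
def forUp (r : ℕ) (lo : AExp) (h : ℕ) (body : AProg) : AProg :=
  .assign r lo ;; .loop (.lt (.var r) (.var h)) (body ;; .assign r (.add (.var r) (.const 1)))

/-- The body must be free of loop iterations (`t = 0`), so the iterations are exactly those of the
counter. The invariant is required after the increment of the counter, and `b < B` prevents this
increment from overflowing. -/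
theorem Runs.forUp {N B : ℕ} {σ : ASt} {r h : ℕ} {lo : AExp} {body : AProg} {a b : ℕ}
    (I : ℕ → ASt → Prop) (hr : r ∉ body.regs) (hh : h ∉ body.regs) (hrh : h ≠ r)
    (hlo : lo.Ok N B σ) (ha : lo.eval σ = a) (hb : σ.reg h = b) (hbw : b < B) (hab : a ≤ b)
    (h0 : I a (σ.setReg r a))
    (step : ∀ i σ', a ≤ i → i < b → σ'.reg r = i →
      Frame (ArrayRAM.forUp r lo h body) σ σ' → I i σ' →
        Runs N B body σ' fun σ'' t => t = 0 ∧ I (i + 1) (σ''.setReg r (i + 1))) :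
    Runs N B (ArrayRAM.forUp r lo h body) σ fun σ' t => t ≤ b - a ∧ I b σ' := by
  have hreg : h ∉ (ArrayRAM.forUp r lo h body).regs := by
    simp [ArrayRAM.forUp, AProg.regs, hh, hrh]
  refine .seq (.assign hlo ?_)
  refine (Runs.loop (fun σ' => a ≤ σ'.reg r ∧ σ'.reg r ≤ b ∧ I (σ'.reg r) σ')
    (fun σ' => b - σ'.reg r) ?_ ?_).mono ?_
  · simp [ha, hab, h0]
  · rintro σ' hF ⟨h1, h2, h3⟩
    have hF' : Frame (ArrayRAM.forUp r lo h body) σ σ' := by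
      refine Frame.trans (σ₂ := σ.setReg r (lo.eval σ)) ?_
        (hF.mono (by simp [ArrayRAM.forUp, AProg.regs]) (by simp [ArrayRAM.forUp, AProg.arrs])
          And.right)
      refine ⟨fun r' hr' => ?_, fun _ _ => rfl, fun _ => rfl⟩
      have : r' ≠ r := by rintro rfl; simp [ArrayRAM.forUp, AProg.regs] at hr'
      simp [this]
    refine ⟨⟨trivial, trivial⟩, fun he => ?_⟩
    have hlt : σ'.reg r < b := by
      by_contra hc
      simp [AExp.eval, hF'.1 h hreg, hb] at he
      omega
    refine .seq ((step _ σ' h1 hlt rfl hF' h3).mono ?_)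
    rintro σ₂ t hF2 ⟨rfl, hI⟩
    have hr2 : σ₂.reg r = σ'.reg r := hF2.1 r hr
    refine .assign ⟨trivial, ?_, ?_⟩ ?_
    · simp only [AExp.Ok]; omega
    · simp only [AExp.eval]; omega
    · simp only [AExp.eval, ASt.setReg_reg, if_true, hr2]
      refine ⟨⟨by omega, by omega, hI⟩, by omega⟩
  · rintro σ' t hF ⟨⟨h1, h2, h3⟩, he, hle⟩
    have hh' : σ'.reg h = b := by
      rw [hF.1 h (by simp [AProg.regs, hh, hrh]), ASt.setReg_reg, if_neg hrh, hb]
    have : ¬ σ'.reg r < b := by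
      intro hc
      simp [AExp.eval, hh', hc] at he
    have hrb : σ'.reg r = b := by omega
    rw [hrb] at h3
    simp only [ASt.setReg_reg, if_true, ha] at hle
    exact ⟨by omega, h3⟩

end ArrayRAM

open ArrayRAM

/-! ### Instances in memory -/

/-- An instance on the vertices `0, …, n - 1` together with its representation in the input
region: `adj v` is the adjacency list of `v`, and it starts in cell `off v`. -/
structure Inst where
  n : ℕ
  k : ℕ
  f : ℕ
  N : ℕ
  col : ℕ → ℕ
  adj : ℕ → List ℕ
  off : ℕ → ℕ
  inp : ℕ → ℕ
  n_pos : 0 < n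
  adj_lt : ∀ {u v}, v ∈ adj u → v < n
  adj_symm : ∀ {u v}, v ∈ adj u → u ∈ adj v
  adj_nodup : ∀ u, (adj u).Nodup
  col_lt : ∀ {v}, v < n → col v < k
  off_zero : off 0 = 3 + 2 * n
  off_succ : ∀ v, off (v + 1) = off v + (adj v).length
  off_n : off n = N
  inp_zero : inp 0 = n
  inp_one : inp 1 = k
  inp_two : inp 2 = f
  inp_col : ∀ {v}, v < n → inp (3 + v) = col v
  inp_deg : ∀ {v}, v < n → inp (3 + n + v) = (adj v).length
  inp_adj : ∀ v j (h : j < (adj v).length), inp (off v + j) = (adj v)[j]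

namespace Inst

variable (I : Inst)

/-- By symmetry of adjacency. Thus `n` serves as a dummy vertex: choosing it changes no neighbor
count, so it can pad a stack or stand for choosing nothing. -/
theorem adj_of_le {v : ℕ} (h : I.n ≤ v) : I.adj v = [] := by
  rw [List.eq_nil_iff_forall_not_mem]
  intro u hu
  have := I.adj_lt (I.adj_symm hu)
  omega

theorem off_mono : Monotone I.off :=
  monotone_nat_of_le_succ fun v => by rw [I.off_succ]; omega

theorem off_n_succ : I.off (I.n + 1) = I.N := by
  rw [I.off_succ, I.off_n, I.adj_of_le le_rfl]; rfl

theorem off_le {v : ℕ} (h : v ≤ I.n + 1) : I.off v ≤ I.N := I.off_n_succ ▸ I.off_mono h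

theorem le_off (v : ℕ) : 3 + 2 * I.n ≤ I.off v := I.off_zero ▸ I.off_mono (Nat.zero_le v)

theorem le_N : 3 + 2 * I.n ≤ I.N := I.off_n ▸ I.le_off _

theorem length_adj_le (v : ℕ) : (I.adj v).length ≤ I.n := by
  have h : (I.adj v).toFinset ⊆ Finset.range I.n := fun u hu => by
    simpa using I.adj_lt (List.mem_toFinset.1 hu)
  simpa [List.toFinset_card_of_nodup (I.adj_nodup v)] using Finset.card_le_card h

/-- The words are long enough for the instance. -/
def Fits (B : ℕ) : Prop := 32 * (I.n + 2) + I.N + I.k + I.f ≤ B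

/-- The parameters of the instance stand in registers, the input region is unchanged, and array `0`
holds the first addresses of the adjacency lists. -/
structure Ready (σ : ASt) : Prop where
  reg2 : σ.reg 2 = I.N
  reg3 : σ.reg 3 = I.n
  reg4 : σ.reg 4 = I.k
  reg5 : σ.reg 5 = I.f
  inp : σ.inp = I.inp
  arr0 : ∀ v ≤ I.n + 1, σ.arr 0 v = I.off v

variable {I}

theorem Ready.frame {σ σ' : ASt} {p : AProg} (h : I.Ready σ) (hF : Frame p σ σ')
    (h2 : 2 ∉ p.regs) (h3 : 3 ∉ p.regs) (h4 : 4 ∉ p.regs) (h5 : 5 ∉ p.regs) (h0 : 0 ∉ p.arrs)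
    (hp : p.NoPut) : I.Ready σ' where
  reg2 := by rw [hF.1 2 h2, h.reg2]
  reg3 := by rw [hF.1 3 h3, h.reg3]
  reg4 := by rw [hF.1 4 h4, h.reg4]
  reg5 := by rw [hF.1 5 h5, h.reg5]
  inp := by rw [hF.2.2 hp, h.inp]
  arr0 := by rw [hF.2.1 0 h0]; exact h.arr0

theorem Ready.congr {σ σ' : ASt} (h : I.Ready σ) (h2 : σ'.reg 2 = σ.reg 2)
    (h3 : σ'.reg 3 = σ.reg 3) (h4 : σ'.reg 4 = σ.reg 4) (h5 : σ'.reg 5 = σ.reg 5)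
    (hi : σ'.inp = σ.inp) (h0 : σ'.arr 0 = σ.arr 0) : I.Ready σ' where
  reg2 := by rw [h2, h.reg2]
  reg3 := by rw [h3, h.reg3]
  reg4 := by rw [h4, h.reg4]
  reg5 := by rw [h5, h.reg5]
  inp := by rw [hi, h.inp]
  arr0 := by rw [h0]; exact h.arr0

end Inst

/-! ### Choosing and unchoosing a vertex

Array `1` counts how often each vertex is chosen, and array `2` counts the chosen neighbors. The
vertex in question is in register `14`. -/

/-- Apply `upd` to all entries of array `2` that belong to neighbors of the vertex. -/
def overNeighbors (upd : AExp → AExp) : AProg :=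
  .assign 13 (.get 0 (.add (.var 14) (.const 1))) ;;
  forUp 12 (.get 0 (.var 14)) 13 (.set 2 (.inp (.var 12)) (upd (.get 2 (.inp (.var 12)))))

/-- Choose a vertex. -/
def choose : AProg :=
  .set 1 (.var 14) (.add (.get 1 (.var 14)) (.const 1)) ;;
  overNeighbors fun e => .add e (.const 1)

/-- Unchoose a vertex. -/
def unchoose : AProg :=
  .set 1 (.var 14) (.sub (.get 1 (.var 14)) (.const 1)) ;;
  overNeighbors fun e => .sub e (.const 1)

/-! ### Updating the counters along an adjacency list -/

section

variable {I : Inst} {B : ℕ}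

theorem iterate_sub_one (m a : ℕ) : (fun a => a - 1)^[m] a = a - m := by
  induction m generalizing a with
  | zero => rfl
  | succ m ih => rw [Function.iterate_succ_apply, ih]; omega

/-- Invariant: after a prefix of the list has been processed, `g` has been applied to entry `y` as
often as `y` occurs in the prefix. The premise `hok` needs to exclude overflow only for values that
arise before the last of these applications. -/
theorem runs_overNeighbors (hw : I.Fits B) {σ : ASt} (hσ : I.Ready σ) {x : ℕ} (hx' : σ.reg 14 = x)
    (hx : x ≤ I.n) (upd : AExp → AExp) (g : ℕ → ℕ)
    (heval : ∀ e σ', (upd e).eval σ' = g (e.eval σ'))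
    (hok : ∀ σ' e, e.Ok I.N B σ' → (∃ m y, m < (I.adj x).count y ∧
      e.eval σ' = g^[m] (σ.arr 2 y)) → (upd e).Ok I.N B σ') :
    Runs I.N B (overNeighbors upd) σ fun σ' t => t ≤ I.n ∧
      σ'.arr 2 = fun y => g^[(I.adj x).count y] (σ.arr 2 y) := by
  have hw' : 32 * (I.n + 2) + I.N + I.k + I.f ≤ B := hw
  have hN := hσ.reg2
  have h0 := hσ.arr0 x (by omega)
  have h1 := hσ.arr0 (x + 1) (by omega)
  have ho := I.off_succ x
  have hoN := I.off_le (v := x + 1) (by omega)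
  refine .seq (.assign ?_ ?_)
  · simp [AExp.Ok, AExp.eval, hx', hN]; omega
  simp only [AExp.eval, hx', h1, zero_add]
  refine (Runs.forUp (a := I.off x) (b := I.off (x + 1))
    (fun j σ' => σ'.arr 2 = fun y => g^[((I.adj x).take (j - I.off x)).count y] (σ.arr 2 y))
    (by simp [AProg.regs]) (by simp [AProg.regs]) (by simp) ?_ ?_ ?_ ?_ ?_ ?_ ?_).mono ?_
  · simp [AExp.Ok, AExp.eval, hx', hN]; omega
  · simp [AExp.eval, hx', h0]
  · simp
  · omega
  · omega
  · simp
  · intro j σ' hj1 hj2 hr hF hI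
    obtain ⟨m, rfl⟩ := Nat.exists_eq_add_of_le hj1
    have hm : m < (I.adj x).length := by omega
    have hN' : σ'.reg 2 = I.N := by
      rw [hF.1 2 (by simp [forUp, AProg.regs])]; simpa using hN
    have hi' : σ'.inp = I.inp := by
      rw [hF.2.2 (by simp [forUp, AProg.NoPut])]; exact hσ.inp
    have hy := I.inp_adj x m hm
    have hyn : (I.adj x)[m] < I.n := I.adj_lt (List.getElem_mem hm)
    have hcnt : ∀ y, ((I.adj x).take (m + 1)).count y =
        ((I.adj x).take m).count y + if y = (I.adj x)[m] then 1 else 0 := by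
      intro y
      rw [List.take_succ_eq_append_getElem hm, List.count_append, List.count_singleton]
      simp only [beq_iff_eq, @eq_comm _ _ y]
    simp only [Nat.add_sub_cancel_left] at hI
    have hg : (AExp.get 2 (.inp (.var 12))).Ok I.N B σ' := by
      simp only [AExp.Ok, AExp.eval, hr, hi', hy, hN']
      exact ⟨⟨trivial, by omega⟩, trivial, by norm_num, by omega⟩
    refine .set hg (hok _ _ hg ⟨((I.adj x).take m).count (I.adj x)[m], (I.adj x)[m], ?_, ?_⟩) ?_
    · have h2 : ((I.adj x).take (m + 1)).count (I.adj x)[m] ≤ (I.adj x).count (I.adj x)[m] :=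
        (List.take_sublist _ _).count_le _
      rw [hcnt] at h2
      simpa using h2
    · simp only [AExp.eval, hr, hi', hy, hI]
    · refine ⟨rfl, ?_⟩
      have : I.off x + m + 1 - I.off x = m + 1 := by omega
      simp only [ASt.setReg_arr, ASt.setArr_arr, if_true, AExp.eval, hr, hi', hy, heval, hI, this]
      funext y
      rw [hcnt y]
      by_cases hyy : y = (I.adj x)[m]
      · subst hyy
        simp [Function.iterate_succ_apply']
      · simp [hyy]
  · rintro σ' t hF ⟨ht, hI⟩
    have := I.length_adj_le x
    refine ⟨by omega, ?_⟩
    rw [hI, ho]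
    simp

theorem runs_choose (hw : I.Fits B) {σ : ASt} (hσ : I.Ready σ) {x : ℕ} (hx' : σ.reg 14 = x)
    (hx : x ≤ I.n) (h1 : σ.arr 1 x + 1 < B)
    (h2 : ∀ y < I.n, σ.arr 2 y + 1 < B) :
    Runs I.N B choose σ fun σ' t => t ≤ I.n ∧
      σ'.arr 1 = Function.update (σ.arr 1) x (σ.arr 1 x + 1) ∧
      σ'.arr 2 = fun y => σ.arr 2 y + (I.adj x).count y := by
  have hw' : 32 * (I.n + 2) + I.N + I.k + I.f ≤ B := hw
  have hN := hσ.reg2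
  refine .seq (.set ?_ ?_ ?_)
  · simp [AExp.Ok, AExp.eval, hx', hN]; omega
  · simp [AExp.Ok, AExp.eval, hx', hN]; omega
  · simp only [AExp.eval, hx', zero_add]
    refine (runs_overNeighbors hw (hσ.congr (by simp) (by simp) (by simp) (by simp) (by simp)
      (by simp)) (by simpa using hx') hx _ (fun m => m + 1) (fun _ _ => rfl) ?_).mono ?_
    · rintro σ' e he ⟨m, y, hm, hy⟩
      -- Adjacency lists have no repetitions, so the entry still has its initial value when it is
      -- incremented.
      have hle := (List.nodup_iff_count_le_one.1 (I.adj_nodup x)) y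
      obtain rfl : m = 0 := by omega
      have := h2 y (I.adj_lt (List.count_pos_iff.1 hm))
      simp only [ASt.setArr_arr, Function.iterate_zero, id] at hy
      simp [AExp.Ok, AExp.eval, he, hy]
      omega
    · rintro σ' t hF ⟨ht, h⟩
      refine ⟨ht, ?_, ?_⟩
      · rw [hF.2.1 1 (by simp [overNeighbors, forUp, AProg.arrs])]; simp
      · simpa [Nat.succ_iterate] using h

theorem runs_unchoose (hw : I.Fits B) {σ : ASt} (hσ : I.Ready σ) {x : ℕ} (hx' : σ.reg 14 = x)
    (hx : x ≤ I.n) :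
    Runs I.N B unchoose σ fun σ' t => t ≤ I.n ∧
      σ'.arr 1 = Function.update (σ.arr 1) x (σ.arr 1 x - 1) ∧
      σ'.arr 2 = fun y => σ.arr 2 y - (I.adj x).count y := by
  have hw' : 32 * (I.n + 2) + I.N + I.k + I.f ≤ B := hw
  have hN := hσ.reg2
  refine .seq (.set ?_ ?_ ?_)
  · simp [AExp.Ok, AExp.eval, hx', hN]; omega
  · simp [AExp.Ok, AExp.eval, hx', hN]; omega
  · simp only [AExp.eval, hx', zero_add]
    refine (runs_overNeighbors hw (hσ.congr (by simp) (by simp) (by simp) (by simp) (by simp)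
      (by simp)) (by simpa using hx') hx _ (fun m => m - 1) (fun _ _ => rfl) ?_).mono ?_
    · rintro σ' e he -
      simp [AExp.Ok, he]
      omega
    · rintro σ' t hF ⟨ht, h⟩
      refine ⟨ht, ?_, ?_⟩
      · rw [hF.2.1 1 (by simp [overNeighbors, forUp, AProg.arrs])]; simp
      · simpa [iterate_sub_one] using h

end

/-! ### Searching all sequences of binary choices

The search maintains a stack of pairs of vertices, in the arrays `3` and `4`, together with a bit
that tells which vertex of the pair is chosen, in array `5`. Register `6` holds the depth at which
the stack is full, and register `7` holds the current depth. -/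

/-- The vertex that is chosen at depth `i`. -/
def choice (σ : ASt) (i : ℕ) : ℕ := if σ.arr 5 i = 0 then σ.arr 3 i else σ.arr 4 i

/-- The first `d` bits are those that `orc` demands. -/
def Agree (orc : ℕ → ℕ → Prop) (σ : ASt) (d : ℕ) : Prop :=
  ∀ i < d, (σ.arr 5 i ≠ 0 ↔ orc (σ.arr 3 i) (σ.arr 4 i))

/-- The bits that `orc` demands are lexicographically larger than the first `d` bits. -/
def Ahead (orc : ℕ → ℕ → Prop) (σ : ASt) (d : ℕ) : Prop :=
  ∃ j < d, Agree orc σ j ∧ σ.arr 5 j = 0 ∧ orc (σ.arr 3 j) (σ.arr 4 j)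

/-- The stacks agree up to depth `d`. -/
def SameBelow (σ σ' : ASt) (d : ℕ) : Prop :=
  ∀ i < d, σ'.arr 3 i = σ.arr 3 i ∧ σ'.arr 4 i = σ.arr 4 i ∧ σ'.arr 5 i = σ.arr 5 i

theorem SameBelow.mono {σ σ' : ASt} {c d : ℕ} (h : SameBelow σ σ' d) (hcd : c ≤ d) :
    SameBelow σ σ' c := fun i hi => h i (by omega)

theorem SameBelow.choice {σ σ' : ASt} {d i : ℕ} (h : SameBelow σ σ' d) (hi : i < d) :
    choice σ' i = choice σ i := by
  obtain ⟨h1, h2, h3⟩ := h i hi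
  simp only [_root_.choice, h1, h2, h3]

theorem SameBelow.agree {σ σ' : ASt} {d : ℕ} {orc : ℕ → ℕ → Prop} (h : SameBelow σ σ' d)
    (hA : Agree orc σ d) : Agree orc σ' d := fun i hi => by
  obtain ⟨h1, h2, h3⟩ := h i hi
  rw [h1, h2, h3]
  exact hA i hi

theorem SameBelow.ahead {σ σ' : ASt} {d : ℕ} {orc : ℕ → ℕ → Prop} (h : SameBelow σ σ' d)
    (hA : Ahead orc σ d) : Ahead orc σ' d := by
  obtain ⟨j, hj, hA, h0, ho⟩ := hA
  obtain ⟨h1, h2, h3⟩ := h j hj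
  exact ⟨j, hj, (h.mono hj.le).agree hA, by rw [h3, h0], by rwa [h1, h2]⟩

theorem Ahead.mono {σ : ASt} {c d : ℕ} {orc : ℕ → ℕ → Prop} (h : Ahead orc σ c) (hcd : c ≤ d) :
    Ahead orc σ d := by
  obtain ⟨j, hj, h⟩ := h
  exact ⟨j, by omega, h⟩

theorem Agree.succ {σ : ASt} {d : ℕ} {orc : ℕ → ℕ → Prop} (h : Agree orc σ d)
    (hd : σ.arr 5 d ≠ 0 ↔ orc (σ.arr 3 d) (σ.arr 4 d)) : Agree orc σ (d + 1) := fun i hi => by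
  rcases Nat.lt_succ_iff_lt_or_eq.1 hi with hi | rfl
  · exact h i hi
  · exact hd

/-- The state of the search at depth `d`. Every pair `u`, `v` at depth `i` of the stack satisfies
`PK c i u v`, where `c` is the sequence of choices. -/
structure Stack (I : Inst) (Aux : ASt → Prop) (PK : (ℕ → ℕ) → ℕ → ℕ → ℕ → Prop) (b d : ℕ)
    (σ : ASt) : Prop where
  ready : I.Ready σ
  aux : Aux σ
  reg6 : σ.reg 6 = b
  le : d ≤ b
  fst_le : ∀ i < d, σ.arr 3 i ≤ I.n
  snd_le : ∀ i < d, σ.arr 4 i ≤ I.n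
  pk : ∀ i < d, PK (choice σ) i (σ.arr 3 i) (σ.arr 4 i)
  chosen : ∀ v ≤ I.n, σ.arr 1 v = ∑ i ∈ Finset.range d, if choice σ i = v then 1 else 0
  nbrs : ∀ v ≤ I.n, σ.arr 2 v = ∑ i ∈ Finset.range d, (I.adj (choice σ i)).count v

/-- A way to extend the stack and to test a full stack. The test searches for something that is
found for every sequence of choices that some `orc` with `Good b orc` demands. -/
structure Strategy (I : Inst) where
  pick : AProg
  check : AProg
  Aux : ASt → Prop
  PK : (ℕ → ℕ) → ℕ → ℕ → ℕ → Prop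
  Good : ℕ → (ℕ → ℕ → Prop) → Prop
  Found : ASt → Prop
  aux_congr : ∀ {σ σ' : ASt}, Aux σ → σ'.reg 6 = σ.reg 6 → σ'.arr 6 = σ.arr 6 →
    σ'.arr 7 = σ.arr 7 → Aux σ'
  pk_congr : ∀ {c c' : ℕ → ℕ} {i u v : ℕ}, (∀ j < i, c' j = c j) → PK c i u v → PK c' i u v
  found_congr : ∀ {σ σ' : ASt}, Found σ → σ'.arr = σ.arr → Found σ'
  pick_regs : ∀ r ∈ pick.regs, 10 ≤ r ∧ r ≤ 13
  pick_arrs : pick.arrs = []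
  pick_noPut : pick.NoPut
  check_regs : ∀ r ∈ check.regs, r = 9 ∨ r = 10 ∨ r = 12 ∨ r = 13
  check_arrs : ∀ j ∈ check.arrs, j = 8 ∨ j = 9
  check_noPut : check.NoPut
  runs_pick : ∀ {B : ℕ}, I.Fits B → ∀ {b d : ℕ} {σ : ASt}, b ≤ I.n → σ.reg 7 = d → d < b →
    Stack I Aux PK b d σ → Runs I.N B pick σ fun σ' t => t ≤ 2 * I.n ∧ σ'.reg 10 ≤ I.n ∧
      σ'.reg 11 ≤ I.n ∧ PK (choice σ) d (σ'.reg 10) (σ'.reg 11)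
  runs_check : ∀ {B : ℕ}, I.Fits B → ∀ {b : ℕ} {σ : ASt}, b ≤ I.n →
    Stack I Aux PK b b σ → Runs I.N B check σ fun σ' t => t ≤ 4 * I.n ∧
      ((σ'.reg 9 = 1 ∧ Found σ') ∨ (σ'.reg 9 = 0 ∧ ∀ orc, Good b orc → ¬ Agree orc σ b))

/-! ### The backtracking search and its invariants -/

namespace Strategy

variable {I : Inst} (T : Strategy I)

/-- Extend the stack. -/
def push (pick : AProg) : AProg :=
  pick ;; .set 3 (.var 7) (.var 10) ;; .set 4 (.var 7) (.var 11) ;;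
    .set 5 (.var 7) (.const 0) ;; .assign 14 (.var 10) ;; choose ;;
    .assign 7 (.add (.var 7) (.const 1))

/-- Test a full stack. -/
def leaf (check : AProg) : AProg :=
  check ;; .ite (.var 9) (.assign 8 (.const 0)) (.assign 8 (.const 2))

/-- Remove the topmost pair, or change its bit from `0` to `1`. -/
def back : AProg :=
  .ite (.eq (.var 7) (.const 0)) (.assign 8 (.const 0))
    (.assign 7 (.sub (.var 7) (.const 1)) ;;
      .ite (.get 5 (.var 7)) (.assign 14 (.get 4 (.var 7)) ;; unchoose)
        (.assign 14 (.get 3 (.var 7)) ;; unchoose ;; .set 5 (.var 7) (.const 1) ;;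
          .assign 14 (.get 4 (.var 7)) ;; choose ;; .assign 7 (.add (.var 7) (.const 1)) ;;
          .assign 8 (.const 1)))

/-- One step of the search. Register `8` holds `1` when the stack grows, `2` when it shrinks, and
`0` at the end of the search. -/
def step (pick check : AProg) : AProg :=
  .ite (.eq (.var 8) (.const 1)) (.ite (.lt (.var 7) (.var 6)) (push pick) (leaf check)) back

/-- The search. At the end register `9` tells whether it has been successful. -/
def search (pick check : AProg) : AProg :=
  .assign 13 (.add (.var 3) (.const 1)) ;;
    forUp 12 (.const 0) 13 (.set 1 (.var 12) (.const 0) ;; .set 2 (.var 12) (.const 0)) ;;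
    .assign 7 (.const 0) ;; .assign 8 (.const 1) ;; .assign 9 (.const 0) ;;
    .loop (.var 8) (step pick check)

/-- The number of remaining steps of the search that are caused by the stack. -/
def pending (b d : ℕ) (F : ℕ → ℕ) : ℕ :=
  ∑ i ∈ Finset.range d, if F i = 0 then 4 * 2 ^ (b - i - 1) - 1 else 1

/-- The number of remaining steps of the search. -/
def remaining (b : ℕ) (σ : ASt) : ℕ :=
  if σ.reg 8 = 1 then 4 * 2 ^ (b - σ.reg 7) - 3 + pending b (σ.reg 7) (σ.arr 5) + 1
  else if σ.reg 8 = 2 then pending b (σ.reg 7) (σ.arr 5) + 1 else 0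

/-- The invariant of the search. -/
structure Inv (b : ℕ) (σ : ASt) : Prop where
  stack : Stack I T.Aux T.PK b (σ.reg 7) σ
  mode : (σ.reg 8 = 1 ∧ σ.reg 9 = 0 ∧
      ∀ orc, T.Good b orc → Agree orc σ (σ.reg 7) ∨ Ahead orc σ (σ.reg 7)) ∨
    (σ.reg 8 = 2 ∧ σ.reg 9 = 0 ∧ ∀ orc, T.Good b orc → Ahead orc σ (σ.reg 7)) ∨
    (σ.reg 8 = 0 ∧ ((σ.reg 9 = 1 ∧ σ.reg 7 = b ∧ T.Found σ) ∨
      (σ.reg 9 = 0 ∧ ∀ orc, ¬ T.Good b orc)))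

variable {T}

theorem stack_push {b d : ℕ} {σ σ' : ASt} (h : Stack I T.Aux T.PK b d σ) (hd : d < b)
    (hR : I.Ready σ') (h6 : σ'.reg 6 = σ.reg 6) (ha6 : σ'.arr 6 = σ.arr 6)
    (ha7 : σ'.arr 7 = σ.arr 7) (hS : SameBelow σ σ' d) (hu : σ'.arr 3 d ≤ I.n)
    (hv : σ'.arr 4 d ≤ I.n) (hpk : T.PK (choice σ) d (σ'.arr 3 d) (σ'.arr 4 d))
    (h1 : σ'.arr 1 = Function.update (σ.arr 1) (choice σ' d) (σ.arr 1 (choice σ' d) + 1))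
    (h2 : σ'.arr 2 = fun y => σ.arr 2 y + (I.adj (choice σ' d)).count y) :
    Stack I T.Aux T.PK b (d + 1) σ' where
  ready := hR
  aux := T.aux_congr h.aux h6 ha6 ha7
  reg6 := by rw [h6, h.reg6]
  le := hd
  fst_le i hi := by
    rcases Nat.lt_succ_iff_lt_or_eq.1 hi with hi | rfl
    · rw [(hS i hi).1]; exact h.fst_le i hi
    · exact hu
  snd_le i hi := by
    rcases Nat.lt_succ_iff_lt_or_eq.1 hi with hi | rfl
    · rw [(hS i hi).2.1]; exact h.snd_le i hi
    · exact hv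
  pk i hi := by
    rcases Nat.lt_succ_iff_lt_or_eq.1 hi with hi | rfl
    · rw [(hS i hi).1, (hS i hi).2.1]
      exact T.pk_congr (fun j hj => hS.choice (by omega)) (h.pk i hi)
    · exact T.pk_congr (fun j hj => hS.choice hj) hpk
  chosen v hv := by
    rw [Finset.sum_range_succ, Finset.sum_congr rfl (g := fun i => if choice σ i = v then 1 else 0)
      fun i hi => by rw [hS.choice (Finset.mem_range.1 hi)], ← h.chosen v hv, h1]
    by_cases hvd : v = choice σ' d
    · simp [← hvd]
    · simp [Function.update_of_ne hvd, Ne.symm hvd]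
  nbrs v hv := by
    rw [Finset.sum_range_succ, Finset.sum_congr rfl (g := fun i => (I.adj (choice σ i)).count v)
      fun i hi => by rw [hS.choice (Finset.mem_range.1 hi)], ← h.nbrs v hv, h2]

/-- The counters are sums over the stack that contain the contribution of the top entry, so the
truncated subtractions are exact. -/
theorem stack_pop {b d : ℕ} {σ σ' : ASt} (h : Stack I T.Aux T.PK b (d + 1) σ)
    (hR : I.Ready σ') (h6 : σ'.reg 6 = σ.reg 6) (ha6 : σ'.arr 6 = σ.arr 6)
    (ha7 : σ'.arr 7 = σ.arr 7) (hS : SameBelow σ σ' d)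
    (h1 : σ'.arr 1 = Function.update (σ.arr 1) (choice σ d) (σ.arr 1 (choice σ d) - 1))
    (h2 : σ'.arr 2 = fun y => σ.arr 2 y - (I.adj (choice σ d)).count y) :
    Stack I T.Aux T.PK b d σ' where
  ready := hR
  aux := T.aux_congr h.aux h6 ha6 ha7
  reg6 := by rw [h6, h.reg6]
  le := by have := h.le; omega
  fst_le i hi := by rw [(hS i hi).1]; exact h.fst_le i (by omega)
  snd_le i hi := by rw [(hS i hi).2.1]; exact h.snd_le i (by omega)
  pk i hi := by
    rw [(hS i hi).1, (hS i hi).2.1]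
    exact T.pk_congr (fun j hj => hS.choice (by omega)) (h.pk i (by omega))
  chosen v hv := by
    have hc := h.chosen v hv
    rw [Finset.sum_range_succ] at hc
    rw [Finset.sum_congr rfl (g := fun i => if choice σ i = v then 1 else 0)
      fun i hi => by rw [hS.choice (Finset.mem_range.1 hi)], h1]
    by_cases hvd : v = choice σ d
    · rw [← hvd, Function.update_self, hc]
      simp [← hvd]
    · rw [Function.update_of_ne hvd, hc]
      simp [Ne.symm hvd]
  nbrs v hv := by
    have hc := h.nbrs v hv
    rw [Finset.sum_range_succ] at hc
    rw [Finset.sum_congr rfl (g := fun i => (I.adj (choice σ i)).count v)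
      fun i hi => by rw [hS.choice (Finset.mem_range.1 hi)], h2]
    simp [hc]

/-- Together with `nbrs_le` this excludes overflow of the counters. -/
theorem chosen_le {b d : ℕ} {σ : ASt} (h : Stack I T.Aux T.PK b d σ) {v : ℕ} (hv : v ≤ I.n) :
    σ.arr 1 v ≤ d := by
  rw [h.chosen v hv]
  refine (Finset.sum_le_card_nsmul _ _ 1 fun i _ => ?_).trans (by simp)
  split_ifs <;> simp

theorem nbrs_le {b d : ℕ} {σ : ASt} (h : Stack I T.Aux T.PK b d σ) {v : ℕ} (hv : v ≤ I.n) :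
    σ.arr 2 v ≤ d := by
  rw [h.nbrs v hv]
  refine (Finset.sum_le_card_nsmul _ _ 1 fun i _ => ?_).trans (by simp)
  exact List.nodup_iff_count_le_one.1 (I.adj_nodup _) v

theorem choice_le {b d : ℕ} {σ : ASt} (h : Stack I T.Aux T.PK b d σ) {i : ℕ} (hi : i < d) :
    choice σ i ≤ I.n := by
  unfold choice
  split_ifs
  exacts [h.fst_le i hi, h.snd_le i hi]

/-- A subtree of height h takes S(h) = 4 * 2^h - 3 steps: S(0) = 1 for the leaf, and S(h + 1) = 2 *
S(h) + 3 for the push, the change of the bit and the pop. An entry with bit 0 still owes the change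
of its bit, one subtree of height b - d - 1 and the pop, which is 4 * 2^(b - d - 1) - 1; any other
entry owes only the pop. -/
theorem pending_succ (b d : ℕ) (F : ℕ → ℕ) :
    pending b (d + 1) F = pending b d F + if F d = 0 then 4 * 2 ^ (b - d - 1) - 1 else 1 :=
  Finset.sum_range_succ _ _

theorem pending_congr {b d : ℕ} {F F' : ℕ → ℕ} (h : ∀ i < d, F' i = F i) :
    pending b d F' = pending b d F :=
  Finset.sum_congr rfl fun i hi => by rw [h i (Finset.mem_range.1 hi)]

variable {B : ℕ}

theorem runs_push (hB : I.Fits B) {b d : ℕ} {σ : ASt} (hb : b ≤ I.n) (h7 : σ.reg 7 = d)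
    (hd : d < b) (h : Stack I T.Aux T.PK b d σ) :
    Runs I.N B (push T.pick) σ fun σ' t => t ≤ 3 * I.n ∧ Stack I T.Aux T.PK b (d + 1) σ' ∧
      σ'.reg 7 = d + 1 ∧ σ'.reg 8 = σ.reg 8 ∧ σ'.reg 9 = σ.reg 9 ∧ SameBelow σ σ' d ∧
      σ'.arr 5 d = 0 := by
  have hB' : 32 * (I.n + 2) + I.N + I.k + I.f ≤ B := hB
  refine .seq ((T.runs_pick hB hb h7 hd h).mono ?_)
  rintro σ₁ t₁ hF₁ ⟨ht₁, hu, hv, hpk⟩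
  have hr : ∀ r, r < 10 ∨ 13 < r → σ₁.reg r = σ.reg r := fun r hr =>
    hF₁.1 r fun hc => by have := T.pick_regs r hc; omega
  have ha : σ₁.arr = σ.arr := funext fun j => hF₁.2.1 j (by simp [T.pick_arrs])
  have hi : σ₁.inp = σ.inp := hF₁.2.2 T.pick_noPut
  have hN : σ₁.reg 2 = I.N := by rw [hr 2 (by omega), h.ready.reg2]
  have h7₁ : σ₁.reg 7 = d := by rw [hr 7 (by omega), h7]
  have hok : ∀ j < 16, ∀ σ' : ASt, σ'.reg 2 = I.N → σ'.reg 7 = d →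
      (AExp.get j (.var 7)).Ok I.N B σ' := fun j hj σ' h2 h7 =>
    ⟨trivial, h2, hj, by simp only [AExp.eval, h7]; omega⟩
  refine .seq (.set (hok 3 (by norm_num) _ hN h7₁) trivial ?_)
  refine .seq (.set (hok 4 (by norm_num) _ hN h7₁) trivial ?_)
  refine .seq (.set (hok 5 (by norm_num) _ hN h7₁) (by simp only [AExp.Ok]; omega) ?_)
  refine .seq (.assign trivial ?_)
  simp only [AExp.eval, h7₁, ASt.setArr_reg]
  refine .seq ((runs_choose (x := σ₁.reg 10) hB (h.ready.congr ?_ ?_ ?_ ?_ ?_ ?_) ?_ hu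
    ?_ ?_).mono ?_)
  · simp [hr]
  · simp [hr]
  · simp [hr]
  · simp [hr]
  · simp [hi]
  · simp [ha]
  · simp
  · have := chosen_le h hu
    simp [ha]; omega
  · intro y hy
    have := nbrs_le h hy.le
    simp [ha]; omega
  rintro σ₂ t₂ hF₂ ⟨ht₂, h1, h2⟩
  have hr₂ : ∀ r, r ≠ 12 → r ≠ 13 → r ≠ 14 → σ₂.reg r = σ₁.reg r := fun r h12 h13 h14 => by
    rw [hF₂.1 r (by simp [choose, overNeighbors, forUp, AProg.regs, h12, h13])]
    simp [h14]
  have ha₂ : ∀ j, j ≠ 1 → j ≠ 2 → σ₂.arr j = if j = 5 then Function.update (σ.arr 5) d 0 else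
      if j = 4 then Function.update (σ.arr 4) d (σ₁.reg 11) else
      if j = 3 then Function.update (σ.arr 3) d (σ₁.reg 10) else σ.arr j := fun j hj1 hj2 => by
    rw [hF₂.2.1 j (by simp [choose, overNeighbors, forUp, AProg.arrs, hj1, hj2])]
    simp [ha]
  have hi₂ : σ₂.inp = σ.inp := by
    rw [hF₂.2.2 (by simp [choose, overNeighbors, forUp, AProg.NoPut])]
    simp [hi]
  have hS : SameBelow σ (σ₂.setReg 7 (d + 1)) d := fun i hi => by
    have : i ≠ d := by omega
    simp [ha₂, Function.update_of_ne this]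
  refine .assign ⟨trivial, by simp only [AExp.Ok]; omega, ?_⟩ ?_
  · simp only [AExp.eval, hr₂ 7 (by omega) (by omega) (by omega), h7₁]; omega
  simp only [AExp.eval, hr₂ 7 (by omega) (by omega) (by omega), h7₁]
  -- The fresh bit is 0, so the vertex chosen at the new depth is the first one of the pair.
  have hc : choice (σ₂.setReg 7 (d + 1)) d = σ₁.reg 10 := by simp [choice, ha₂]
  refine ⟨by omega, stack_push h hd (h.ready.congr ?_ ?_ ?_ ?_ ?_ ?_) ?_ ?_ ?_ hS ?_ ?_ ?_ ?_ ?_,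
    ?_, ?_, ?_, hS, ?_⟩
  · simp [hr, hr₂]
  · simp [hr, hr₂]
  · simp [hr, hr₂]
  · simp [hr, hr₂]
  · simp [hi₂]
  · simp [ha₂]
  · simp [hr, hr₂]
  · simp [ha₂]
  · simp [ha₂]
  · simp [ha₂, hu]
  · simp [ha₂, hv]
  · simp [ha₂, hpk]
  · rw [hc]; simp [h1, ha]
  · rw [hc]; simp [h2, ha]
  · simp
  · simp [hr, hr₂]
  · simp [hr, hr₂]
  · simp [ha₂]

end Strategy

/-! ### Single steps of the search, completeness and step count -/

namespace Strategy

variable {I : Inst} {T : Strategy I} {B : ℕ}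

/-- The test writes only to arrays `8` and `9` and to scratch registers, so the stack and its
counters survive it. -/
theorem runs_leaf (hB : I.Fits B) {b : ℕ} {σ : ASt} (hb : b ≤ I.n)
    (h : Stack I T.Aux T.PK b b σ) :
    Runs I.N B (leaf T.check) σ fun σ' t => t ≤ 4 * I.n ∧ Stack I T.Aux T.PK b b σ' ∧
      σ'.reg 7 = σ.reg 7 ∧ σ'.arr 5 = σ.arr 5 ∧ SameBelow σ σ' b ∧
      ((σ'.reg 8 = 0 ∧ σ'.reg 9 = 1 ∧ T.Found σ') ∨
        (σ'.reg 8 = 2 ∧ σ'.reg 9 = 0 ∧ ∀ orc, T.Good b orc → ¬ Agree orc σ b)) := by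
  have hB' : 32 * (I.n + 2) + I.N + I.k + I.f ≤ B := hB
  refine .seq ((T.runs_check hB hb h).mono ?_)
  rintro σ₁ t₁ hF₁ ⟨ht₁, hQ⟩
  have hr : ∀ r, r < 9 ∨ 13 < r → σ₁.reg r = σ.reg r := fun r hr =>
    hF₁.1 r fun hc => by have := T.check_regs r hc; omega
  have ha : ∀ j, j ≠ 8 → j ≠ 9 → σ₁.arr j = σ.arr j := fun j hj1 hj2 =>
    hF₁.2.1 j fun hc => by have := T.check_arrs j hc; omega
  have hi : σ₁.inp = σ.inp := hF₁.2.2 T.check_noPut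
  have hS : ∀ x, SameBelow σ (σ₁.setReg 8 x) b := fun x i hi => by simp [ha]
  have hst : ∀ x, Stack I T.Aux T.PK b b (σ₁.setReg 8 x) := fun x =>
    { ready := h.ready.congr (by simp [hr]) (by simp [hr]) (by simp [hr]) (by simp [hr])
        (by simp [hi]) (by simp [ha])
      aux := T.aux_congr h.aux (by simp [hr]) (by simp [ha]) (by simp [ha])
      reg6 := by simp [hr, h.reg6]
      le := le_rfl
      fst_le := fun i hi => by simpa [ha] using h.fst_le i hi
      snd_le := fun i hi => by simpa [ha] using h.snd_le i hi
      pk := fun i hi => by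
        rw [(hS x i hi).1, (hS x i hi).2.1]
        exact T.pk_congr (fun j hj => (hS x).choice (by omega)) (h.pk i hi)
      chosen := fun v hv => by
        have e : choice (σ₁.setReg 8 x) = choice σ := by funext i; simp [choice, ha]
        simpa only [e, ASt.setReg_arr, ha 1 (by norm_num) (by norm_num)] using h.chosen v hv
      nbrs := fun v hv => by simpa [ha, choice] using h.nbrs v hv }
  refine .ite trivial (fun he => ?_) fun he => ?_
  · refine .assign (by simp only [AExp.Ok]; omega) ⟨by omega, hst _, by simp [hr], by simp [ha],
      hS _, .inl ?_⟩
    rcases hQ with ⟨h9, hQ⟩ | ⟨h9, -⟩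
    · exact ⟨by simp [AExp.eval], by simp [h9], T.found_congr hQ (by simp)⟩
    · exact absurd h9 he
  · refine .assign (by simp only [AExp.Ok]; omega) ⟨by omega, hst _, by simp [hr], by simp [ha],
      hS _, .inr ?_⟩
    rcases hQ with ⟨h9, -⟩ | ⟨h9, hQ⟩
    · simp [AExp.eval, h9] at he
    · exact ⟨by simp [AExp.eval], by simp [h9], hQ⟩

theorem runs_back (hB : I.Fits B) {b d : ℕ} {σ : ASt} (hb : b ≤ I.n) (h7 : σ.reg 7 = d + 1)
    (h8 : σ.reg 8 = 2) (h : Stack I T.Aux T.PK b (d + 1) σ) :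
    Runs I.N B back σ fun σ' t => t ≤ 2 * I.n ∧ σ'.reg 9 = σ.reg 9 ∧ SameBelow σ σ' d ∧
      ((σ.arr 5 d ≠ 0 ∧ Stack I T.Aux T.PK b d σ' ∧ σ'.reg 7 = d ∧ σ'.reg 8 = 2) ∨
        (σ.arr 5 d = 0 ∧ Stack I T.Aux T.PK b (d + 1) σ' ∧ σ'.reg 7 = d + 1 ∧ σ'.reg 8 = 1 ∧
          σ'.arr 5 d = 1 ∧ σ'.arr 3 d = σ.arr 3 d ∧ σ'.arr 4 d = σ.arr 4 d)) := by
  have hB' : 32 * (I.n + 2) + I.N + I.k + I.f ≤ B := hB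
  have hdb := h.le
  have hN := h.ready.reg2
  refine .ite ⟨trivial, by simp only [AExp.Ok]; omega⟩
    (fun he => by simp [AExp.eval, h7] at he) fun _ => ?_
  refine .seq (.assign ⟨trivial, by simp only [AExp.Ok]; omega⟩ ?_)
  simp only [AExp.eval, h7, Nat.add_sub_cancel]
  have hok : ∀ j < 16, ∀ σ' : ASt, σ'.reg 2 = I.N → σ'.reg 7 = d →
      (AExp.get j (.var 7)).Ok I.N B σ' := fun j hj σ' h2 h7 =>
    ⟨trivial, h2, hj, by simp only [AExp.eval, h7]; omega⟩
  have hR : ∀ x, I.Ready ((σ.setReg 7 d).setReg 14 x) := fun x =>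
    h.ready.congr (by simp) (by simp) (by simp) (by simp) (by simp) (by simp)
  refine .ite (hok 5 (by norm_num) _ (by simpa using hN) (by simp)) (fun he => ?_) fun he => ?_
  · simp only [AExp.eval, ASt.setReg_reg, ASt.setReg_arr, if_true] at he
    refine .seq (.assign (hok 4 (by norm_num) _ (by simpa using hN) (by simp)) ?_)
    simp only [AExp.eval, ASt.setReg_reg, ASt.setReg_arr, if_true]
    refine (runs_unchoose hB (hR _) (by simp) (h.snd_le d (by omega))).mono ?_
    rintro σ₁ t₁ hF₁ ⟨ht₁, h1, h2⟩
    have hr : ∀ r, r ≠ 12 → r ≠ 13 → r ≠ 14 → r ≠ 7 → σ₁.reg r = σ.reg r :=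
      fun r h12 h13 h14 h7 => by
        rw [hF₁.1 r (by simp [unchoose, overNeighbors, forUp, AProg.regs, h12, h13])]
        simp [h14, h7]
    have h7₁ : σ₁.reg 7 = d := by
      rw [hF₁.1 7 (by simp [unchoose, overNeighbors, forUp, AProg.regs])]; simp
    have ha : ∀ j, j ≠ 1 → j ≠ 2 → σ₁.arr j = σ.arr j := fun j hj1 hj2 => by
      rw [hF₁.2.1 j (by simp [unchoose, overNeighbors, forUp, AProg.arrs, hj1, hj2])]; simp
    have hR₁ : I.Ready σ₁ := (hR _).frame hF₁ (by simp [unchoose, overNeighbors, forUp, AProg.regs])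
      (by simp [unchoose, overNeighbors, forUp, AProg.regs])
      (by simp [unchoose, overNeighbors, forUp, AProg.regs])
      (by simp [unchoose, overNeighbors, forUp, AProg.regs])
      (by simp [unchoose, overNeighbors, forUp, AProg.arrs])
      (by simp [unchoose, overNeighbors, forUp, AProg.NoPut])
    have hS : SameBelow σ σ₁ d := fun i hi => by simp [ha]
    have hc : choice σ d = σ.arr 4 d := by simp [choice, he]
    refine ⟨by omega, by simp [hr], hS, .inl ⟨he, stack_pop h hR₁ (by simp [hr])
      (by simp [ha]) (by simp [ha]) hS ?_ ?_, h7₁, by simp [hr, h8]⟩⟩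
    · rw [hc]; simpa using h1
    · rw [hc]; simpa using h2
  · simp only [AExp.eval, ASt.setReg_reg, ASt.setReg_arr, if_true] at he
    refine .seq (.assign (hok 3 (by norm_num) _ (by simpa using hN) (by simp)) ?_)
    simp only [AExp.eval, ASt.setReg_reg, ASt.setReg_arr, if_true]
    refine .seq ((runs_unchoose hB (hR _) (by simp) (h.fst_le d (by omega))).mono ?_)
    rintro σ₁ t₁ hF₁ ⟨ht₁, h1, h2⟩
    have hr : ∀ r, r ≠ 12 → r ≠ 13 → r ≠ 14 → r ≠ 7 → σ₁.reg r = σ.reg r :=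
      fun r h12 h13 h14 h7 => by
        rw [hF₁.1 r (by simp [unchoose, overNeighbors, forUp, AProg.regs, h12, h13])]
        simp [h14, h7]
    have h7₁ : σ₁.reg 7 = d := by
      rw [hF₁.1 7 (by simp [unchoose, overNeighbors, forUp, AProg.regs])]; simp
    have ha : ∀ j, j ≠ 1 → j ≠ 2 → σ₁.arr j = σ.arr j := fun j hj1 hj2 => by
      rw [hF₁.2.1 j (by simp [unchoose, overNeighbors, forUp, AProg.arrs, hj1, hj2])]; simp
    have hR₁ : I.Ready σ₁ := (hR _).frame hF₁ (by simp [unchoose, overNeighbors, forUp, AProg.regs])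
      (by simp [unchoose, overNeighbors, forUp, AProg.regs])
      (by simp [unchoose, overNeighbors, forUp, AProg.regs])
      (by simp [unchoose, overNeighbors, forUp, AProg.regs])
      (by simp [unchoose, overNeighbors, forUp, AProg.arrs])
      (by simp [unchoose, overNeighbors, forUp, AProg.NoPut])
    have hS : SameBelow σ σ₁ d := fun i hi => by simp [ha]
    have hc : choice σ d = σ.arr 3 d := by simp [choice, he]
    have hst₁ : Stack I T.Aux T.PK b d σ₁ := stack_pop h hR₁ (by simp [hr])
      (by simp [ha]) (by simp [ha]) hS (by rw [hc]; simpa using h1) (by rw [hc]; simpa using h2)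
    have hv := h.snd_le d (by omega)
    refine .seq (.set (hok 5 (by norm_num) _ hR₁.reg2 h7₁) (by simp only [AExp.Ok]; omega) ?_)
    refine .seq (.assign (hok 4 (by norm_num) _ (by simpa using hR₁.reg2) (by simpa using h7₁)) ?_)
    simp only [AExp.eval, h7₁, ASt.setArr_reg, ASt.setArr_arr]
    refine .seq ((runs_choose (x := σ.arr 4 d) hB
      (hR₁.congr (by simp) (by simp) (by simp) (by simp) (by simp) (by simp)) (by simp [ha]) hv
      ?_ ?_).mono ?_)
    · have := chosen_le hst₁ hv
      simp; omega
    · intro y hy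
      have := nbrs_le hst₁ hy.le
      simp; omega
    rintro σ₂ t₂ hF₂ ⟨ht₂, h1₂, h2₂⟩
    have hr₂ : ∀ r, r ≠ 12 → r ≠ 13 → r ≠ 14 → σ₂.reg r = σ₁.reg r := fun r h12 h13 h14 => by
      rw [hF₂.1 r (by simp [choose, overNeighbors, forUp, AProg.regs, h12, h13])]
      simp [h14]
    have ha₂ : ∀ j, j ≠ 1 → j ≠ 2 → σ₂.arr j = if j = 5 then Function.update (σ.arr 5) d 1 else
        σ.arr j := fun j hj1 hj2 => by
      rw [hF₂.2.1 j (by simp [choose, overNeighbors, forUp, AProg.arrs, hj1, hj2])]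
      simp only [ASt.setReg_arr, ASt.setArr_arr, ha 5 (by norm_num) (by norm_num), ha j hj1 hj2]
    have hi₂ : σ₂.inp = σ₁.inp := by
      rw [hF₂.2.2 (by simp [choose, overNeighbors, forUp, AProg.NoPut])]
      simp
    have h7₂ : σ₂.reg 7 = d := by rw [hr₂ 7 (by omega) (by omega) (by omega), h7₁]
    refine .seq (.assign ⟨trivial, by simp only [AExp.Ok]; omega, ?_⟩ ?_)
    · simp only [AExp.eval, h7₂]; omega
    refine .assign (by simp only [AExp.Ok]; omega) ?_
    simp only [AExp.eval, h7₂]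
    have hS₁ : ∀ x y, SameBelow σ₁ ((σ₂.setReg 7 x).setReg 8 y) d := fun x y i hi => by
      have : i ≠ d := by omega
      simp [ha₂, ha, Function.update_of_ne this]
    have hS₂ : ∀ x y, SameBelow σ ((σ₂.setReg 7 x).setReg 8 y) d := fun x y i hi => by
      have : i ≠ d := by omega
      simp [ha₂, Function.update_of_ne this]
    have hc₂ : ∀ x y, choice ((σ₂.setReg 7 x).setReg 8 y) d = σ.arr 4 d := by
      simp [choice, ha₂]
    refine ⟨by omega, by simp [hr, hr₂], hS₂ _ _, .inr ⟨he, stack_push hst₁ (by omega)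
      (hR₁.congr ?_ ?_ ?_ ?_ ?_ ?_) ?_ ?_ ?_ (hS₁ _ _) ?_ ?_ ?_ ?_ ?_, ?_, ?_, ?_, ?_, ?_⟩⟩
    · simp [hr₂]
    · simp [hr₂]
    · simp [hr₂]
    · simp [hr₂]
    · simp [hi₂]
    · simp [ha₂, ha]
    · simp [hr₂]
    · simp [ha₂, ha]
    · simp [ha₂, ha]
    · simpa [ha₂] using h.fst_le d (by omega)
    · simpa [ha₂] using hv
    · simp only [ASt.setReg_arr, ha₂ 3 (by norm_num) (by norm_num),
        ha₂ 4 (by norm_num) (by norm_num)]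
      exact T.pk_congr (fun j hj => hS.choice hj) (h.pk d (by omega))
    · rw [hc₂]; simpa using h1₂
    · rw [hc₂]; simpa using h2₂
    · simp
    · simp
    · simp [ha₂]
    · simp [ha₂]
    · simp [ha₂]

/-- If the current bits are those demanded by `orc`, then the new bit 0 either continues the
agreement, or `orc` demands 1 there and its branch lies ahead. A branch that was already ahead
remains so. The count uses S(m + 1) = 2 * S(m) + 3 for subtrees of height m + 1. -/
theorem inv_push {b d : ℕ} {σ σ' : ASt} (h : T.Inv b σ) (hd : d < b) (h7 : σ.reg 7 = d)
    (h8 : σ.reg 8 = 1) (hst : Stack I T.Aux T.PK b (d + 1) σ') (h7' : σ'.reg 7 = d + 1)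
    (h8' : σ'.reg 8 = σ.reg 8) (h9' : σ'.reg 9 = σ.reg 9) (hS : SameBelow σ σ' d)
    (h5 : σ'.arr 5 d = 0) : T.Inv b σ' ∧ remaining b σ' + 1 = remaining b σ := by
  obtain ⟨-, ⟨-, h9, hA⟩ | ⟨h8'', -⟩ | ⟨h8'', -⟩⟩ := h
  rotate_left
  · omega
  · omega
  constructor
  · refine ⟨h7' ▸ hst, .inl ⟨by omega, by omega, fun orc ho => ?_⟩⟩
    rw [h7']
    rcases hA orc ho with hA | hA
    · by_cases hc : orc (σ'.arr 3 d) (σ'.arr 4 d)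
      · exact .inr ⟨d, by omega, hS.agree (h7 ▸ hA), h5, hc⟩
      · exact .inl (Agree.succ (hS.agree (h7 ▸ hA)) (by simp [h5, hc]))
    · exact .inr ((hS.ahead (h7 ▸ hA)).mono (by omega))
  · obtain ⟨m, hm⟩ := Nat.exists_eq_add_of_lt hd
    have h1 : b - d = m + 1 := by omega
    have h2 : b - (d + 1) = m := by omega
    have h3 : b - d - 1 = m := by omega
    simp only [remaining, h8', h8, if_true, h7, h7', pending_succ, h5,
      pending_congr fun i hi => (hS i hi).2.2, h1, h2, pow_succ]
    have := Nat.one_le_two_pow (n := m)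
    simp only [Nat.add_sub_cancel]
    omega

/-- A failed test refutes every `orc` that agrees with the full stack, so the branches of all others
are still ahead. -/
theorem inv_leaf {b : ℕ} {σ σ' : ASt} (h : T.Inv b σ) (h7 : σ.reg 7 = b)
    (h8 : σ.reg 8 = 1) (hst : Stack I T.Aux T.PK b b σ') (h7' : σ'.reg 7 = σ.reg 7)
    (hF : σ'.arr 5 = σ.arr 5) (hS : SameBelow σ σ' b)
    (hQ : (σ'.reg 8 = 0 ∧ σ'.reg 9 = 1 ∧ T.Found σ') ∨
        (σ'.reg 8 = 2 ∧ σ'.reg 9 = 0 ∧ ∀ orc, T.Good b orc → ¬ Agree orc σ b)) :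
    T.Inv b σ' ∧ remaining b σ' + 1 ≤ remaining b σ := by
  obtain ⟨-, ⟨-, h9, hA⟩ | ⟨h8'', -⟩ | ⟨h8'', -⟩⟩ := h
  rotate_left
  · omega
  · omega
  constructor
  · refine ⟨by rwa [h7', h7], ?_⟩
    rcases hQ with ⟨h8', h9', hQ⟩ | ⟨h8', h9', hQ⟩
    · exact .inr (.inr ⟨h8', .inl ⟨h9', by omega, hQ⟩⟩)
    · refine .inr (.inl ⟨h8', h9', fun orc ho => ?_⟩)
      rw [h7', h7]
      exact hS.ahead (((h7 ▸ hA orc ho)).resolve_left (hQ orc ho))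
  · rcases hQ with ⟨h8', -⟩ | ⟨h8', -⟩
    · simp [remaining, h8', h8]
    · simp [remaining, h8', h8, h7', h7, hF]

/-- The first position where the demanded bits exceed the current ones carries the bit 0. It
therefore survives the removal of a top entry with a nonzero bit; if it is the top position itself,
changing the bit to 1 restores agreement. -/
theorem inv_back {b d : ℕ} {σ σ' : ASt} (h : T.Inv b σ) (h7 : σ.reg 7 = d + 1)
    (h8 : σ.reg 8 = 2) (h9' : σ'.reg 9 = σ.reg 9) (hS : SameBelow σ σ' d)
    (hQ : (σ.arr 5 d ≠ 0 ∧ Stack I T.Aux T.PK b d σ' ∧ σ'.reg 7 = d ∧ σ'.reg 8 = 2) ∨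
        (σ.arr 5 d = 0 ∧ Stack I T.Aux T.PK b (d + 1) σ' ∧ σ'.reg 7 = d + 1 ∧ σ'.reg 8 = 1 ∧
          σ'.arr 5 d = 1 ∧ σ'.arr 3 d = σ.arr 3 d ∧ σ'.arr 4 d = σ.arr 4 d)) :
    T.Inv b σ' ∧ remaining b σ' + 1 = remaining b σ := by
  obtain ⟨hst, ⟨h8'', -⟩ | ⟨-, h9, hA⟩ | ⟨h8'', -⟩⟩ := h
  · omega
  rotate_left
  · omega
  have hle := hst.le
  rcases hQ with ⟨h5, hst', h7', h8'⟩ | ⟨h5, hst', h7', h8', h5', h3', h4'⟩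
  · constructor
    · refine ⟨h7' ▸ hst', .inr (.inl ⟨h8', by omega, fun orc ho => ?_⟩)⟩
      rw [h7']
      obtain ⟨j, hj, hA⟩ := hA orc ho
      have : j ≠ d := by rintro rfl; exact h5 hA.2.1
      exact hS.ahead ⟨j, by omega, hA⟩
    · simp [remaining, h8', h8, h7, h7', pending_succ, h5,
        pending_congr fun i hi => (hS i hi).2.2]
  · constructor
    · refine ⟨h7' ▸ hst', .inl ⟨h8', by omega, fun orc ho => ?_⟩⟩
      rw [h7']
      obtain ⟨j, hj, hA, h0, ho'⟩ := hA orc ho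
      rcases (show j ≤ d by omega).eq_or_lt with rfl | hjd
      · exact .inl (Agree.succ (hS.agree hA) (by simp [h5', h3', h4', ho']))
      · exact .inr ((hS.ahead ⟨j, hjd, hA, h0, ho'⟩).mono (by omega))
    · have h1 : b - (d + 1) = b - d - 1 := by omega
      have := Nat.one_le_two_pow (n := b - d - 1)
      simp [remaining, h8', h8, h7, h7', pending_succ, h5, h5',
        pending_congr fun i hi => (hS i hi).2.2, h1]
      omega

/-- A step needs at most `4 * n` inner iterations. With the iteration of the main loop this is at
most `5 * n`, because `n` is positive. -/
theorem runs_step (hB : I.Fits B) {b : ℕ} {σ : ASt} (hb : b ≤ I.n) (h : T.Inv b σ)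
    (h8 : σ.reg 8 ≠ 0) :
    Runs I.N B (step T.pick T.check) σ fun σ' t =>
      T.Inv b σ' ∧ t + 1 + 5 * I.n * remaining b σ' ≤ 5 * I.n * remaining b σ := by
  have hB' : 32 * (I.n + 2) + I.N + I.k + I.f ≤ B := hB
  have hn := I.n_pos
  have hst := h.stack
  have key : ∀ {σ' : ASt} {t : ℕ}, t ≤ 4 * I.n → remaining b σ' + 1 ≤ remaining b σ →
      t + 1 + 5 * I.n * remaining b σ' ≤ 5 * I.n * remaining b σ := fun ht hr => by
    have := Nat.mul_le_mul_left (5 * I.n) hr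
    rw [mul_add] at this
    omega
  refine .ite ⟨trivial, by simp only [AExp.Ok]; omega⟩ (fun he => ?_) fun he => ?_
  · have h8' : σ.reg 8 = 1 := by by_contra hc; simp [AExp.eval, hc] at he
    refine .ite ⟨trivial, trivial⟩ (fun he => ?_) fun he => ?_
    · have hlt : σ.reg 7 < b := by simpa [AExp.eval, hst.reg6] using he
      refine (runs_push hB hb rfl hlt hst).mono ?_
      rintro σ' t - ⟨ht, hst', h7', h8'', h9', hS, h5⟩
      obtain ⟨h1, h2⟩ := inv_push h hlt rfl h8' hst' h7' h8'' h9' hS h5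
      exact ⟨h1, key (by omega) h2.le⟩
    · have hlt : σ.reg 7 = b := by
        have : b ≤ σ.reg 7 := by simpa [AExp.eval, hst.reg6] using he
        exact le_antisymm hst.le this
      refine (runs_leaf hB hb (hlt ▸ hst)).mono ?_
      rintro σ' t - ⟨ht, hst', h7', h5', hS, hQ⟩
      obtain ⟨h1, h2⟩ := inv_leaf h hlt h8' hst' h7' h5' hS hQ
      exact ⟨h1, key (by omega) h2⟩
  · have h8' : σ.reg 8 = 2 := by
      have : σ.reg 8 ≠ 1 := fun hc => by simp [AExp.eval, hc] at he
      rcases h.mode with h | h | h <;> omega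
    obtain h0 | ⟨d, hd⟩ : σ.reg 7 = 0 ∨ ∃ d, σ.reg 7 = d + 1 :=
      (Nat.eq_zero_or_eq_succ_pred _).imp_right fun h => ⟨_, h⟩
    · refine .ite ⟨trivial, by simp only [AExp.Ok]; omega⟩ (fun _ => ?_)
        fun he => by simp [AExp.eval, h0] at he
      refine .assign (by simp only [AExp.Ok]; omega) ?_
      obtain ⟨-, ⟨h8'', -⟩ | ⟨-, h9, hA⟩ | ⟨h8'', -⟩⟩ := h
      · omega
      rotate_left
      · omega
      refine ⟨⟨?_, .inr (.inr ⟨by simp [AExp.eval], .inr ⟨by simp [h9], fun orc ho => ?_⟩⟩)⟩,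
        key (by omega) ?_⟩
      · refine ⟨hst.ready.congr (by simp) (by simp) (by simp) (by simp) (by simp) (by simp),
          T.aux_congr hst.aux (by simp) (by simp) (by simp), by simp [hst.reg6], hst.le, hst.fst_le,
          hst.snd_le, hst.pk, hst.chosen, hst.nbrs⟩
      -- With an empty stack no position can lie ahead, so no `orc` is left and the search may
      -- report failure.
      · obtain ⟨j, hj, -⟩ := hA orc ho
        omega
      · simp [remaining, h8', AExp.eval]
    · refine (runs_back hB hb hd h8' (hd ▸ hst)).mono ?_
      rintro σ' t - ⟨ht, h9', hS, hQ⟩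
      obtain ⟨h1, h2⟩ := inv_back h hd h8' h9' hS hQ
      exact ⟨h1, key (by omega) h2.le⟩

/-- At most `4 * 2 ^ b` steps cost `5 * n` each, and clearing the counters costs `n + 1`. The
constant 23 leaves room for one more iteration, which an enclosing loop can charge here. -/
theorem runs_search (hB : I.Fits B) {b : ℕ} {σ : ASt} (hb : b ≤ I.n) (hR : I.Ready σ)
    (hA : T.Aux σ) (h6 : σ.reg 6 = b) :
    Runs I.N B (search T.pick T.check) σ fun σ' t => t + 1 ≤ 23 * I.n * 2 ^ b ∧
      ((σ'.reg 9 = 1 ∧ Stack I T.Aux T.PK b b σ' ∧ T.Found σ') ∨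
        (σ'.reg 9 = 0 ∧ ∀ orc, ¬ T.Good b orc)) := by
  have hB' : 32 * (I.n + 2) + I.N + I.k + I.f ≤ B := hB
  have hn := I.n_pos
  refine .seq (.assign ⟨trivial, by simp only [AExp.Ok]; omega, ?_⟩ ?_)
  · simp only [AExp.eval, hR.reg3]; omega
  simp only [AExp.eval, hR.reg3]
  refine .seq ((Runs.forUp (a := 0) (b := I.n + 1)
    (fun m σ' => ∀ v < m, σ'.arr 1 v = 0 ∧ σ'.arr 2 v = 0)
    (by simp [AProg.regs]) (by simp [AProg.regs]) (by simp) (by simp only [AExp.Ok]; omega)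
    (by simp [AExp.eval]) (by simp) (by omega) (by omega) (by simp) ?_).mono ?_)
  · intro m σ' _ hm hr hF hI
    have hN : σ'.reg 2 = I.N := by
      rw [hF.1 2 (by simp [forUp, AProg.regs])]; simpa using hR.reg2
    refine .seq (.set ⟨trivial, hN, by norm_num, ?_⟩ (by simp only [AExp.Ok]; omega) ?_)
    · simp only [AExp.eval, hr]; omega
    refine .set ⟨trivial, hN, by norm_num, ?_⟩ (by simp only [AExp.Ok]; omega) ⟨rfl, ?_⟩
    · simp only [AExp.eval, ASt.setArr_reg, hr]; omega
    intro v hv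
    simp only [AExp.eval, ASt.setArr_reg, ASt.setReg_arr, ASt.setArr_arr, hr]
    by_cases hvm : v = m
    · simp [hvm]
    · simpa [Function.update_of_ne hvm] using hI v (by omega)
  rintro σ₁ t₁ hF₁ ⟨ht₁, h0⟩
  have hr : ∀ r, r ≠ 12 → r ≠ 13 → σ₁.reg r = σ.reg r := fun r h12 h13 => by
    rw [hF₁.1 r (by simp [forUp, AProg.regs, h12])]
    simp [h13]
  have ha : ∀ j, j ≠ 1 → j ≠ 2 → σ₁.arr j = σ.arr j := fun j hj1 hj2 => by
    rw [hF₁.2.1 j (by simp [forUp, AProg.arrs, hj1, hj2])]; simp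
  have hi : σ₁.inp = σ.inp := by
    rw [hF₁.2.2 (by simp [forUp, AProg.NoPut])]; simp
  refine .seq (.assign (by simp only [AExp.Ok]; omega) ?_)
  refine .seq (.assign (by simp only [AExp.Ok]; omega) ?_)
  refine .seq (.assign (by simp only [AExp.Ok]; omega) ?_)
  simp only [AExp.eval]
  refine (Runs.loop (N := I.N) (B := B) (e := .var 8) (p := step T.pick T.check) (T.Inv b)
    (fun σ' => 5 * I.n * remaining b σ') ⟨?_, .inl ?_⟩
    fun σ' _ hI => ⟨trivial, runs_step hB hb hI⟩).mono ?_
  · have h7 : (((σ₁.setReg 7 0).setReg 8 1).setReg 9 0).reg 7 = 0 := by simp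
    rw [h7]
    refine ⟨hR.congr (by simp [hr]) (by simp [hr]) (by simp [hr]) (by simp [hr]) (by simp [hi])
      (by simp [ha]), T.aux_congr hA (by simp [hr]) (by simp [ha]) (by simp [ha]),
      by simp [hr, h6],
      Nat.zero_le _, by simp, by simp, by simp, fun v hv => ?_, fun v hv => ?_⟩
    · simpa using (h0 v (by omega)).1
    · simpa using (h0 v (by omega)).2
  · exact ⟨by simp, by simp, fun orc _ => .inl fun i hi => by simp at hi⟩
  · rintro σ' t - ⟨hI, he, hle⟩
    have hrem : remaining b (((σ₁.setReg 7 0).setReg 8 1).setReg 9 0) ≤ 4 * 2 ^ b := by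
      have := Nat.one_le_two_pow (n := b)
      simp [remaining, pending]
    refine ⟨?_, ?_⟩
    · have h1 := Nat.mul_le_mul_left (5 * I.n) hrem
      have h2 : I.n * 1 ≤ I.n * 2 ^ b := Nat.mul_le_mul_left _ Nat.one_le_two_pow
      have h3 : 5 * I.n * (4 * 2 ^ b) = 20 * (I.n * 2 ^ b) := by ring
      have h4 : 23 * I.n * 2 ^ b = 23 * (I.n * 2 ^ b) := by ring
      have : t ≤ 20 * (I.n * 2 ^ b) := by omega
      omega
    · obtain ⟨hst, ⟨h8, -⟩ | ⟨h8, -⟩ | ⟨h8, ⟨h9, h7, hf⟩ | h⟩⟩ := hI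
      · simp [AExp.eval, h8] at he
      · simp [AExp.eval, h8] at he
      · exact .inl ⟨h9, h7 ▸ hst, hf⟩
      · exact .inr h

end Strategy

/-! ### Vertex covers -/

/-- The first `d` choices cover all edges. -/
def Inst.Covers (I : Inst) (c : ℕ → ℕ) (d : ℕ) : Prop :=
  ∀ u v, v ∈ I.adj u → ∃ j < d, c j = u ∨ c j = v

/-- `T` is a vertex cover. -/
def Inst.IsCover (I : Inst) (T : Finset ℕ) : Prop := ∀ u v, v ∈ I.adj u → u ∈ T ∨ v ∈ T

/-- Find a vertex that is not chosen and has fewer chosen neighbors than neighbors. The result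
stands in register `10`; it is `n` if there is no such vertex. -/
def findVertex : AProg :=
  .assign 10 (.var 3) ;;
    forUp 12 (.const 0) 3 (.ite (.get 1 (.var 12)) .skip
      (.ite (.lt (.get 2 (.var 12)) (.inp (.add (.add (.const 3) (.var 3)) (.var 12))))
        (.assign 10 (.var 12)) .skip))

/-- Find an edge no end of which is chosen. -/
def findEdge : AProg :=
  findVertex ;; .assign 11 (.var 3) ;; .assign 13 (.get 0 (.add (.var 10) (.const 1))) ;;
    forUp 12 (.get 0 (.var 10)) 13
      (.ite (.get 1 (.inp (.var 12))) .skip (.assign 11 (.inp (.var 12))))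

/-! ### Finding an uncovered edge from the counters -/

section

variable {I : Inst} {B : ℕ}

theorem chosen_eq_zero {Aux : ASt → Prop} {PK : (ℕ → ℕ) → ℕ → ℕ → ℕ → Prop} {b d : ℕ} {σ : ASt}
    (h : Stack I Aux PK b d σ) {v : ℕ} (hv : v ≤ I.n) :
    σ.arr 1 v = 0 ↔ ∀ i < d, choice σ i ≠ v := by
  rw [h.chosen v hv, Finset.sum_eq_zero_iff]
  refine forall_congr' fun i => ?_
  simp

/-- Double counting of the pairs formed by a stack position and a neighbor of `v` chosen there;
adjacency is symmetric and the lists have no repetitions. -/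
theorem nbrs_eq_sum {Aux : ASt → Prop} {PK : (ℕ → ℕ) → ℕ → ℕ → ℕ → Prop} {b d : ℕ} {σ : ASt}
    (h : Stack I Aux PK b d σ) {v : ℕ} (hv : v ≤ I.n) :
    σ.arr 2 v = ∑ y ∈ (I.adj v).toFinset, σ.arr 1 y := by
  rw [h.nbrs v hv, Finset.sum_congr rfl fun y hy => h.chosen y
    (I.adj_lt (List.mem_toFinset.1 hy)).le, Finset.sum_comm]
  refine Finset.sum_congr rfl fun i _ => ?_
  rw [Finset.sum_ite_eq, List.Nodup.count (I.adj_nodup _)]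
  exact if_congr (by rw [List.mem_toFinset]; exact ⟨I.adj_symm, I.adj_symm⟩) rfl rfl

/-- Degrees are read from the input and compared with the counters, so the scan takes one iteration
per vertex, however many edges there are. -/
theorem runs_findVertex (hB : I.Fits B) {σ : ASt} (hR : I.Ready σ) :
    Runs I.N B findVertex σ fun σ' t => t ≤ I.n ∧
      ((σ'.reg 10 = I.n ∧ ∀ u < I.n, σ.arr 1 u ≠ 0 ∨ (I.adj u).length ≤ σ.arr 2 u) ∨
        (σ'.reg 10 < I.n ∧ σ.arr 1 (σ'.reg 10) = 0 ∧
          σ.arr 2 (σ'.reg 10) < (I.adj (σ'.reg 10)).length)) := by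
  have hB' : 32 * (I.n + 2) + I.N + I.k + I.f ≤ B := hB
  have hNle := I.le_N
  refine .seq (.assign trivial ?_)
  simp only [AExp.eval, hR.reg3, zero_add]
  refine (Runs.forUp (a := 0) (b := I.n) (fun m σ' =>
    ((σ'.reg 10 = I.n ∧ ∀ u < m, σ.arr 1 u ≠ 0 ∨ (I.adj u).length ≤ σ.arr 2 u) ∨
        (σ'.reg 10 < I.n ∧ σ.arr 1 (σ'.reg 10) = 0 ∧
          σ.arr 2 (σ'.reg 10) < (I.adj (σ'.reg 10)).length)))
    (by simp [AProg.regs]) (by simp [AProg.regs]) (by simp) (by simp only [AExp.Ok]; omega)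
    (by simp [AExp.eval]) (by simpa using hR.reg3) (by omega) (by omega) (by simp) ?_).mono ?_
  · intro m σ' _ hm hr hF hI
    have hN : σ'.reg 2 = I.N := by
      rw [hF.1 2 (by simp [forUp, AProg.regs])]; simpa using hR.reg2
    have h3 : σ'.reg 3 = I.n := by
      rw [hF.1 3 (by simp [forUp, AProg.regs])]; simpa using hR.reg3
    have ha : σ'.arr = σ.arr := funext fun j => by
      rw [hF.2.1 j (by simp [forUp, AProg.arrs])]; simp
    have hi : σ'.inp = I.inp := by
      rw [hF.2.2 (by simp [forUp, AProg.NoPut])]; exact hR.inp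
    have hok : ∀ j < 16, (AExp.get j (.var 12)).Ok I.N B σ' := fun j hj =>
      ⟨trivial, hN, hj, by simp only [AExp.eval, hr]; omega⟩
    refine .ite (hok 1 (by norm_num)) (fun he => .skip ⟨rfl, ?_⟩) fun he => ?_
    · simp only [AExp.eval, hr, ha] at he
      refine hI.imp (fun ⟨h1, h2⟩ => ⟨by simpa using h1, fun u hu => ?_⟩) (by simp)
      rcases Nat.lt_succ_iff_lt_or_eq.1 hu with hu | rfl
      exacts [h2 u hu, .inl he]
    simp only [AExp.eval, hr, ha] at he
    refine .ite ⟨hok 2 (by norm_num), ⟨⟨⟨by simp only [AExp.Ok]; omega, trivial, ?_⟩, trivial, ?_⟩,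
      ?_⟩⟩ (fun he2 => ?_) fun he2 => .skip ⟨rfl, ?_⟩
    · simp only [AExp.eval, h3]; omega
    · simp only [AExp.eval, h3, hr]; omega
    · simp only [AExp.eval, h3, hr]; omega
    · refine .assign trivial ⟨rfl, .inr ?_⟩
      have : σ.arr 2 m < (I.adj m).length := by
        by_contra hc
        simp [AExp.eval, h3, hr, hi, ha, I.inp_deg hm, hc] at he2
      simpa [AExp.eval, hr] using ⟨hm, he, this⟩
    · have : ¬ σ.arr 2 m < (I.adj m).length := fun hc => by
        simp [AExp.eval, h3, hr, hi, ha, I.inp_deg hm, hc] at he2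
      refine hI.imp (fun ⟨h1, h2⟩ => ⟨by simpa using h1, fun u hu => ?_⟩) (by simp)
      rcases Nat.lt_succ_iff_lt_or_eq.1 hu with hu | rfl
      exacts [h2 u hu, .inr (by omega)]
  · rintro σ' t - ⟨ht, hI⟩
    exact ⟨by omega, hI⟩

/-- The relation between earlier choices and the next pair in the search for a vertex cover. -/
def Inst.CoverPick (I : Inst) (c : ℕ → ℕ) (i u v : ℕ) : Prop :=
  (u < I.n ∧ v ∈ I.adj u ∧ ∀ j < i, c j ≠ u ∧ c j ≠ v) ∨ (u = I.n ∧ v = I.n ∧ I.Covers c i)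

theorem choice_cases {Aux : ASt → Prop} {b d : ℕ} {σ : ASt} (h : Stack I Aux I.CoverPick b d σ)
    {i : ℕ} (hi : i < d) : (∀ j < i, choice σ j ≠ choice σ i) ∨
      (choice σ i = I.n ∧ I.Covers (choice σ) i) := by
  rcases h.pk i hi with ⟨-, -, hj⟩ | ⟨hu, hv, hc⟩
  · refine .inl fun j hji => ?_
    conv_rhs => unfold choice
    split_ifs
    exacts [(hj j hji).1, (hj j hji).2]
  · exact .inr ⟨by unfold choice; split_ifs <;> assumption, hc⟩

/-- Pairs pushed in the cover search consist of unchosen vertices, so only the dummy `n` can be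
chosen repeatedly. -/
theorem chosen_le_one {Aux : ASt → Prop} {b d : ℕ} {σ : ASt} (h : Stack I Aux I.CoverPick b d σ)
    {v : ℕ} (hv : v < I.n) : σ.arr 1 v ≤ 1 := by
  rw [h.chosen v hv.le, Finset.sum_boole, Nat.cast_id, Finset.card_le_one]
  have key : ∀ i j, i < j → j < d → choice σ i = v → choice σ j ≠ v := fun i j hij hj hi hj' => by
    rcases choice_cases h hj with hc | ⟨hc, -⟩
    · exact hc i hij (hi.trans hj'.symm)
    · omega
  intro i hi j hj
  simp only [Finset.mem_filter, Finset.mem_range] at hi hj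
  rcases lt_trichotomy i j with hij | hij | hij
  · exact absurd hj.2 (key i j hij hj.1 hi.2)
  · exact hij
  · exact absurd hi.2 (key j i hij hi.1 hj.2)

theorem exists_unchosen_nbr {Aux : ASt → Prop} {PK : (ℕ → ℕ) → ℕ → ℕ → ℕ → Prop} {b d : ℕ}
    {σ : ASt} (h : Stack I Aux PK b d σ) {u : ℕ} (hu : u < I.n)
    (hlt : σ.arr 2 u < (I.adj u).length) : ∃ v ∈ I.adj u, σ.arr 1 v = 0 := by
  by_contra! hc
  rw [nbrs_eq_sum h hu.le, ← List.toFinset_card_of_nodup (I.adj_nodup u)] at hlt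
  have := Finset.card_nsmul_le_sum (I.adj u).toFinset (fun y => σ.arr 1 y) 1 fun y hy =>
    Nat.one_le_iff_ne_zero.2 (hc y (List.mem_toFinset.1 hy))
  simp only [smul_eq_mul, mul_one] at this
  omega

/-- Since no neighbor counts more than once, a counter that reaches the degree must have counted
every neighbor. -/
theorem chosen_nbr {Aux : ASt → Prop} {b d : ℕ} {σ : ASt} (h : Stack I Aux I.CoverPick b d σ)
    {u v : ℕ} (hu : u < I.n) (hle : (I.adj u).length ≤ σ.arr 2 u) (hv : v ∈ I.adj u) :
    σ.arr 1 v ≠ 0 := by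
  intro h0
  rw [nbrs_eq_sum h hu.le, ← List.toFinset_card_of_nodup (I.adj_nodup u),
    Finset.card_eq_sum_ones] at hle
  refine absurd hle (not_le.2 (Finset.sum_lt_sum (fun y hy => ?_) ⟨v, List.mem_toFinset.2 hv, ?_⟩))
  · exact chosen_le_one h (I.adj_lt (List.mem_toFinset.1 hy))
  · simp [h0]

theorem cover_of_saturated {Aux : ASt → Prop} {b d : ℕ} {σ : ASt}
    (h : Stack I Aux I.CoverPick b d σ)
    (hs : ∀ u < I.n, σ.arr 1 u ≠ 0 ∨ (I.adj u).length ≤ σ.arr 2 u) {u v : ℕ} (hv : v ∈ I.adj u) :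
    σ.arr 1 u ≠ 0 ∨ σ.arr 1 v ≠ 0 :=
  (hs u (I.adj_lt (I.adj_symm hv))).imp id fun hle =>
    chosen_nbr h (I.adj_lt (I.adj_symm hv)) hle hv

/-- If no vertex has an uncovered edge, `findVertex` returns the dummy `n`, whose list is empty;
register `11` then keeps its default `n`, and the stack is padded with the pair of dummies.
Otherwise the vertex found is unchosen and has an unchosen neighbor, and one scan of its list yields
it. -/
theorem runs_findEdge (hB : I.Fits B) {Aux : ASt → Prop} {b d : ℕ} {σ : ASt}
    (h : Stack I Aux I.CoverPick b d σ) :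
    Runs I.N B findEdge σ fun σ' t => t ≤ 2 * I.n ∧ σ'.reg 10 ≤ I.n ∧
      σ'.reg 11 ≤ I.n ∧ I.CoverPick (choice σ) d (σ'.reg 10) (σ'.reg 11) := by
  have hB' : 32 * (I.n + 2) + I.N + I.k + I.f ≤ B := hB
  have hNle := I.le_N
  refine .seq ((runs_findVertex hB h.ready).mono ?_)
  rintro σ₁ t₁ hF₁ ⟨ht₁, hQ⟩
  have hR₁ : I.Ready σ₁ := h.ready.frame hF₁ (by simp [findVertex, forUp, AProg.regs])
    (by simp [findVertex, forUp, AProg.regs]) (by simp [findVertex, forUp, AProg.regs])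
    (by simp [findVertex, forUp, AProg.regs]) (by simp [findVertex, forUp, AProg.arrs])
    (by simp [findVertex, forUp, AProg.NoPut])
  have ha : σ₁.arr = σ.arr := funext fun j => hF₁.2.1 j (by simp [findVertex, forUp, AProg.arrs])
  obtain ⟨u, hu⟩ : ∃ u, σ₁.reg 10 = u := ⟨_, rfl⟩
  rw [hu] at hQ
  have hun : u ≤ I.n := by rcases hQ with ⟨h, -⟩ | ⟨h, -⟩ <;> omega
  have h0 := hR₁.arr0 u (by omega)
  have h1 := hR₁.arr0 (u + 1) (by omega)
  have ho := I.off_succ u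
  have hoN := I.off_le (v := u + 1) (by omega)
  have hlen := I.length_adj_le u
  refine .seq (.assign trivial ?_)
  refine .seq (.assign ?_ ?_)
  · simp [AExp.Ok, AExp.eval, hu, hR₁.reg2]; omega
  simp only [AExp.eval, ASt.setReg_reg, ASt.setReg_arr, hu, hR₁.reg3]
  refine (Runs.forUp (a := I.off u) (b := I.off (u + 1)) (fun m σ' =>
    (σ'.reg 11 = I.n ∧ ∀ y ∈ (I.adj u).take (m - I.off u), σ.arr 1 y ≠ 0) ∨
      (σ'.reg 11 ∈ I.adj u ∧ σ.arr 1 (σ'.reg 11) = 0))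
    (by simp [AProg.regs]) (by simp [AProg.regs]) (by simp) ?_ ?_ ?_ ?_ ?_ ?_ ?_).mono ?_
  · simp [AExp.Ok, AExp.eval, hu, hR₁.reg2]; omega
  · simp [AExp.eval, hu, h0]
  · simp [h1]
  · omega
  · omega
  · simp
  · intro m σ' hm1 hm hr hF hI
    obtain ⟨m, rfl⟩ := Nat.exists_eq_add_of_le hm1
    have hm : m < (I.adj u).length := by omega
    have hN : σ'.reg 2 = I.N := by
      rw [hF.1 2 (by simp [forUp, AProg.regs])]; simpa using hR₁.reg2
    have ha' : σ'.arr = σ.arr := funext fun j => by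
      rw [hF.2.1 j (by simp [forUp, AProg.arrs])]; simp [ha]
    have hi : σ'.inp = I.inp := by
      rw [hF.2.2 (by simp [forUp, AProg.NoPut])]; exact hR₁.inp
    have hy := I.inp_adj u m hm
    have hyn : (I.adj u)[m] < I.n := I.adj_lt (List.getElem_mem hm)
    refine .ite ⟨⟨trivial, ?_⟩, hN, by norm_num, ?_⟩ (fun he => .skip ⟨rfl, ?_⟩)
      fun he => .assign ⟨trivial, ?_⟩ ⟨rfl, .inr ?_⟩
    · simp only [AExp.eval, hr]; omega
    · simp only [AExp.eval, hr, hi, hy]; omega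
    · simp only [AExp.eval, hr, hi, hy, ha'] at he
      refine hI.imp (fun ⟨h1, h2⟩ => ⟨by simpa using h1, ?_⟩) (by simp)
      have : I.off u + m + 1 - I.off u = m + 1 := by omega
      rw [this, List.take_succ_eq_append_getElem hm]
      rw [Nat.add_sub_cancel_left] at h2
      intro y hy
      rcases List.mem_append.1 hy with hy | hy
      · exact h2 y hy
      · rwa [List.mem_singleton.1 hy]
    · simp only [AExp.eval, hr]; omega
    · simp only [AExp.eval, hr, hi, hy, ha'] at he
      simp [AExp.eval, hr, hi, hy, he]
  · rintro σ' t hF ⟨ht, hI⟩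
    have hu' : σ'.reg 10 = u := by
      rw [hF.1 10 (by simp [forUp, AProg.regs])]; simp [hu]
    refine ⟨by omega, by omega, ?_, ?_⟩
    · rcases hI with ⟨h, -⟩ | ⟨h, -⟩
      · omega
      · exact (I.adj_lt h).le
    rw [hu']
    rw [ho, Nat.add_sub_cancel_left, List.take_length] at hI
    rcases hQ with ⟨rfl, hs⟩ | ⟨hun, hu1, hu2⟩
    · refine .inr ⟨rfl, ?_, fun x y hy => ?_⟩
      · rcases hI with ⟨h, -⟩ | ⟨h, -⟩
        · exact h
        · simp [I.adj_of_le le_rfl] at h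
      · by_contra! hc
        rcases cover_of_saturated h hs hy with hx | hx
        · exact hx ((chosen_eq_zero h (I.adj_lt (I.adj_symm hy)).le).2 fun i hi => (hc i hi).1)
        · exact hx ((chosen_eq_zero h (I.adj_lt hy).le).2 fun i hi => (hc i hi).2)
    · rcases hI with ⟨-, hI⟩ | ⟨hv, hv0⟩
      · obtain ⟨y, hy, hy0⟩ := exists_unchosen_nbr h hun hu2
        exact absurd hy0 (hI y hy)
      · exact .inl ⟨hun, hv, fun j hj => ⟨(chosen_eq_zero h hun.le).1 hu1 j hj,
          (chosen_eq_zero h (I.adj_lt hv).le).1 hv0 j hj⟩⟩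

/-- Following `T`, every choice lies in `T`, as `T` contains an end of each edge on the stack. While
an edge is uncovered no dummies are pushed, so the `b` choices are distinct. As `T` has at most `b`
elements they exhaust `T`, and then the uncovered edge meets `T` in a chosen vertex. -/
theorem not_agree_of_uncovered {Aux : ASt → Prop} {b : ℕ} {σ : ASt}
    (h : Stack I Aux I.CoverPick b b σ) {x y : ℕ} (hy : y ∈ I.adj x) (hx0 : σ.arr 1 x = 0)
    (hy0 : σ.arr 1 y = 0) {T : Finset ℕ} (hT : I.IsCover T) (hTb : T.card ≤ b) :
    ¬ Agree (fun u _ => u ∉ T) σ b := by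
  intro hA
  rw [chosen_eq_zero h (I.adj_lt (I.adj_symm hy)).le] at hx0
  rw [chosen_eq_zero h (I.adj_lt hy).le] at hy0
  have hnc : ∀ i ≤ b, ¬ I.Covers (choice σ) i := fun i hi hc => by
    obtain ⟨j, hj, hj' | hj'⟩ := hc x y hy
    exacts [hx0 j (by omega) hj', hy0 j (by omega) hj']
  have hmem : ∀ i < b, choice σ i ∈ T := fun i hi => by
    rcases h.pk i hi with ⟨-, hv, -⟩ | ⟨-, -, hc⟩
    · have hAi := hA i hi
      unfold choice
      split_ifs with h5
      · by_contra hc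
        exact hAi.2 hc h5
      · exact (hT _ _ hv).resolve_left (hAi.1 h5)
    · exact absurd hc (hnc i hi.le)
  have hinj : Set.InjOn (choice σ) (Finset.range b) := by
    have key : ∀ i j, i < j → j < b → choice σ i ≠ choice σ j := fun i j hij hj =>
      (choice_cases h hj).elim (fun hc => hc i hij) fun hc => absurd hc.2 (hnc j hj.le)
    intro i hi j hj hij
    simp only [Finset.coe_range, Set.mem_Iio] at hi hj
    rcases lt_trichotomy i j with hl | hl | hl
    · exact absurd hij (key i j hl hj)
    · exact hl
    · exact absurd hij.symm (key j i hl hi)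
  have himg : (Finset.range b).image (choice σ) = T := by
    refine Finset.eq_of_subset_of_card_le (fun z hz => ?_) ?_
    · obtain ⟨i, hi, rfl⟩ := Finset.mem_image.1 hz
      exact hmem i (Finset.mem_range.1 hi)
    · rwa [Finset.card_image_of_injOn hinj, Finset.card_range]
  rcases hT x y hy with hx | hx <;> rw [← himg] at hx <;>
    obtain ⟨i, hi, hix⟩ := Finset.mem_image.1 hx
  exacts [hx0 i (Finset.mem_range.1 hi) hix, hy0 i (Finset.mem_range.1 hi) hix]

variable (I)

/-- The search for a vertex cover: one end of each edge has to be chosen. -/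
def coverStrategy : Strategy I where
  pick := findEdge
  check := findVertex ;; .assign 9 (.eq (.var 10) (.var 3))
  Aux := fun _ => True
  PK := I.CoverPick
  -- Bit 0 takes the first end when it lies in the cover; otherwise the second end must lie in it.
  Good := fun b orc => ∃ T : Finset ℕ, T.card ≤ b ∧ I.IsCover T ∧ orc = fun u _ => u ∉ T
  Found := fun σ => ∀ u v, v ∈ I.adj u → σ.arr 1 u ≠ 0 ∨ σ.arr 1 v ≠ 0
  aux_congr := fun _ _ _ _ => trivial
  pk_congr := fun {c c' i u v} hc h => by
    refine h.imp (fun ⟨h1, h2, h3⟩ => ⟨h1, h2, fun j hj => by rw [hc j hj]; exact h3 j hj⟩)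
      fun ⟨h1, h2, h3⟩ => ⟨h1, h2, fun x y hy => ?_⟩
    obtain ⟨j, hj, h⟩ := h3 x y hy
    exact ⟨j, hj, by rwa [hc j hj]⟩
  found_congr := fun h ha => by rwa [ha]
  pick_regs := by simp [findEdge, findVertex, forUp, AProg.regs]
  pick_arrs := by simp [findEdge, findVertex, forUp, AProg.arrs]
  pick_noPut := by simp [findEdge, findVertex, forUp, AProg.NoPut]
  check_regs := by simp [findVertex, forUp, AProg.regs]
  check_arrs := by simp [findVertex, forUp, AProg.arrs]
  check_noPut := by simp [findVertex, forUp, AProg.NoPut]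
  runs_pick := fun hB _ _ _ _ _ _ h => runs_findEdge hB h
  runs_check := fun {B} hB {b σ} _ h => by
    refine .seq ((runs_findVertex hB h.ready).mono ?_)
    rintro σ₁ t₁ hF₁ ⟨ht₁, hQ⟩
    have h3 : σ₁.reg 3 = I.n := by
      rw [hF₁.1 3 (by simp [findVertex, forUp, AProg.regs]), h.ready.reg3]
    have ha : σ₁.arr = σ.arr := funext fun j =>
      hF₁.2.1 j (by simp [findVertex, forUp, AProg.arrs])
    refine .assign ⟨trivial, trivial⟩ ⟨by omega, ?_⟩
    rcases hQ with ⟨hu, hs⟩ | ⟨hu, hu1, hu2⟩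
    · refine .inl ⟨by simp [AExp.eval, hu, h3], fun x y hy => ?_⟩
      simpa [ha] using cover_of_saturated h hs hy
    · refine .inr ⟨by simp [AExp.eval, h3, hu.ne], ?_⟩
      rintro orc ⟨T, hTb, hT, rfl⟩
      obtain ⟨y, hy, hy0⟩ := exists_unchosen_nbr h hu hu2
      exact not_agree_of_uncovered h hy hu1 hy0 hT hTb

end

/-! ### Balanced independent sets -/

/-- `L` is an `f`-balanced independent set. -/
structure Inst.Balanced (I : Inst) (L : Finset ℕ) : Prop where
  lt : ∀ v ∈ L, v < I.n
  indep : ∀ u ∈ L, ∀ v ∈ L, v ∉ I.adj u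
  card : ∀ c < I.k, (L.filter fun v => I.col v = c).card = I.f

/-- The number of vertices of color `c` below `m` at which `g` does not vanish. -/
def Inst.numCol (I : Inst) (g : ℕ → ℕ) (m c : ℕ) : ℕ :=
  ((Finset.range m).filter fun v => g v ≠ 0 ∧ I.col v = c).card

/-- The color of the vertex in register `12`. -/
def colExp : AExp := .inp (.add (.const 3) (.var 12))

/-- Increase the number of selected vertices of the color of the vertex in register `12`. -/
def countColor : AProg := .set 8 colExp (.add (.get 8 colExp) (.const 1))

/-- Select the chosen vertices in array `9`, count their colors in array `8`, and set register `10`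
if two of them are adjacent. -/
def selectChosen : AProg :=
  .assign 10 (.const 0) ;; forUp 12 (.const 0) 4 (.set 8 (.var 12) (.const 0)) ;;
    forUp 12 (.const 0) 3 (.ite (.get 1 (.var 12))
      (.set 9 (.var 12) (.const 1) ;; countColor ;;
        .ite (.get 2 (.var 12)) (.assign 10 (.const 1)) .skip)
      (.set 9 (.var 12) (.const 0)))

/-- Select further vertices outside the vertex cover as long as their colors are needed. -/
def selectFree : AProg :=
  forUp 12 (.const 0) 3 (.ite (.get 7 (.var 12)) .skip (.ite (.get 2 (.var 12)) .skip
    (.ite (.lt (.get 8 colExp) (.var 5)) (.set 9 (.var 12) (.const 1) ;; countColor) .skip)))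

/-- Set register `10` if the number of selected vertices of some color is wrong. -/
def testColors : AProg :=
  forUp 12 (.const 0) 4 (.ite (.eq (.get 8 (.var 12)) (.var 5)) .skip (.assign 10 (.const 1)))

/-- Complete the chosen vertices to an `f`-balanced independent set. -/
def complete : AProg :=
  selectChosen ;; selectFree ;; testColors ;; .assign 9 (.eq (.var 10) (.const 0))

/-! ### The loops of the greedy completion -/

section

variable {I : Inst} {B : ℕ}

theorem numCol_succ (g : ℕ → ℕ) (m c : ℕ) :
    I.numCol g (m + 1) c = I.numCol g m c + if g m ≠ 0 ∧ I.col m = c then 1 else 0 := by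
  unfold Inst.numCol
  rw [Finset.range_add_one, Finset.filter_insert]
  split_ifs with h
  · rw [Finset.card_insert_of_notMem (by simp)]
  · simp

theorem numCol_le (g : ℕ → ℕ) (m c : ℕ) : I.numCol g m c ≤ m :=
  (Finset.card_filter_le _ _).trans (by simp)

/-- The hypothesis `h0` ensures that the vertex was not counted before. -/
theorem numCol_update {g : ℕ → ℕ} {m v : ℕ} (hv : v < m) (h0 : g v = 0) (c : ℕ) :
    I.numCol (Function.update g v 1) m c = I.numCol g m c + if I.col v = c then 1 else 0 := by
  unfold Inst.numCol
  split_ifs with h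
  · rw [← Finset.card_insert_of_notMem (a := v) (by simp [h0])]
    congr 1
    ext u
    by_cases hu : u = v
    · subst hu; simp [hv, h]
    · simp [hu]
  · rw [add_zero]
    congr 1
    ext u
    by_cases hu : u = v
    · subst hu; simp [h]
    · simp [Function.update_of_ne hu]

theorem runs_countColor (hB : I.Fits B) (hk : I.k ≤ I.n) {σ : ASt} {v : ℕ} (hv : v < I.n)
    (h12 : σ.reg 12 = v) (h2 : σ.reg 2 = I.N) (hi : σ.inp = I.inp)
    (h8 : σ.arr 8 (I.col v) ≤ I.n) :
    Runs I.N B countColor σ fun σ' t => t = 0 ∧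
      σ'.arr 8 = fun c => σ.arr 8 c + if I.col v = c then 1 else 0 := by
  have hB' : 32 * (I.n + 2) + I.N + I.k + I.f ≤ B := hB
  have hNle := I.le_N
  have hcol := I.col_lt hv
  have hc : colExp.Ok I.N B σ := by
    refine ⟨⟨?_, trivial, ?_⟩, ?_⟩
    · simp only [AExp.Ok]; omega
    · simp only [AExp.eval, h12]; omega
    · simp only [AExp.eval, h12]; omega
  have hc' : colExp.eval σ = I.col v := by simp only [colExp, AExp.eval, h12, hi, I.inp_col hv]
  have hg : (AExp.get 8 colExp).Ok I.N B σ := ⟨hc, h2, by norm_num, by rw [hc']; omega⟩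
  refine .set hg ⟨hg, ?_, ?_⟩ ⟨rfl, ?_⟩
  · simp only [AExp.Ok]; omega
  · simp only [AExp.eval, hc']; omega
  · funext c
    simp only [ASt.setArr_arr, if_true, AExp.eval, hc']
    by_cases h : c = I.col v
    · subst h; simp
    · simp [Function.update_of_ne h, Ne.symm h]

theorem get_ok (hB : I.Fits B) {σ : ASt} {v : ℕ} (hv : v < I.n) (h12 : σ.reg 12 = v)
    (h2 : σ.reg 2 = I.N) {j : ℕ} (hj : j < 16) : (AExp.get j (.var 12)).Ok I.N B σ := by
  have hB' : 32 * (I.n + 2) + I.N + I.k + I.f ≤ B := hB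
  exact ⟨trivial, h2, hj, by simp only [AExp.eval, h12]; omega⟩

theorem runs_selectChosen (hB : I.Fits B) (hk : I.k ≤ I.n) {σ : ASt} (hR : I.Ready σ) :
    Runs I.N B selectChosen σ fun σ' t => t ≤ 2 * I.n ∧
      (∀ v < I.n, σ'.arr 9 v ≠ 0 ↔ σ.arr 1 v ≠ 0) ∧
      (∀ c < I.k, σ'.arr 8 c = I.numCol (σ.arr 1) I.n c) ∧
      (σ'.reg 10 ≠ 0 ↔ ∃ v < I.n, σ.arr 1 v ≠ 0 ∧ σ.arr 2 v ≠ 0) := by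
  have hB' : 32 * (I.n + 2) + I.N + I.k + I.f ≤ B := hB
  refine .seq (.assign (by simp only [AExp.Ok]; omega) ?_)
  simp only [AExp.eval]
  refine .seq ((Runs.forUp (a := 0) (b := I.k) (fun m σ' => ∀ c < m, σ'.arr 8 c = 0)
    (by simp [AProg.regs]) (by simp [AProg.regs]) (by simp) (by simp only [AExp.Ok]; omega)
    (by simp [AExp.eval]) (by simpa using hR.reg4) (by omega) (by omega) (by simp) ?_).mono ?_)
  · intro m σ' _ hm hr hF hI
    have hN : σ'.reg 2 = I.N := by
      rw [hF.1 2 (by simp [forUp, AProg.regs])]; simpa using hR.reg2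
    refine .set (get_ok hB (by omega) hr hN (by norm_num)) (by simp only [AExp.Ok]; omega)
      ⟨rfl, fun c hc => ?_⟩
    simp only [AExp.eval, ASt.setReg_arr, ASt.setArr_arr, if_true, hr]
    by_cases hcm : c = m
    · simp [hcm]
    · simpa [Function.update_of_ne hcm] using hI c (by omega)
  rintro σ₁ t₁ hF₁ ⟨ht₁, h0⟩
  have hR₁ : I.Ready σ₁ := Inst.Ready.frame (σ := σ.setReg 10 0)
    (hR.congr (by simp) (by simp) (by simp) (by simp) (by simp) (by simp)) hF₁
    (by simp [forUp, AProg.regs]) (by simp [forUp, AProg.regs]) (by simp [forUp, AProg.regs])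
    (by simp [forUp, AProg.regs]) (by simp [forUp, AProg.arrs]) (by simp [forUp, AProg.NoPut])
  have ha₁ : ∀ j, j ≠ 8 → σ₁.arr j = σ.arr j := fun j hj => by
    rw [hF₁.2.1 j (by simp [forUp, AProg.arrs, hj])]; simp
  have h10 : σ₁.reg 10 = 0 := by rw [hF₁.1 10 (by simp [forUp, AProg.regs])]; simp
  refine (Runs.forUp (a := 0) (b := I.n) (fun m σ' =>
      (∀ v < m, σ'.arr 9 v ≠ 0 ↔ σ.arr 1 v ≠ 0) ∧
      (∀ c < I.k, σ'.arr 8 c = I.numCol (σ.arr 1) m c) ∧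
      (σ'.reg 10 ≠ 0 ↔ ∃ v < m, σ.arr 1 v ≠ 0 ∧ σ.arr 2 v ≠ 0))
    (by simp [countColor, AProg.regs]) (by simp [countColor, AProg.regs]) (by simp)
    (by simp only [AExp.Ok]; omega)
    (by simp [AExp.eval]) (by simpa using hR₁.reg3) (by omega) (by omega) ?_ ?_).mono ?_
  · refine ⟨by simp, fun c hc => ?_, by simp [h10]⟩
    simp [h0 c hc, Inst.numCol]
  · rintro m σ' _ hm hr hF ⟨hI9, hI8, hI10⟩
    have hN : σ'.reg 2 = I.N := by
      rw [hF.1 2 (by simp [forUp, countColor, AProg.regs])]; simpa using hR₁.reg2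
    have ha : ∀ j, j ≠ 8 → j ≠ 9 → σ'.arr j = σ.arr j := fun j hj8 hj9 => by
      rw [hF.2.1 j (by simp [forUp, countColor, AProg.arrs, hj8, hj9]), ha₁ j hj8]
    have hi : σ'.inp = I.inp := by
      rw [hF.2.2 (by simp [forUp, countColor, AProg.NoPut])]; exact hR₁.inp
    have hcol := I.col_lt hm
    have hnum := numCol_le (I := I) (σ.arr 1) m (I.col m)
    have hsplit : (∃ v < m + 1, σ.arr 1 v ≠ 0 ∧ σ.arr 2 v ≠ 0) ↔
        (∃ v < m, σ.arr 1 v ≠ 0 ∧ σ.arr 2 v ≠ 0) ∨ (σ.arr 1 m ≠ 0 ∧ σ.arr 2 m ≠ 0) := by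
      constructor
      · rintro ⟨v, hv, h⟩
        rcases Nat.lt_succ_iff_lt_or_eq.1 hv with hv | rfl
        exacts [.inl ⟨v, hv, h⟩, .inr h]
      · rintro (⟨v, hv, h⟩ | h)
        exacts [⟨v, by omega, h⟩, ⟨m, by omega, h⟩]
    refine .ite (get_ok hB hm hr hN (by norm_num)) (fun he => ?_) fun he => ?_
    · simp only [AExp.eval, hr, ha 1 (by norm_num) (by norm_num)] at he
      refine .seq (.set (get_ok hB hm hr hN (by norm_num)) (by simp only [AExp.Ok]; omega) ?_)
      refine .seq ((runs_countColor hB hk hm (by simpa using hr) (by simpa using hN)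
        (by simpa using hi) (by simp [hI8 _ hcol]; omega)).mono ?_)
      rintro σ₂ t₂ hF₂ ⟨rfl, h8₂⟩
      have hr₂ : ∀ r, σ₂.reg r = σ'.reg r := fun r => by
        rw [hF₂.1 r (by simp [countColor, AProg.regs])]; simp
      have ha₂ : ∀ j, j ≠ 8 → j ≠ 9 → σ₂.arr j = σ.arr j := fun j hj8 hj9 => by
        rw [hF₂.2.1 j (by simp [countColor, AProg.arrs, hj8])]; simp [hj9, ha j hj8 hj9]
      have h9₂ : σ₂.arr 9 = Function.update (σ'.arr 9) m 1 := by
        rw [hF₂.2.1 9 (by simp [countColor, AProg.arrs])]; simp [AExp.eval, hr]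
      have hA : (∀ v < m + 1, σ₂.arr 9 v ≠ 0 ↔ σ.arr 1 v ≠ 0) ∧
          (∀ c < I.k, σ₂.arr 8 c = I.numCol (σ.arr 1) (m + 1) c) := by
        refine ⟨fun v hv => ?_, fun c hc => ?_⟩
        · rw [h9₂]
          by_cases hvm : v = m
          · simp [hvm, he]
          · rw [Function.update_of_ne hvm]
            exact hI9 v (by omega)
        · rw [h8₂, numCol_succ]
          simp [hI8 c hc, he]
      refine .ite (get_ok hB hm (by rw [hr₂, hr]) (by rw [hr₂, hN]) (by norm_num)) (fun he2 => ?_)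
        fun he2 => ?_
      · simp only [AExp.eval, hr₂, hr, ha₂ 2 (by norm_num) (by norm_num)] at he2
        refine .assign (by simp only [AExp.Ok]; omega) ⟨rfl, hA.1, hA.2, ?_⟩
        rw [hsplit]
        simp [AExp.eval, he, he2]
      · simp only [AExp.eval, hr₂, hr, ha₂ 2 (by norm_num) (by norm_num)] at he2
        refine .skip ⟨rfl, hA.1, hA.2, ?_⟩
        rw [hsplit, ← hI10]
        simp [hr₂, he2]
    · simp only [AExp.eval, hr, ha 1 (by norm_num) (by norm_num)] at he
      refine .set (get_ok hB hm hr hN (by norm_num)) (by simp only [AExp.Ok]; omega)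
        ⟨rfl, fun v hv => ?_, fun c hc => ?_, ?_⟩
      · simp only [AExp.eval, ASt.setReg_arr, ASt.setArr_arr, if_true, hr]
        by_cases hvm : v = m
        · simp [hvm, he]
        · rw [Function.update_of_ne hvm]
          exact hI9 v (by omega)
      · rw [numCol_succ]
        simp [hI8 c hc, he]
      · rw [hsplit, ← hI10]
        simp [he]
  · rintro σ' t - ⟨ht, hI⟩
    exact ⟨by omega, hI⟩

/-- The last conclusion is the maximality of the greedy choice: a free vertex is passed over only if
its color already has `f` selected vertices, and the counts never decrease. The premise `h79` says
that initially selected vertices lie in the cover, which keeps the loop from counting a vertex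
twice. -/
theorem runs_selectFree (hB : I.Fits B) (hk : I.k ≤ I.n) {σ : ASt} (hR : I.Ready σ)
    (h79 : ∀ v < I.n, σ.arr 9 v ≠ 0 → σ.arr 7 v ≠ 0)
    (h8 : ∀ c < I.k, σ.arr 8 c = I.numCol (σ.arr 9) I.n c) :
    Runs I.N B selectFree σ fun σ' t => t ≤ I.n ∧
      (∀ v < I.n, σ'.arr 9 v ≠ 0 → σ.arr 9 v ≠ 0 ∨ (σ.arr 7 v = 0 ∧ σ.arr 2 v = 0)) ∧
      (∀ v < I.n, σ.arr 9 v ≠ 0 → σ'.arr 9 v ≠ 0) ∧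
      (∀ c < I.k, σ'.arr 8 c = I.numCol (σ'.arr 9) I.n c) ∧
      (∀ c < I.k, σ'.arr 8 c ≤ max I.f (σ.arr 8 c)) ∧
      (∀ v < I.n, σ.arr 7 v = 0 → σ.arr 2 v = 0 → σ'.arr 9 v ≠ 0 ∨ I.f ≤ σ'.arr 8 (I.col v)) := by
  have hB' : 32 * (I.n + 2) + I.N + I.k + I.f ≤ B := hB
  have hNle := I.le_N
  refine (Runs.forUp (a := 0) (b := I.n) (fun m σ' =>
      (∀ v < I.n, σ'.arr 9 v ≠ 0 → σ.arr 9 v ≠ 0 ∨ (v < m ∧ σ.arr 7 v = 0 ∧ σ.arr 2 v = 0)) ∧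
      (∀ v < I.n, σ.arr 9 v ≠ 0 → σ'.arr 9 v ≠ 0) ∧
      (∀ c < I.k, σ'.arr 8 c = I.numCol (σ'.arr 9) I.n c) ∧
      (∀ c < I.k, σ'.arr 8 c ≤ max I.f (σ.arr 8 c)) ∧
      (∀ v < m, σ.arr 7 v = 0 → σ.arr 2 v = 0 → σ'.arr 9 v ≠ 0 ∨ I.f ≤ σ'.arr 8 (I.col v)))
    (by simp [countColor, AProg.regs]) (by simp [countColor, AProg.regs]) (by simp)
    (by simp only [AExp.Ok]; omega)
    (by simp [AExp.eval]) (by simpa using hR.reg3) (by omega) (by omega) ?_ ?_).mono ?_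
  · exact ⟨fun v _ h => .inl h, fun v _ h => h, by simpa using h8, fun c _ => le_max_right _ _,
      by simp⟩
  · rintro m σ' _ hm hr hF ⟨hIa, hIb, hI8, hIm, hIf⟩
    have hN : σ'.reg 2 = I.N := by
      rw [hF.1 2 (by simp [forUp, countColor, AProg.regs])]; simpa using hR.reg2
    have h5 : σ'.reg 5 = I.f := by
      rw [hF.1 5 (by simp [forUp, countColor, AProg.regs])]; simpa using hR.reg5
    have ha : ∀ j, j ≠ 8 → j ≠ 9 → σ'.arr j = σ.arr j := fun j hj8 hj9 => by
      rw [hF.2.1 j (by simp [forUp, countColor, AProg.arrs, hj8, hj9])]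
    have hi : σ'.inp = I.inp := by
      rw [hF.2.2 (by simp [forUp, countColor, AProg.NoPut])]; exact hR.inp
    have hcol := I.col_lt hm
    have hnum := numCol_le (I := I) (σ'.arr 9) I.n (I.col m)
    have hIa' : ∀ v < I.n, σ'.arr 9 v ≠ 0 →
        σ.arr 9 v ≠ 0 ∨ (v < m + 1 ∧ σ.arr 7 v = 0 ∧ σ.arr 2 v = 0) := fun v hv h =>
      (hIa v hv h).imp id fun ⟨h1, h2⟩ => ⟨by omega, h2⟩
    have hskip : (σ.arr 7 m = 0 → σ.arr 2 m = 0 → σ'.arr 9 m ≠ 0 ∨ I.f ≤ σ'.arr 8 (I.col m)) →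
        ∀ v < m + 1, σ.arr 7 v = 0 → σ.arr 2 v = 0 →
          σ'.arr 9 v ≠ 0 ∨ I.f ≤ σ'.arr 8 (I.col v) := fun h v hv => by
      rcases Nat.lt_succ_iff_lt_or_eq.1 hv with hv | rfl
      exacts [hIf v hv, h]
    refine .ite (get_ok hB hm hr hN (by norm_num)) (fun he => ?_) fun he => ?_
    · simp only [AExp.eval, hr, ha 7 (by norm_num) (by norm_num)] at he
      exact .skip ⟨rfl, hIa', hIb, hI8, hIm, hskip fun h => absurd h he⟩
    simp only [AExp.eval, hr, ha 7 (by norm_num) (by norm_num)] at he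
    refine .ite (get_ok hB hm hr hN (by norm_num)) (fun he2 => ?_) fun he2 => ?_
    · simp only [AExp.eval, hr, ha 2 (by norm_num) (by norm_num)] at he2
      exact .skip ⟨rfl, hIa', hIb, hI8, hIm, hskip fun _ h => absurd h he2⟩
    simp only [AExp.eval, hr, ha 2 (by norm_num) (by norm_num)] at he2
    have hc : colExp.Ok I.N B σ' := by
      refine ⟨⟨?_, trivial, ?_⟩, ?_⟩
      · simp only [AExp.Ok]; omega
      · simp only [AExp.eval, hr]; omega
      · simp only [AExp.eval, hr]; omega
    have hc' : colExp.eval σ' = I.col m := by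
      simp only [colExp, AExp.eval, hr, hi, I.inp_col hm]
    refine .ite ⟨⟨hc, hN, by norm_num, by rw [hc']; omega⟩, trivial⟩ (fun he3 => ?_) fun he3 => ?_
    · have hlt : σ'.arr 8 (I.col m) < I.f := by
        by_contra hcon
        simp [AExp.eval, hc', h5, hcon] at he3
      -- Selected vertices are either initial ones, which the cover marks, or earlier in the scan;
      -- `m` is neither.
      have h9m : σ'.arr 9 m = 0 := by
        by_contra hcon
        rcases hIa m hm hcon with h | ⟨h, -⟩
        · exact h79 m hm h he
        · omega
      refine .seq (.set (get_ok hB hm hr hN (by norm_num)) (by simp only [AExp.Ok]; omega) ?_)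
      refine (runs_countColor hB hk hm (by simpa using hr) (by simpa using hN)
        (by simpa using hi) (by simp [hI8 _ hcol]; omega)).mono ?_
      rintro σ₂ t₂ hF₂ ⟨rfl, h8₂⟩
      have h9₂ : σ₂.arr 9 = Function.update (σ'.arr 9) m 1 := by
        rw [hF₂.2.1 9 (by simp [countColor, AProg.arrs])]; simp [AExp.eval, hr]
      have h8' : ∀ c, σ₂.arr 8 c = σ'.arr 8 c + if I.col m = c then 1 else 0 := by simp [h8₂]
      refine ⟨rfl, ?_⟩
      simp only [ASt.setReg_arr]
      refine ⟨fun v hv h => ?_, fun v hv h => ?_, fun c hc => ?_, fun c hc => ?_,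
        fun v hv h7 h2 => ?_⟩
      · by_cases hvm : v = m
        · subst hvm; exact .inr ⟨by omega, he, he2⟩
        · rw [h9₂, Function.update_of_ne hvm] at h
          exact hIa' v hv h
      · by_cases hvm : v = m
        · simp [h9₂, hvm]
        · rw [h9₂, Function.update_of_ne hvm]
          exact hIb v hv h
      · rw [h8', h9₂, numCol_update hm h9m, hI8 c hc]
      · rw [h8']
        split_ifs with h
        · subst h; exact le_max_of_le_left hlt
        · exact hIm c hc
      · by_cases hvm : v = m
        · exact .inl (by simp [h9₂, hvm])
        · rw [h9₂, Function.update_of_ne hvm, h8']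
          exact (hIf v (by omega) h7 h2).imp id fun h => h.trans (Nat.le_add_right _ _)
    · have hle : I.f ≤ σ'.arr 8 (I.col m) := by
        by_contra hcon
        simp [AExp.eval, hc', h5, not_le.1 hcon] at he3
      exact .skip ⟨rfl, hIa', hIb, hI8, hIm, hskip fun _ _ => .inr hle⟩
  · rintro σ' t - ⟨ht, hI1, hI⟩
    exact ⟨by omega, fun v hv h => (hI1 v hv h).imp id And.right, hI⟩

theorem runs_testColors (hB : I.Fits B) (hk : I.k ≤ I.n) {σ : ASt} (hR : I.Ready σ) :
    Runs I.N B testColors σ fun σ' t => t ≤ I.n ∧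
      (σ'.reg 10 ≠ 0 ↔ σ.reg 10 ≠ 0 ∨ ∃ c < I.k, σ.arr 8 c ≠ I.f) := by
  have hB' : 32 * (I.n + 2) + I.N + I.k + I.f ≤ B := hB
  refine (Runs.forUp (a := 0) (b := I.k) (fun m σ' =>
      (σ'.reg 10 ≠ 0 ↔ σ.reg 10 ≠ 0 ∨ ∃ c < m, σ.arr 8 c ≠ I.f))
    (by simp [AProg.regs]) (by simp [AProg.regs]) (by simp)
    (by simp only [AExp.Ok]; omega)
    (by simp [AExp.eval]) (by simpa using hR.reg4) (by omega) (by omega) (by simp) ?_).mono ?_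
  · intro m σ' _ hm hr hF hI
    have hN : σ'.reg 2 = I.N := by
      rw [hF.1 2 (by simp [forUp, AProg.regs])]; simpa using hR.reg2
    have h5 : σ'.reg 5 = I.f := by
      rw [hF.1 5 (by simp [forUp, AProg.regs])]; simpa using hR.reg5
    have ha : σ'.arr = σ.arr := funext fun j => hF.2.1 j (by simp [forUp, AProg.arrs])
    have hsplit : (∃ c < m + 1, σ.arr 8 c ≠ I.f) ↔
        (∃ c < m, σ.arr 8 c ≠ I.f) ∨ σ.arr 8 m ≠ I.f := by
      constructor
      · rintro ⟨v, hv, h⟩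
        rcases Nat.lt_succ_iff_lt_or_eq.1 hv with hv | rfl
        exacts [.inl ⟨v, hv, h⟩, .inr h]
      · rintro (⟨v, hv, h⟩ | h)
        exacts [⟨v, by omega, h⟩, ⟨m, by omega, h⟩]
    refine .ite ⟨get_ok hB (by omega) hr hN (by norm_num), trivial⟩ (fun he => ?_) fun he => ?_
    · have he' : σ.arr 8 m = I.f := by
        by_contra hc
        simp [AExp.eval, hr, ha, h5, hc] at he
      refine .skip ⟨rfl, ?_⟩
      rw [hsplit, ← or_assoc, ← hI]
      simp [he']
    · have he' : σ.arr 8 m ≠ I.f := fun hc => by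
        simp [AExp.eval, hr, ha, h5, hc] at he
      refine .assign (by simp only [AExp.Ok]; omega) ⟨rfl, ?_⟩
      rw [hsplit]
      simp [he', AExp.eval]
  · rintro σ' t - ⟨ht, hI⟩
    exact ⟨by omega, hI⟩

end

/-! ### Why the greedy completion decides whether a subset extends -/

section

variable {I : Inst} {B : ℕ}

/-- The vertex cover that has been found: array `6` lists its vertices, and array `7` marks them. -/
structure Inst.CoverAt (I : Inst) (b : ℕ) (σ : ASt) : Prop where
  reg6 : σ.reg 6 = b
  le : ∀ i < b, σ.arr 6 i ≤ I.n
  mark : ∀ v < I.n, σ.arr 7 v ≠ 0 ↔ ∃ i < b, σ.arr 6 i = v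
  covers : ∀ u v, v ∈ I.adj u → σ.arr 7 u ≠ 0 ∨ σ.arr 7 v ≠ 0

/-- The relation between the depth and the next pair in the search for a subset of the cover. -/
def Inst.SubsetPick (I : Inst) (X : ℕ → ℕ) (_ : ℕ → ℕ) (i u v : ℕ) : Prop := u = I.n ∧ v = X i

/-- The set of selected vertices. -/
def Inst.selected (I : Inst) (σ : ASt) : Finset ℕ :=
  (Finset.range I.n).filter fun v => σ.arr 9 v ≠ 0

/-- Two chosen vertices are nonadjacent by the test, a chosen and a free vertex because a free
vertex has no chosen neighbor, and two free vertices because every edge meets the cover. -/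
theorem balanced_selected {σ : ASt}
    (hS : ∀ u v, v ∈ I.adj u → σ.arr 1 v ≠ 0 → σ.arr 2 u ≠ 0)
    (hbad : ¬ ∃ v < I.n, σ.arr 1 v ≠ 0 ∧ σ.arr 2 v ≠ 0)
    (hcov : ∀ u v, v ∈ I.adj u → σ.arr 7 u ≠ 0 ∨ σ.arr 7 v ≠ 0) {σ' : ASt}
    (h9 : ∀ v < I.n, σ'.arr 9 v ≠ 0 → σ.arr 1 v ≠ 0 ∨ (σ.arr 7 v = 0 ∧ σ.arr 2 v = 0))
    (h8 : ∀ c < I.k, σ'.arr 8 c = I.numCol (σ'.arr 9) I.n c)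
    (hf : ∀ c < I.k, σ'.arr 8 c = I.f) : I.Balanced (I.selected σ') where
  lt v hv := by simpa using (Finset.mem_filter.1 hv).1
  indep u hu v hv huv := by
    simp only [Inst.selected, Finset.mem_filter, Finset.mem_range] at hu hv
    rcases h9 u hu.1 hu.2 with hu1 | ⟨hu7, hu2⟩
    · have := hS v u (I.adj_symm huv) hu1
      rcases h9 v hv.1 hv.2 with hv1 | ⟨hv7, hv2⟩
      · exact hbad ⟨v, hv.1, hv1, this⟩
      · exact this hv2
    · rcases h9 v hv.1 hv.2 with hv1 | ⟨hv7, hv2⟩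
      · exact hS u v huv hv1 hu2
      · exact (hcov u v huv).elim (fun h => h hu7) fun h => h hv7
  card c hc := by
    rw [← hf c hc, h8 c hc, Inst.selected, Finset.filter_filter]
    rfl

/-- No element of `L` has a chosen neighbor, so the elements of `L` outside the cover are all free.
The chosen vertices have at most `f` vertices of each color, and the greedy choice never exceeds `f`
after that. If it stopped below `f` in some color, all vertices of `L` of this color would be
selected, and these are already `f` many. -/
theorem not_wrong_of_balanced {σ : ASt} {L : Finset ℕ} (hL : I.Balanced L)
    (hS : ∀ v < I.n, σ.arr 1 v ≠ 0 ↔ v ∈ L ∧ σ.arr 7 v ≠ 0)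
    (hN : ∀ u < I.n, σ.arr 2 u ≠ 0 → ∃ v ∈ I.adj u, σ.arr 1 v ≠ 0) {σ' : ASt}
    (h9 : ∀ v < I.n, σ.arr 1 v ≠ 0 → σ'.arr 9 v ≠ 0)
    (h8 : ∀ c < I.k, σ'.arr 8 c = I.numCol (σ'.arr 9) I.n c)
    (hm : ∀ c < I.k, σ'.arr 8 c ≤ max I.f (I.numCol (σ.arr 1) I.n c))
    (hfree : ∀ v < I.n, σ.arr 7 v = 0 → σ.arr 2 v = 0 →
      σ'.arr 9 v ≠ 0 ∨ I.f ≤ σ'.arr 8 (I.col v)) :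
    (¬ ∃ v < I.n, σ.arr 1 v ≠ 0 ∧ σ.arr 2 v ≠ 0) ∧ ¬ ∃ c < I.k, σ'.arr 8 c ≠ I.f := by
  have hnbr : ∀ v ∈ L, σ.arr 2 v = 0 := fun v hv => by
    by_contra h
    obtain ⟨u, hu, hu1⟩ := hN v (hL.lt v hv) h
    exact hL.indep v hv u ((hS u (I.adj_lt hu)).1 hu1).1 hu
  refine ⟨fun ⟨v, hv, h1, h2⟩ => h2 (hnbr v ((hS v hv).1 h1).1), ?_⟩
  rintro ⟨c, hc, hne⟩
  have hle : σ'.arr 8 c ≤ I.f := by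
    have : I.numCol (σ.arr 1) I.n c ≤ I.f := by
      rw [← hL.card c hc]
      refine Finset.card_le_card fun v hv => ?_
      simp only [Finset.mem_filter, Finset.mem_range] at hv ⊢
      exact ⟨((hS v hv.1).1 hv.2.1).1, hv.2.2⟩
    simpa [this] using hm c hc
  refine hne (le_antisymm hle ?_)
  by_contra hlt
  refine hlt ?_
  conv_lhs => rw [← hL.card c hc]
  rw [h8 c hc]
  refine Finset.card_le_card fun v hv => ?_
  simp only [Finset.mem_filter, Finset.mem_range] at hv ⊢
  have hvn := hL.lt v hv.1
  refine ⟨hvn, ?_, hv.2⟩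
  by_cases h7 : σ.arr 7 v = 0
  · exact (hfree v hvn h7 (hnbr v hv.1)).resolve_right (by rw [hv.2]; exact hlt)
  · exact h9 v hvn ((hS v hvn).2 ⟨hv.1, h7⟩)

/-- Every pair on the stack consists of the dummy and a cover vertex, so bits that follow `L` choose
exactly the real cover vertices in `L`. -/
theorem chosen_iff {X : ℕ → ℕ} {b : ℕ} {σ : ASt}
    (h : Stack I (fun σ => I.CoverAt b σ ∧ σ.arr 6 = X) (I.SubsetPick X) b b σ) {L : Finset ℕ}
    (hA : Agree (fun _ v => v ∈ L) σ b) {v : ℕ} (hv : v < I.n) :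
    σ.arr 1 v ≠ 0 ↔ v ∈ L ∧ σ.arr 7 v ≠ 0 := by
  rw [Ne, chosen_eq_zero h hv.le, h.aux.1.mark v hv]
  push Not
  have hch : ∀ i < b, choice σ i = if X i ∈ L then X i else I.n := fun i hi => by
    obtain ⟨hu, hv⟩ := h.pk i hi
    have := hA i hi
    unfold choice
    rw [hv] at this
    by_cases hX : X i ∈ L
    · simp [this.2 hX, hX, hv]
    · have h0 : σ.arr 5 i = 0 := by
        by_contra hc
        exact hX (this.1 hc)
      simp [h0, hX, hu]
  constructor
  · rintro ⟨i, hi, hiv⟩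
    rw [hch i hi] at hiv
    split_ifs at hiv with hX
    · exact ⟨hiv ▸ hX, i, hi, by rw [h.aux.2, hiv]⟩
    · omega
  · rintro ⟨hvL, i, hi, hiv⟩
    rw [h.aux.2] at hiv
    exact ⟨i, hi, by rw [hch i hi, hiv, if_pos hvL]⟩

theorem chosen_mark {X : ℕ → ℕ} {b : ℕ} {σ : ASt}
    (h : Stack I (fun σ => I.CoverAt b σ ∧ σ.arr 6 = X) (I.SubsetPick X) b b σ) {v : ℕ}
    (hv : v < I.n) (h1 : σ.arr 1 v ≠ 0) : σ.arr 7 v ≠ 0 := by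
  rw [Ne, chosen_eq_zero h hv.le] at h1
  push Not at h1
  obtain ⟨i, hi, hiv⟩ := h1
  rw [h.aux.1.mark v hv]
  obtain ⟨hu, hv'⟩ := h.pk i hi
  unfold choice at hiv
  split_ifs at hiv
  · omega
  · exact ⟨i, hi, by rw [h.aux.2, ← hv', hiv]⟩

theorem nbrs_ne_zero {Aux : ASt → Prop} {PK : (ℕ → ℕ) → ℕ → ℕ → ℕ → Prop} {b d : ℕ} {σ : ASt}
    (h : Stack I Aux PK b d σ) {u : ℕ} (hu : u < I.n) :
    σ.arr 2 u ≠ 0 ↔ ∃ v ∈ I.adj u, σ.arr 1 v ≠ 0 := by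
  rw [nbrs_eq_sum h hu.le, Ne, Finset.sum_eq_zero_iff]
  simp

/-- Soundness needs no `L` at all; completeness concerns only those `L` that prescribe the current
bits, that is, whose intersection with the cover is the current subset. -/
theorem runs_complete (hB : I.Fits B) (hk : I.k ≤ I.n) {X : ℕ → ℕ} {b : ℕ} {σ : ASt}
    (h : Stack I (fun σ => I.CoverAt b σ ∧ σ.arr 6 = X) (I.SubsetPick X) b b σ) :
    Runs I.N B complete σ fun σ' t => t ≤ 4 * I.n ∧
      ((σ'.reg 9 = 1 ∧ I.Balanced (I.selected σ')) ∨
        (σ'.reg 9 = 0 ∧ ∀ L, I.Balanced L → ¬ Agree (fun _ v => v ∈ L) σ b)) := by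
  have hB' : 32 * (I.n + 2) + I.N + I.k + I.f ≤ B := hB
  have hS : ∀ u v, v ∈ I.adj u → σ.arr 1 v ≠ 0 → σ.arr 2 u ≠ 0 := fun u v hv h1 =>
    (nbrs_ne_zero h (I.adj_lt (I.adj_symm hv))).2 ⟨v, hv, h1⟩
  refine .seq ((runs_selectChosen hB hk h.ready).mono ?_)
  rintro σ₁ t₁ hF₁ ⟨ht₁, h9₁, h8₁, h10₁⟩
  have hR₁ : I.Ready σ₁ := h.ready.frame hF₁ (by simp [selectChosen, countColor, forUp, AProg.regs])
    (by simp [selectChosen, countColor, forUp, AProg.regs])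
    (by simp [selectChosen, countColor, forUp, AProg.regs])
    (by simp [selectChosen, countColor, forUp, AProg.regs])
    (by simp [selectChosen, countColor, forUp, AProg.arrs])
    (by simp [selectChosen, countColor, forUp, AProg.NoPut])
  have ha₁ : ∀ j < 8, σ₁.arr j = σ.arr j := fun j hj => by
    rw [hF₁.2.1 j (by simp [selectChosen, countColor, forUp, AProg.arrs]; omega)]
  have hnum : ∀ c, I.numCol (σ₁.arr 9) I.n c = I.numCol (σ.arr 1) I.n c := fun c => by
    unfold Inst.numCol
    congr 1
    refine Finset.filter_congr fun v hv => ?_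
    rw [h9₁ v (Finset.mem_range.1 hv)]
  refine .seq ((runs_selectFree hB hk hR₁ (fun v hv h9 => ?_) fun c hc => ?_).mono ?_)
  · rw [ha₁ 7 (by norm_num)]
    exact chosen_mark h hv ((h9₁ v hv).1 h9)
  · rw [hnum, h8₁ c hc]
  rintro σ₂ t₂ hF₂ ⟨ht₂, ha, hb, hc, hd, he⟩
  have hR₂ : I.Ready σ₂ := hR₁.frame hF₂ (by simp [selectFree, countColor, forUp, AProg.regs])
    (by simp [selectFree, countColor, forUp, AProg.regs])
    (by simp [selectFree, countColor, forUp, AProg.regs])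
    (by simp [selectFree, countColor, forUp, AProg.regs])
    (by simp [selectFree, countColor, forUp, AProg.arrs])
    (by simp [selectFree, countColor, forUp, AProg.NoPut])
  have h10₂ : σ₂.reg 10 = σ₁.reg 10 :=
    hF₂.1 10 (by simp [selectFree, countColor, forUp, AProg.regs])
  rw [ha₁ 7 (by norm_num), ha₁ 2 (by norm_num)] at ha he
  refine .seq ((runs_testColors hB hk hR₂).mono ?_)
  rintro σ₃ t₃ hF₃ ⟨ht₃, h10₃⟩
  have h9₃ : σ₃.arr 9 = σ₂.arr 9 := hF₃.2.1 9 (by simp [testColors, forUp, AProg.arrs])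
  rw [h10₂, h10₁] at h10₃
  refine .assign ⟨trivial, by simp only [AExp.Ok]; omega⟩ ⟨by omega, ?_⟩
  have hsel : ∀ x, I.selected (σ₃.setReg 9 x) = I.selected σ₂ := fun x => by
    simp [Inst.selected, h9₃]
  rw [hsel]
  by_cases h10 : σ₃.reg 10 = 0
  · refine .inl ⟨by simp [AExp.eval, h10], ?_⟩
    have hno := (not_congr h10₃).1 (not_not.2 h10)
    push Not at hno
    refine balanced_selected hS (fun ⟨v, hv, h1, h2⟩ => h2 (hno.1 v hv h1)) h.aux.1.covers
      (fun v hv h9 => (ha v hv h9).imp (h9₁ v hv).1 id) hc hno.2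
  · refine .inr ⟨by simp [AExp.eval, h10], fun L hL hA => ?_⟩
    obtain ⟨hn1, hn2⟩ := not_wrong_of_balanced (σ' := σ₂) hL (fun v hv => chosen_iff h hA hv)
      (fun u hu => (nbrs_ne_zero h hu).1) (fun v hv h1 => hb v hv ((h9₁ v hv).2 h1)) hc
      (fun c hc' => by rw [← h8₁ c hc']; exact hd c hc') he
    exact (h10₃.1 h10).elim hn1 hn2

variable (I)

/-- The search for the intersection of an `f`-balanced independent set with the vertex cover. -/
def subsetStrategy (hk : I.k ≤ I.n) (b : ℕ) (X : ℕ → ℕ) : Strategy I where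
  pick := .assign 10 (.var 3) ;; .assign 11 (.get 6 (.var 7))
  check := complete
  Aux := fun σ => I.CoverAt b σ ∧ σ.arr 6 = X
  PK := I.SubsetPick X
  Good := fun _ orc => ∃ L, I.Balanced L ∧ orc = fun _ v => v ∈ L
  Found := fun σ => I.Balanced (I.selected σ)
  aux_congr := fun ⟨h, hX⟩ h6 ha6 ha7 => ⟨⟨by rw [h6, h.reg6], by rw [ha6]; exact h.le,
    by rw [ha6, ha7]; exact h.mark, by rw [ha7]; exact h.covers⟩, by rw [ha6, hX]⟩
  pk_congr := fun _ h => h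
  found_congr := fun h ha => by simpa only [Inst.selected, ha] using h
  pick_regs := by simp [AProg.regs]
  pick_arrs := by simp [AProg.arrs]
  pick_noPut := by simp [AProg.NoPut]
  check_regs := by
    simp [complete, selectChosen, selectFree, testColors, countColor, forUp, AProg.regs]
  check_arrs := by
    simp [complete, selectChosen, selectFree, testColors, countColor, forUp, AProg.arrs]
  check_noPut := by
    simp [complete, selectChosen, selectFree, testColors, countColor, forUp, AProg.NoPut]
  runs_pick := fun {B} hB {b' d σ} hb h7 hd h => by
    have hB' : 32 * (I.n + 2) + I.N + I.k + I.f ≤ B := hB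
    -- The depth bound in register `6` is also the length of the stored cover.
    obtain rfl : b' = b := h.reg6.symm.trans h.aux.1.reg6
    have hX := h.aux.1.le d hd
    rw [h.aux.2] at hX
    refine .seq (.assign trivial (.assign ⟨trivial, ?_, by norm_num, ?_⟩ ?_))
    · simpa using h.ready.reg2
    · simp [AExp.eval, h7]; omega
    · simp [AExp.eval, h7, h.ready.reg3, hX, Inst.SubsetPick, h.aux.2]
  runs_check := fun {B} hB {b' σ} _ h => by
    obtain rfl : b' = b := h.reg6.symm.trans h.aux.1.reg6
    refine (runs_complete hB hk h).mono ?_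
    rintro σ' t - ⟨ht, hQ⟩
    refine ⟨ht, hQ.imp id fun ⟨h9, hL⟩ => ⟨h9, ?_⟩⟩
    rintro orc ⟨L, hb, rfl⟩
    exact hL L hb

end

/-! ### The whole program -/

/-- The expression for the degree of the vertex in register `12`. -/
def degExp : AExp := .inp (.add (.add (.const 3) (.var 3)) (.var 12))

/-- Read the parameters and compute where the adjacency lists start. -/
def prologue : AProg :=
  .assign 3 (.inp (.const 0)) ;; .assign 4 (.inp (.const 1)) ;; .assign 5 (.inp (.const 2)) ;;
    .assign 2 (.add (.const 3) (.add (.var 3) (.var 3))) ;;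
    forUp 12 (.const 0) 3 (.assign 2 (.add (.var 2) degExp)) ;;
    .assign 15 (.add (.const 3) (.add (.var 3) (.var 3))) ;;
    forUp 12 (.const 0) 3 (.set 0 (.var 12) (.var 15) ;; .assign 15 (.add (.var 15) degExp)) ;;
    .set 0 (.var 3) (.var 15) ;; .set 0 (.add (.var 3) (.const 1)) (.var 15)

/-- The search for a vertex cover whose size is in register `6`. -/
def coverSearch : AProg :=
  Strategy.search findEdge (findVertex ;; .assign 9 (.eq (.var 10) (.var 3)))

/-- The search for an `f`-balanced independent set by means of a vertex cover. -/
def subsetSearch : AProg :=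
  Strategy.search (.assign 10 (.var 3) ;; .assign 11 (.get 6 (.var 7))) complete

/-- Find a vertex cover of minimum size. -/
def minCover : AProg :=
  .assign 6 (.const 0) ;; .assign 9 (.const 0) ;;
    .loop (.eq (.var 9) (.const 0))
      (coverSearch ;; .ite (.var 9) .skip (.assign 6 (.add (.var 6) (.const 1))))

/-- Copy the vertex cover from the stack. -/
def copyCover : AProg :=
  forUp 12 (.const 0) 6 (.ite (.get 5 (.var 12)) (.set 6 (.var 12) (.get 4 (.var 12)))
      (.set 6 (.var 12) (.get 3 (.var 12)))) ;;
    forUp 12 (.const 0) 3 (.set 7 (.var 12) (.get 1 (.var 12)))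

/-- Write the selected vertices to the input region. -/
def epilogue : AProg :=
  forUp 12 (.const 0) 3 (.put (.add (.const 3) (.var 12)) (.get 9 (.var 12))) ;; .assign 1 (.const 3)

/-- Compute an `f`-balanced independent set. -/
def solve : AProg :=
  prologue ;;
    .ite (.lt (.var 3) (.var 4)) (.assign 0 (.eq (.var 5) (.const 0)))
      (minCover ;; copyCover ;; subsetSearch ;; .assign 0 (.var 9)) ;;
    epilogue

/-! ### Correctness and running time of the phases -/

section

variable {I : Inst} {B : ℕ}

/-- Only the degrees are read, never the adjacency lists, so the time is linear in `n`. Two passes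
are needed because the arrays can be addressed only once register `2` holds the end of the input.
The two final writes give the dummy `n` an empty list. -/
theorem runs_prologue (hB : I.Fits B) {σ : ASt} (hi : σ.inp = I.inp) :
    Runs I.N B prologue σ fun σ' t => t ≤ 2 * I.n ∧ I.Ready σ' := by
  have hB' : 32 * (I.n + 2) + I.N + I.k + I.f ≤ B := hB
  have hNle := I.le_N
  have hinp : ∀ c < 3, ∀ σ : ASt, (AExp.inp (.const c)).Ok I.N B σ := fun c hc σ =>
    ⟨by simp only [AExp.Ok]; omega, by simp only [AExp.eval]; omega⟩
  have hdeg : ∀ v < I.n, ∀ σ' : ASt, σ'.reg 3 = I.n → σ'.reg 12 = v → σ'.inp = I.inp →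
      degExp.Ok I.N B σ' ∧ degExp.eval σ' = (I.adj v).length := fun v hv σ' h3 h12 hi => by
    refine ⟨⟨⟨⟨by simp only [AExp.Ok]; omega, trivial, ?_⟩, trivial, ?_⟩, ?_⟩, ?_⟩
    · simp only [AExp.eval, h3]; omega
    · simp only [AExp.eval, h3, h12]; omega
    · simp only [AExp.eval, h3, h12]; omega
    · simp only [degExp, AExp.eval, h3, h12, hi, I.inp_deg hv]
  have hoff : ∀ v < I.n, I.off v + (I.adj v).length < B := fun v hv => by
    rw [← I.off_succ]
    have := I.off_le (v := v + 1) (by omega)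
    omega
  refine .seq (.assign (hinp 0 (by norm_num) _) ?_)
  refine .seq (.assign (hinp 1 (by norm_num) _) ?_)
  refine .seq (.assign (hinp 2 (by norm_num) _) ?_)
  simp only [AExp.eval, ASt.setReg_inp, hi, I.inp_zero, I.inp_one, I.inp_two]
  refine .seq (.assign ⟨by simp only [AExp.Ok]; omega, ⟨trivial, trivial, ?_⟩, ?_⟩ ?_)
  · simp [AExp.eval]; omega
  · simp [AExp.eval]; omega
  have h3 : ((((σ.setReg 3 I.n).setReg 4 I.k).setReg 5 I.f).reg 3) = I.n := by simp
  simp only [AExp.eval, h3]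
  refine .seq ((Runs.forUp (a := 0) (b := I.n) (fun m σ' => σ'.reg 2 = I.off m)
    (by simp [AProg.regs]) (by simp [AProg.regs]) (by simp)
    (by simp only [AExp.Ok]; omega) (by simp [AExp.eval]) (by simp) (by omega) (by omega)
    ?_ ?_).mono ?_)
  · simp [I.off_zero]; omega
  · intro m σ' _ hm hr hF hI
    have h3 : σ'.reg 3 = I.n := by
      rw [hF.1 3 (by simp [forUp, AProg.regs])]; simp
    have hi' : σ'.inp = I.inp := by
      rw [hF.2.2 (by simp [forUp, AProg.NoPut])]; exact hi
    obtain ⟨h1, h2⟩ := hdeg m hm σ' h3 hr hi'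
    refine .assign ⟨trivial, h1, ?_⟩ ⟨rfl, ?_⟩
    · rw [h2]
      simp only [AExp.eval, hI]
      exact hoff m hm
    · simp [AExp.eval, h2, hI, I.off_succ]
  rintro σ₁ t₁ hF₁ ⟨ht₁, h2₁⟩
  rw [I.off_n] at h2₁
  have h3₁ : σ₁.reg 3 = I.n := by rw [hF₁.1 3 (by simp [forUp, AProg.regs])]; simp
  have h4₁ : σ₁.reg 4 = I.k := by rw [hF₁.1 4 (by simp [forUp, AProg.regs])]; simp
  have h5₁ : σ₁.reg 5 = I.f := by rw [hF₁.1 5 (by simp [forUp, AProg.regs])]; simp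
  have hi₁ : σ₁.inp = I.inp := by rw [hF₁.2.2 (by simp [forUp, AProg.NoPut])]; exact hi
  refine .seq (.assign ⟨by simp only [AExp.Ok]; omega, ⟨trivial, trivial, ?_⟩, ?_⟩ ?_)
  · simp only [AExp.eval, h3₁]; omega
  · simp only [AExp.eval, h3₁]; omega
  simp only [AExp.eval, h3₁]
  refine .seq ((Runs.forUp (a := 0) (b := I.n) (fun m σ' => σ'.reg 15 = I.off m ∧
      ∀ v < m, σ'.arr 0 v = I.off v)
    (by simp [AProg.regs]) (by simp [AProg.regs]) (by simp)
    (by simp only [AExp.Ok]; omega) (by simp [AExp.eval]) (by simpa using h3₁) (by omega) (by omega)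
    ?_ ?_).mono ?_)
  · simp [I.off_zero]; omega
  · rintro m σ' _ hm hr hF ⟨hI, hI0⟩
    have hN : σ'.reg 2 = I.N := by
      rw [hF.1 2 (by simp [forUp, AProg.regs])]; simpa using h2₁
    have h3 : σ'.reg 3 = I.n := by
      rw [hF.1 3 (by simp [forUp, AProg.regs])]; simpa using h3₁
    have hi' : σ'.inp = I.inp := by
      rw [hF.2.2 (by simp [forUp, AProg.NoPut])]; exact hi₁
    refine .seq (.set (get_ok hB hm hr hN (by norm_num)) trivial ?_)
    obtain ⟨h1, h2⟩ := hdeg m hm (σ'.setArr 0 (AExp.eval σ' (.var 12)) (AExp.eval σ' (.var 15)))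
      h3 hr hi'
    refine .assign ⟨trivial, h1, ?_⟩ ⟨rfl, ?_, fun v hv => ?_⟩
    · rw [h2]
      simp only [AExp.eval, ASt.setArr_reg, hI]
      exact hoff m hm
    · simp only [AExp.eval, ASt.setReg_reg, ASt.setArr_reg, hI, I.off_succ] at h2 ⊢
      simp [h2]
    · simp only [AExp.eval, hr, hI, ASt.setReg_arr, ASt.setArr_arr, if_true]
      by_cases hvm : v = m
      · simp [hvm]
      · rw [Function.update_of_ne hvm]
        exact hI0 v (by omega)
  rintro σ₂ t₂ hF₂ ⟨ht₂, h15, h0⟩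
  have hr₂ : ∀ r, r ≠ 12 → r ≠ 15 → σ₂.reg r = σ₁.reg r := fun r h12 h15 => by
    rw [hF₂.1 r (by simp [forUp, AProg.regs, h12, h15])]; simp [h15]
  have hi₂ : σ₂.inp = I.inp := by rw [hF₂.2.2 (by simp [forUp, AProg.NoPut])]; exact hi₁
  have h2₂ : σ₂.reg 2 = I.N := by rw [hr₂ 2 (by omega) (by omega), h2₁]
  have h3₂ : σ₂.reg 3 = I.n := by rw [hr₂ 3 (by omega) (by omega), h3₁]
  refine .seq (.set ⟨trivial, h2₂, by norm_num, ?_⟩ trivial ?_)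
  · simp only [AExp.eval, h3₂]; omega
  refine .set ⟨⟨trivial, by simp only [AExp.Ok]; omega, ?_⟩, h2₂, by norm_num, ?_⟩ trivial ?_
  · simp only [AExp.eval, ASt.setArr_reg, h3₂]; omega
  · simp only [AExp.eval, ASt.setArr_reg, h3₂]; omega
  refine ⟨by omega, h2₂, h3₂, by simp [hr₂, h4₁], by simp [hr₂, h5₁], hi₂, fun v hv => ?_⟩
  simp only [AExp.eval, ASt.setArr_arr, ASt.setArr_reg, h3₂, h15, if_true]
  rcases Nat.lt_succ_iff_lt_or_eq.1 (Nat.lt_succ_of_le hv) with hv | rfl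
  · rw [Function.update_of_ne hv.ne]
    rcases Nat.lt_succ_iff_lt_or_eq.1 hv with hv | rfl
    · rw [Function.update_of_ne hv.ne, h0 v hv]
    · rw [Function.update_self]
  · rw [Function.update_self, I.off_n_succ, I.off_n]

/-- A search of depth `b` costs at most `23 * n * 2 ^ b`, and the depths sum geometrically. Since
`T` is an arbitrary cover of at most `n` vertices, the bound applies to a minimum one, without
proving that the cover found is minimum. -/
theorem runs_minCover (hB : I.Fits B) {σ : ASt} (hR : I.Ready σ) {T : Finset ℕ} (hT : I.IsCover T)
    (hTn : T.card ≤ I.n) :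
    Runs I.N B minCover σ fun σ' t => t ≤ 46 * (I.n * 2 ^ T.card) ∧ ∃ b ≤ T.card,
      Stack I (coverStrategy I).Aux I.CoverPick b b σ' ∧ (coverStrategy I).Found σ' := by
  have hB' : 32 * (I.n + 2) + I.N + I.k + I.f ≤ B := hB
  refine .seq (.assign (by simp only [AExp.Ok]; omega) ?_)
  refine .seq (.assign (by simp only [AExp.Ok]; omega) ?_)
  simp only [AExp.eval]
  refine (Runs.loop (fun σ' => I.Ready σ' ∧ σ'.reg 6 ≤ T.card ∧ (σ'.reg 9 ≠ 0 →
      Stack I (coverStrategy I).Aux I.CoverPick (σ'.reg 6) (σ'.reg 6) σ' ∧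
        (coverStrategy I).Found σ'))
    -- The difference of powers is the sum of `2 ^ i` over the depths still possible, from the
    -- current one up to `T.card`.
    (fun σ' => if σ'.reg 9 = 0 then 23 * I.n * (2 ^ (T.card + 1) - 2 ^ σ'.reg 6) else 0)
    ⟨?_, ?_, ?_⟩ ?_).mono ?_
  · exact hR.congr (by simp) (by simp) (by simp) (by simp) (by simp) (by simp)
  · simp
  · simp
  · rintro σ' - ⟨hR', hb, -⟩
    refine ⟨⟨trivial, by simp only [AExp.Ok]; omega⟩, fun he => ?_⟩
    have h9 : σ'.reg 9 = 0 := by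
      by_contra hc
      simp [AExp.eval, hc] at he
    obtain ⟨b, hb6⟩ : ∃ b, σ'.reg 6 = b := ⟨_, rfl⟩
    rw [hb6] at hb
    have hpow : 2 ^ (b + 1) ≤ 2 ^ (T.card + 1) := Nat.pow_le_pow_right (by norm_num) (by omega)
    rw [pow_succ] at hpow
    refine .seq ((Strategy.runs_search (T := coverStrategy I) hB (hb.trans hTn) hR' trivial
      hb6).mono ?_)
    rintro σ₁ t₁ hF₁ ⟨ht₁, hQ⟩
    -- Unfolding the strategy yields a concrete program, for which register membership is decidable
    -- by evaluation.
    replace hF₁ : Frame coverSearch σ' σ₁ := hF₁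
    have hR₁ : I.Ready σ₁ := hR'.frame hF₁ (by decide) (by decide) (by decide) (by decide)
      (by decide) (by simp [coverSearch, Strategy.search, Strategy.step, Strategy.push,
        Strategy.leaf, Strategy.back, findEdge, findVertex, choose, unchoose, overNeighbors, forUp,
        AProg.NoPut])
    have h6₁ : σ₁.reg 6 = b := by rw [hF₁.1 6 (by decide), hb6]
    refine .ite trivial (fun he => ?_) fun he => ?_
    · rcases hQ with ⟨h9, hQ⟩ | ⟨h9, -⟩
      · refine .skip ⟨⟨hR₁, by omega, fun _ => by rw [h6₁]; exact hQ⟩, ?_⟩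
        have : 23 * I.n * 2 ^ b ≤ 23 * I.n * (2 ^ (T.card + 1) - 2 ^ b) :=
          Nat.mul_le_mul_left _ (by omega)
        simp only [h9, ‹σ'.reg 9 = 0›, hb6, if_true]
        simp
        omega
      · exact absurd h9 he
    · rcases hQ with ⟨h9, hQ⟩ | ⟨h9₁, hQ⟩
      · simp [AExp.eval, h9] at he
      -- At depth at least `T.card` the set `T` itself would be a target, contradicting the failure
      -- of the search.
      · have hlt : b < T.card := by
          by_contra hc
          exact hQ _ ⟨T, by omega, hT, rfl⟩
        refine .assign ⟨trivial, by simp only [AExp.Ok]; omega, ?_⟩ ⟨⟨?_, ?_, ?_⟩, ?_⟩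
        · simp only [AExp.eval, h6₁]; omega
        · exact hR₁.congr (by simp) (by simp) (by simp) (by simp) (by simp) (by simp)
        · simp [AExp.eval, h6₁]; omega
        · simp [h9₁]
        · have h1 : 2 ^ (T.card + 1) - 2 ^ b = (2 ^ (T.card + 1) - 2 ^ (b + 1)) + 2 ^ b := by
            rw [pow_succ 2 b]; omega
          simp only [AExp.eval, ASt.setReg_reg, h6₁, h9₁, h9, hb6, if_true, if_false,
            show ¬ (9 = 6) by norm_num, h1, mul_add]
          omega
  · rintro σ' t - ⟨⟨hR', hb, hQ⟩, he, hle⟩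
    have h9 : σ'.reg 9 ≠ 0 := fun hc => by simp [AExp.eval, hc] at he
    refine ⟨?_, _, hb, hQ h9⟩
    have h1 : 23 * I.n * (2 ^ (T.card + 1) - 1) ≤ 23 * I.n * 2 ^ (T.card + 1) :=
      Nat.mul_le_mul_left _ (Nat.sub_le _ _)
    have h2 : 23 * I.n * 2 ^ (T.card + 1) = 46 * (I.n * 2 ^ T.card) := by ring
    simp at hle
    omega

/-- The multiplicities in array `1` serve as marks. The copied list may still contain the dummy `n`,
which costs a level of the second search but does no harm. -/
theorem runs_copyCover (hB : I.Fits B) {b : ℕ} {σ : ASt} (hb : b ≤ I.n)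
    (hst : Stack I (coverStrategy I).Aux I.CoverPick b b σ) (hf : (coverStrategy I).Found σ) :
    Runs I.N B copyCover σ fun σ' t => t ≤ 2 * I.n ∧ I.CoverAt b σ' := by
  have hB' : 32 * (I.n + 2) + I.N + I.k + I.f ≤ B := hB
  have hR := hst.ready
  refine .seq ((Runs.forUp (a := 0) (b := b) (fun m σ' => ∀ i < m, σ'.arr 6 i = choice σ i)
    (by simp [AProg.regs]) (by simp [AProg.regs]) (by simp)
    (by simp only [AExp.Ok]; omega) (by simp [AExp.eval]) hst.reg6 (by omega) (by omega)
    (by simp) ?_).mono ?_)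
  · intro m σ' _ hm hr hF hI
    have hN : σ'.reg 2 = I.N := by
      rw [hF.1 2 (by simp [forUp, AProg.regs])]; exact hR.reg2
    have ha : ∀ j, j ≠ 6 → σ'.arr j = σ.arr j := fun j hj =>
      hF.2.1 j (by simp [forUp, AProg.arrs, hj])
    have hok : ∀ j < 16, (AExp.get j (.var 12)).Ok I.N B σ' := fun j hj =>
      get_ok hB (by omega) hr hN hj
    have key : ∀ x, x = choice σ m → ∀ i < m + 1,
        Function.update (σ'.arr 6) m x i = choice σ i := fun x hx i hi => by
      by_cases him : i = m
      · simp [him, hx]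
      · rw [Function.update_of_ne him]
        exact hI i (by omega)
    refine .ite (hok 5 (by norm_num)) (fun he => ?_) fun he => ?_
    · simp only [AExp.eval, hr, ha 5 (by norm_num)] at he
      refine .set (hok 6 (by norm_num)) (hok 4 (by norm_num)) ⟨rfl, ?_⟩
      simp only [ASt.setReg_arr, ASt.setArr_arr, AExp.eval, hr, if_true, ha 4 (by norm_num)]
      exact key _ (by simp [choice, he])
    · simp only [AExp.eval, hr, ha 5 (by norm_num)] at he
      refine .set (hok 6 (by norm_num)) (hok 3 (by norm_num)) ⟨rfl, ?_⟩
      simp only [ASt.setReg_arr, ASt.setArr_arr, AExp.eval, hr, if_true, ha 3 (by norm_num)]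
      exact key _ (by simp [choice, he])
  rintro σ₁ t₁ hF₁ ⟨ht₁, h6₁⟩
  have hr₁ : ∀ r, r ≠ 12 → σ₁.reg r = σ.reg r := fun r h12 =>
    hF₁.1 r (by simp [forUp, AProg.regs, h12])
  have ha₁ : σ₁.arr 1 = σ.arr 1 := hF₁.2.1 1 (by simp [forUp, AProg.arrs])
  refine (Runs.forUp (a := 0) (b := I.n) (fun m σ' => ∀ v < m, σ'.arr 7 v = σ.arr 1 v)
    (by simp [AProg.regs]) (by simp [AProg.regs]) (by simp)
    (by simp only [AExp.Ok]; omega) (by simp [AExp.eval])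
    (by rw [hr₁ 3 (by norm_num), hR.reg3]) (by omega) (by omega) (by simp) ?_).mono ?_
  · intro m σ' _ hm hr hF hI
    have hN : σ'.reg 2 = I.N := by
      rw [hF.1 2 (by simp [forUp, AProg.regs]), hr₁ 2 (by norm_num), hR.reg2]
    have ha : σ'.arr 1 = σ.arr 1 := by rw [hF.2.1 1 (by simp [forUp, AProg.arrs]), ha₁]
    refine .set (get_ok hB hm hr hN (by norm_num)) (get_ok hB hm hr hN (by norm_num))
      ⟨rfl, fun v hv => ?_⟩
    simp only [ASt.setReg_arr, ASt.setArr_arr, AExp.eval, hr, if_true, ha]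
    by_cases hvm : v = m
    · simp [hvm]
    · rw [Function.update_of_ne hvm]
      exact hI v (by omega)
  · rintro σ₂ t₂ hF₂ ⟨ht₂, h7₂⟩
    have h6₂ : σ₂.arr 6 = σ₁.arr 6 := hF₂.2.1 6 (by simp [forUp, AProg.arrs])
    refine ⟨by omega, ?_, fun i hi => ?_, fun v hv => ?_, fun u v hv => ?_⟩
    · rw [hF₂.1 6 (by simp [forUp, AProg.regs]), hr₁ 6 (by norm_num), hst.reg6]
    · rw [h6₂, h6₁ i hi]
      exact Strategy.choice_le (T := coverStrategy I) hst hi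
    · rw [h7₂ v hv, Ne, chosen_eq_zero hst hv.le, h6₂]
      push Not
      exact exists_congr fun i => and_congr_right fun hi => by rw [h6₁ i hi]
    · rw [h7₂ u (I.adj_lt (I.adj_symm hv)), h7₂ v (I.adj_lt hv)]
      exact hf u v hv

/-- Summing over the color classes, a balanced set would have `k * f ≥ k > n` elements. -/
theorem not_balanced (hk : I.n < I.k) (hf : I.f ≠ 0) (L : Finset ℕ) : ¬ I.Balanced L := fun h => by
  have h1 : L.card ≤ I.n := by
    simpa using Finset.card_le_card (fun v hv => Finset.mem_range.2 (h.lt v hv) :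
      L ⊆ Finset.range I.n)
  rw [Finset.card_eq_sum_card_fiberwise (f := I.col) (t := Finset.range I.k)
    (fun v hv => by simpa using I.col_lt (h.lt v hv)),
    Finset.sum_congr rfl fun c hc => h.card c (Finset.mem_range.1 hc)] at h1
  simp only [Finset.sum_const, Finset.card_range, smul_eq_mul] at h1
  have := Nat.le_mul_of_pos_right I.k (Nat.pos_of_ne_zero hf)
  omega

/-- In units of `n * 2 ^ T.card`, the two searches take at most 46 and 23, and prologue, copying and
epilogue at most 2, 2 and 1; all in all at most 75. -/
theorem runs_solve (hB : I.Fits B) {σ : ASt} (hi : σ.inp = I.inp) (h9 : σ.arr 9 = fun _ => 0)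
    {T : Finset ℕ} (hT : I.IsCover T) (hTn : T.card ≤ I.n) :
    Runs I.N B solve σ fun σ' t => t ≤ 75 * (2 ^ T.card * I.n) ∧ σ'.reg 1 = 3 ∧
      (∀ v < I.n, σ'.inp (3 + v) = σ'.arr 9 v) ∧
      ((σ'.reg 0 = 1 ∧ I.Balanced (I.selected σ')) ∨ (σ'.reg 0 = 0 ∧ ∀ L, ¬ I.Balanced L)) := by
  have hB' : 32 * (I.n + 2) + I.N + I.k + I.f ≤ B := hB
  have hNle := I.le_N
  have hn : I.n * 1 ≤ I.n * 2 ^ T.card := Nat.mul_le_mul_left _ Nat.one_le_two_pow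
  refine .seq ((runs_prologue hB hi).mono ?_)
  rintro σ₁ t₁ hF₁ ⟨ht₁, hR₁⟩
  have h9₁ : σ₁.arr 9 = fun _ => 0 := by rw [hF₁.2.1 9 (by decide), h9]
  suffices H : Runs I.N B (.ite (.lt (.var 3) (.var 4)) (.assign 0 (.eq (.var 5) (.const 0)))
      (minCover ;; copyCover ;; subsetSearch ;; .assign 0 (.var 9))) σ₁ fun σ' t =>
        t ≤ 72 * (I.n * 2 ^ T.card) ∧ ((σ'.reg 0 = 1 ∧ I.Balanced (I.selected σ')) ∨
          (σ'.reg 0 = 0 ∧ ∀ L, ¬ I.Balanced L)) by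
    refine .seq (H.mono ?_)
    rintro σ₂ t₂ hF₂ ⟨ht₂, hQ⟩
    have hR₂ : I.Ready σ₂ := hR₁.frame hF₂ (by decide) (by decide) (by decide) (by decide)
      (by decide) (by simp [minCover, coverSearch, copyCover, subsetSearch, complete, selectChosen,
        selectFree, testColors, countColor, Strategy.search, Strategy.step, Strategy.push,
        Strategy.leaf, Strategy.back, findEdge, findVertex, choose, unchoose, overNeighbors, forUp,
        AProg.NoPut])
    refine .seq ((Runs.forUp (a := 0) (b := I.n) (fun m σ' => ∀ v < m, σ'.inp (3 + v) = σ₂.arr 9 v)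
      (by simp [AProg.regs]) (by simp [AProg.regs]) (by simp)
      (by simp only [AExp.Ok]; omega) (by simp [AExp.eval]) hR₂.reg3 (by omega) (by omega)
      (by simp) ?_).mono ?_)
    · intro m σ' _ hm hr hF hI
      have hN : σ'.reg 2 = I.N := by
        rw [hF.1 2 (by simp [forUp, AProg.regs]), hR₂.reg2]
      have ha : σ'.arr 9 = σ₂.arr 9 := hF.2.1 9 (by simp [forUp, AProg.arrs])
      refine .put ⟨⟨by simp only [AExp.Ok]; omega, trivial, ?_⟩, ?_⟩
        (get_ok hB hm hr hN (by norm_num)) ⟨rfl, fun v hv => ?_⟩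
      · simp only [AExp.eval, hr]; omega
      · simp only [AExp.eval, hr]; omega
      simp only [AExp.eval, hr, ASt.setReg_inp, ASt.setInp_inp, ha]
      by_cases hvm : v = m
      · simp [hvm]
      · rw [Function.update_of_ne (by omega)]
        exact hI v (by omega)
    · rintro σ₃ t₃ hF₃ ⟨ht₃, hI⟩
      have ha : σ₃.arr 9 = σ₂.arr 9 := hF₃.2.1 9 (by simp [forUp, AProg.arrs])
      have hr : σ₃.reg 0 = σ₂.reg 0 := hF₃.1 0 (by simp [forUp, AProg.regs])
      refine .assign (by simp only [AExp.Ok]; omega) ⟨?_, by simp [AExp.eval], fun v hv => ?_, ?_⟩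
      · rw [mul_comm (2 ^ T.card)]; omega
      · simpa [ha] using hI v hv
      · simpa [Inst.selected, ha, hr] using hQ
  refine .ite ⟨trivial, trivial⟩ (fun he => ?_) fun he => ?_
  · have hk : I.n < I.k := by
      by_contra hc
      simp [AExp.eval, hR₁.reg3, hR₁.reg4, hc] at he
    refine .assign ⟨trivial, by simp only [AExp.Ok]; omega⟩ ⟨by omega, ?_⟩
    by_cases hf : I.f = 0
    · refine .inl ⟨by simp [AExp.eval, hR₁.reg5, hf], ?_⟩
      -- For `f = 0` and more colors than vertices the empty set is the answer: array `9` is still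
      -- zero here.
      simp only [Inst.selected, ASt.setReg_arr, h9₁, ne_eq, not_true_eq_false, Finset.filter_false]
      exact ⟨by simp, by simp, by simp [hf]⟩
    · exact .inr ⟨by simp [AExp.eval, hR₁.reg5, hf], not_balanced hk hf⟩
  · have hk : I.k ≤ I.n := by
      by_contra hc
      simp [AExp.eval, hR₁.reg3, hR₁.reg4, not_le.1 hc] at he
    refine .seq ((runs_minCover hB hR₁ hT hTn).mono ?_)
    rintro σ₂ t₂ - ⟨ht₂, b, hb, hst, hf⟩
    refine .seq ((runs_copyCover hB (hb.trans hTn) hst hf).mono ?_)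
    rintro σ₃ t₃ hF₃ ⟨ht₃, hcov⟩
    have hR₃ : I.Ready σ₃ := hst.ready.frame hF₃ (by decide) (by decide) (by decide) (by decide)
      (by decide) (by simp [copyCover, forUp, AProg.NoPut])
    refine .seq ((Strategy.runs_search (T := subsetStrategy I hk b (σ₃.arr 6)) hB (hb.trans hTn)
      hR₃ ⟨hcov, rfl⟩ hcov.reg6).mono ?_)
    rintro σ₄ t₄ - ⟨ht₄, hQ⟩
    refine .assign trivial ⟨?_, ?_⟩
    · have h1 : 23 * I.n * 2 ^ b ≤ 23 * I.n * 2 ^ T.card :=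
        Nat.mul_le_mul_left _ (Nat.pow_le_pow_right (by norm_num) hb)
      rw [mul_assoc, mul_assoc] at h1
      rw [mul_assoc] at ht₄
      omega
    · rcases hQ with ⟨h9, -, hf⟩ | ⟨h9, hQ⟩
      · exact .inl ⟨by simp [AExp.eval, h9], hf⟩
      · exact .inr ⟨by simp [AExp.eval, h9], fun L hL => hQ _ ⟨L, hL, rfl⟩⟩

end

/-! ### The input -/

theorem length_flatten_map_range (h : ℕ → List ℕ) (n : ℕ) :
    ((List.range n).map h).flatten.length = ∑ i ∈ Finset.range n, (h i).length := by
  induction n with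
  | zero => simp
  | succ n ih =>
    rw [List.range_succ, List.map_append, List.flatten_append, List.length_append, ih,
      Finset.sum_range_succ]
    simp

theorem getD_flatten_map_range (h : ℕ → List ℕ) {n v j : ℕ} (hv : v < n) (hj : j < (h v).length) :
    ((List.range n).map h).flatten.getD (∑ i ∈ Finset.range v, (h i).length + j) 0 = (h v)[j] := by
  induction n with
  | zero => omega
  | succ n ih =>
    rw [List.range_succ, List.map_append, List.flatten_append]
    rcases Nat.lt_succ_iff_lt_or_eq.1 hv with hv | rfl
    · rw [List.getD_append _ _ _ _ ?_, ih hv]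
      rw [length_flatten_map_range]
      have h1 := Finset.sum_range_succ (fun i => (h i).length) v
      have h2 : ∑ i ∈ Finset.range (v + 1), (h i).length ≤ ∑ i ∈ Finset.range n, (h i).length :=
        Finset.sum_le_sum_of_subset (by simpa using hv)
      omega
    · rw [List.getD_append_right _ _ _ _ (by rw [length_flatten_map_range]; omega),
        length_flatten_map_range, Nat.add_sub_cancel_left]
      simp [hj]

/-! ### From the encoded input to an instance -/

section

variable {n k : ℕ} (f : ℕ) (γ : Fin n → Fin k) (adj : Fin n → List (Fin n))

/-- The color of a vertex. -/
def colOf (v : ℕ) : ℕ := if h : v < n then γ ⟨v, h⟩ else 0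

/-- The adjacency list of a vertex. -/
def adjOf (v : ℕ) : List ℕ := if h : v < n then (adj ⟨v, h⟩).map fun u : Fin n => (u : ℕ) else []

theorem ofFn_eq_map_range {α : Type*} (g : Fin n → α) (h : ℕ → α) (hgh : ∀ v : Fin n, h v = g v) :
    List.ofFn g = (List.range n).map h := by
  apply List.ext_getElem
  · simp
  · intro i h1 h2
    simp [← hgh]

theorem encodeInput_eq : encodeInput f γ adj = [n, k, f] ++ ((List.range n).map (colOf γ) ++
    ((List.range n).map (fun v => (adjOf adj v).length) ++
      ((List.range n).map (adjOf adj)).flatten)) := by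
  unfold encodeInput
  rw [ofFn_eq_map_range _ (colOf γ) (fun v => by simp [colOf]),
    ofFn_eq_map_range _ (fun v => (adjOf adj v).length) (fun v => by simp [adjOf]),
    ofFn_eq_map_range _ (adjOf adj) (fun v => by simp [adjOf])]
  simp

theorem length_encodeInput : (encodeInput f γ adj).length =
    3 + 2 * n + ∑ i ∈ Finset.range n, (adjOf adj i).length := by
  rw [encodeInput_eq, List.length_append, List.length_append, List.length_append,
    length_flatten_map_range]
  simp
  omega

theorem mem_adjOf {adj : Fin n → List (Fin n)} {u v : ℕ} :
    v ∈ adjOf adj u ↔ ∃ (hu : u < n) (hv : v < n), (⟨v, hv⟩ : Fin n) ∈ adj ⟨u, hu⟩ := by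
  unfold adjOf
  split_ifs with hu
  · simp only [List.mem_map, hu, exists_true_left]
    constructor
    · rintro ⟨x, hx, rfl⟩
      exact ⟨x.2, hx⟩
    · rintro ⟨hv, h⟩
      exact ⟨_, h, rfl⟩
  · simp [hu]

/-- The instance that is encoded by an input. -/
def instOf {G : SimpleGraph (Fin n)} (hn : 0 < n) (hadj : IsAdjacencyLists G adj) : Inst where
  n := n
  k := k
  f := f
  N := (encodeInput f γ adj).length
  col := colOf γ
  adj := adjOf adj
  off := fun v => 3 + 2 * n + ∑ i ∈ Finset.range v, (adjOf adj i).length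
  inp := fun a => (encodeInput f γ adj).getD a 0
  n_pos := hn
  adj_lt h := (mem_adjOf.1 h).2.1
  adj_symm h := by
    obtain ⟨hu, hv, h⟩ := mem_adjOf.1 h
    exact mem_adjOf.2 ⟨hv, hu, ((hadj _).2 _).2 (((hadj _).2 _).1 h).symm⟩
  adj_nodup u := by
    unfold adjOf
    split_ifs
    · exact (hadj _).1.map Fin.val_injective
    · exact List.nodup_nil
  col_lt hv := by simp [colOf, hv]
  off_zero := by simp
  off_succ v := by rw [Finset.sum_range_succ, ← add_assoc]
  off_n := (length_encodeInput f γ adj).symm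
  inp_zero := by simp [encodeInput_eq]
  inp_one := by simp [encodeInput_eq]
  inp_two := by simp [encodeInput_eq]
  inp_col {v} hv := by
    rw [encodeInput_eq, List.getD_append_right _ _ _ _ (by simp), List.getD_append _ _ _ _]
    · simp [hv]
    · simpa using hv
  inp_deg {v} hv := by
    rw [encodeInput_eq, List.getD_append_right _ _ _ _ (by simp; omega),
      List.getD_append_right _ _ _ _ (by simp; omega), List.getD_append _ _ _ _]
    · have : 3 + n + v - [n, k, f].length - ((List.range n).map (colOf γ)).length = v := by
        simp; omega
      rw [this]
      simp [hv]
    · simp; omega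
  inp_adj v j hj := by
    have hv : v < n := by
      by_contra hc
      simp [adjOf, hc] at hj
    rw [← getD_flatten_map_range (adjOf adj) hv hj, encodeInput_eq,
      List.getD_append_right _ _ _ _ (by simp; omega),
      List.getD_append_right _ _ _ _ (by simp; omega),
      List.getD_append_right _ _ _ _ (by simp; omega)]
    congr 1
    simp
    omega

variable {f γ adj}

theorem balanced_map_iff {G : SimpleGraph (Fin n)} (hn : 0 < n) (hadj : IsAdjacencyLists G adj)
    (L : Finset (Fin n)) : (instOf f γ adj hn hadj).Balanced (L.map Fin.valEmbedding) ↔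
      IsBalancedIndepSet G γ f L := by
  have hcard : ∀ c : Fin k, ((L.map Fin.valEmbedding).filter fun v => colOf γ v = c).card =
      (L.filter fun v => γ v = c).card := fun c => by
    rw [Finset.filter_map, Finset.card_map]
    congr 1
    refine Finset.filter_congr fun v _ => ?_
    simp [colOf, Fin.ext_iff]
  constructor
  · rintro ⟨-, h1, h2⟩
    refine ⟨fun u hu v hv _ huv => ?_, fun c => (hcard c).symm.trans (h2 c c.2)⟩
    exact h1 u (Finset.mem_map_of_mem Fin.valEmbedding hu) v
      (Finset.mem_map_of_mem Fin.valEmbedding hv) (mem_adjOf.2 ⟨u.2, v.2, ((hadj u).2 v).2 huv⟩)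
  · rintro ⟨h1, h2⟩
    refine ⟨fun v hv => ?_, fun u hu v hv huv => ?_, fun c hc => (hcard ⟨c, hc⟩).trans (h2 _)⟩
    · obtain ⟨x, -, rfl⟩ := Finset.mem_map.1 hv
      exact x.2
    · obtain ⟨x, hx, rfl⟩ := Finset.mem_map.1 hu
      obtain ⟨y, hy, rfl⟩ := Finset.mem_map.1 hv
      obtain ⟨_, _, h⟩ := mem_adjOf.1 huv
      have hxy := ((hadj x).2 y).1 h
      exact h1 hx hy hxy.ne hxy

/-- The vertex cover number is attained, and as `Fin n` is finite the passage to natural numbers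
loses nothing. -/
theorem exists_cover {G : SimpleGraph (Fin n)} (hn : 0 < n) (hadj : IsAdjacencyLists G adj) :
    ∃ T, (instOf f γ adj hn hadj).IsCover T ∧ T.card = G.vertexCoverNum.toNat ∧ T.card ≤ n := by
  obtain ⟨s, hs, hc⟩ := G.vertexCoverNum_exists
  refine ⟨s.toFinite.toFinset.map Fin.valEmbedding, fun u v h => ?_, ?_, ?_⟩
  · obtain ⟨hu, hv, h⟩ := mem_adjOf.1 h
    refine (hc (((hadj _).2 _).1 h)).imp (fun h => ?_) fun h => ?_ <;>
      exact Finset.mem_map.2 ⟨_, by simpa using h, rfl⟩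
  · rw [Finset.card_map, ← hs, Set.Finite.encard_eq_coe_toFinset_card s.toFinite, ENat.toNat_natCast]
  · rw [Finset.card_map]
    simpa using Finset.card_le_univ s.toFinite.toFinset

end

/-- One fixed program and one constant `C` serve all instances. The word length `w` need only be
large enough for the numbers up to `C` times the size of the input. -/
theorem theorem4 :
    ∃ (P : WordRAM.Prog) (C : ℕ),
      ∀ (n k f : ℕ) (G : SimpleGraph (Fin n)) (γ : Fin n → Fin k) (adj : Fin n → List (Fin n)),
        0 < n → IsIntervalGraph G → IsAdjacencyLists G adj →
        ∀ w : ℕ, C * ((encodeInput f γ adj).length + k + f) ≤ 2 ^ w →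
          ∃ (t : ℕ) (s : WordRAM.State),
            WordRAM.Exec w P (WordRAM.init (encodeInput f γ adj)) t s ∧
            t ≤ C * (2 ^ G.vertexCoverNum.toNat * n) ∧
            CorrectAnswer G γ f s := by
  -- The factor 76 absorbs the 1 in the time bound `weight * (i + 1)` with `i ≤ 75 * (2 ^ τ * n)`.
  -- The summand 64 makes the words long enough: the input has at least `3 + 2 * n` cells, so `Fits`
  -- follows.
  refine ⟨solve.compile, solve.weight * 76 + 64, fun n k f G γ adj hn _ hadj w hw => ?_⟩
  obtain ⟨T, hT, hTc, hTn⟩ := exists_cover (f := f) (γ := γ) hn hadj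
  have hlen := length_encodeInput f γ adj
  have hB : (instOf f γ adj hn hadj).Fits (2 ^ w) := by
    refine le_trans ?_ hw
    rw [add_mul]
    refine le_trans ?_ (Nat.le_add_left _ _)
    simp only [instOf]
    omega
  obtain ⟨σ, i, hex, hi, h1, hout, hans⟩ := runs_solve (σ := ⟨fun _ => 0,
    fun a => (encodeInput f γ adj).getD a 0, fun _ _ => 0⟩) hB rfl rfl hT hTn
  obtain ⟨t, hrun, ht⟩ := hex.exists_exec
  refine ⟨t, σ.toState (encodeInput f γ adj).length, ?_, ?_, ?_⟩
  · refine (congrArg (fun s₀ => WordRAM.Exec w solve.compile s₀ t (σ.toState _)) ?_).mpr hrun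
    -- Beyond the input all cells hold the default 0, which is what empty arrays look like in
    -- memory.
    simp only [WordRAM.init, ASt.toState, WordRAM.State.mk.injEq, true_and]
    funext a
    split_ifs with ha
    · rfl
    · exact List.getD_eq_default _ _ (not_lt.1 ha)
  · rw [hTc] at hi
    have hpos : 1 ≤ 2 ^ G.vertexCoverNum.toNat * n := Nat.mul_pos (by positivity) hn
    change i ≤ 75 * (2 ^ G.vertexCoverNum.toNat * n) at hi
    calc t ≤ solve.weight * (i + 1) := ht
      _ ≤ solve.weight * (76 * (2 ^ G.vertexCoverNum.toNat * n)) :=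
        Nat.mul_le_mul_left _ (by omega)
      _ ≤ _ := by rw [← mul_assoc]; exact Nat.mul_le_mul_right _ (Nat.le_add_right _ _)
  -- The arrays are interleaved with stride 16, whereas the output must be contiguous; it is read
  -- from the input cells from address 3 on, to which the selection was copied.
  · have hset : (outputSet n (σ.toState (encodeInput f γ adj).length)).map Fin.valEmbedding =
        (instOf f γ adj hn hadj).selected σ := by
      ext v
      simp only [Finset.mem_map, outputSet, Inst.selected, Finset.mem_filter, Finset.mem_univ,
        true_and, Finset.mem_range, Fin.valEmbedding_apply]
      have hmem : ∀ u : ℕ, u < n → (σ.toState (encodeInput f γ adj).length).mem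
          ((σ.toState (encodeInput f γ adj).length).reg 1 + u) = σ.arr 9 u := fun u hu => by
        have hr : (σ.toState (encodeInput f γ adj).length).reg 1 = 3 := h1
        rw [hr, ← hout u hu]
        simp only [ASt.toState]
        rw [if_pos (by omega)]
      constructor
      · rintro ⟨u, hu, rfl⟩
        rw [hmem u u.2] at hu
        exact ⟨u.2, hu⟩
      · rintro ⟨hv, h⟩
        exact ⟨⟨v, hv⟩, by rwa [hmem v hv], rfl⟩
    rcases hans with ⟨h0, hL⟩ | ⟨h0, hL⟩
    · rw [← hset, balanced_map_iff] at hL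
      exact .inl ⟨h0, hL⟩
    · exact .inr ⟨h0, fun ⟨L, h⟩ => hL _ ((balanced_map_iff hn hadj L).2 h)⟩
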